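/- Let $n\ge 2$. A convex body is a nonempty compact convex subset of $\mathbb{R}^n$, its support function is $h(K,u)=\max\{\langle x,u\rangle: x\in K\}$, and $K$ has constant width $1$ if $h(K,u)+h(K,-u)=1$ for all unit vectors $u\in\mathbb{S}^{n-1}$. Let $\mathcal{W}^n_1$ be the space of convex bodies of constant width $1$ in $\mathbb{R}^n$ with the Hausdorff metric. Let $K\in\mathcal{W}^n_1$ and $u\in\mathbb{S}^{n-1}$. Since $K$ is strictly convex, there is a unique point $x\in K$ with $\langle x,u\rangle=h(K,u)$. For a unit vector $t\perp u$ consider the planar section $C=K\cap(x+\operatorname{lin}\{u,t\})$. For a point $z$ of the relative boundary of $C$ with $\langle z-x,t\rangle>0$, let $r(z)\in[0,\infty]$ be the radius of the circle in this plane through $x$ and $z$ with centre on the ray $\{x-su:s\ge 0\}$ (with $r(z)=\infty$ if $\langle z-x,u\rangle=0$). The radius of curvature of $K$ at $u$ in direction $t$ exists and is equal to $\varrho\in[0,\infty]$ if $$\liminf_{z\to x}r(z)=\limsup_{z\to x}r(z)=\varrho .$$ Then a typical $K\in\mathcal{W}^n_1$ (that is, every $K$ in the complement of some meagre subset of $\mathcal{W}^n_1$)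 has the following property. For $\mathcal{H}^{n-1}$-almost every $u\in\mathbb{S}^{n-1}$, either the radius of curvature of $K$ at $u$ exists and is equal to $1$ in every direction $t\in u^\perp\cap\mathbb{S}^{n-1}$, or there is at least one direction $t\in u^\perp\cap\mathbb{S}^{n-1}$ in which the radius of curvature of $K$ at $u$ exists and is equal to $0$. -/

import Mathlib

open MeasureTheory Filter Topology Set
open scoped ENNReal NNReal RealInnerProductSpace

namespace ConstWidth

noncomputable section

/-- Euclidean space `ℝⁿ`. -/
abbrev E (n : ℕ) : Type := EuclideanSpace ℝ (Fin n)

variable {n : ℕ}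

/-- The support function `h(K, u) = max {⟨x, u⟩ : x ∈ K}`. -/
def supportFun (K : ConvexBody (E n)) (u : E n) : ℝ :=
  sSup ((fun x : E n => ⟪x, u⟫) '' (K : Set (E n)))

/-- `K` is of constant width `d`: `h(K, u) + h(K, -u) = d` for all unit vectors `u`. -/
def IsOfConstantWidth (K : ConvexBody (E n)) (d : ℝ) : Prop :=
  ∀ u : E n, ‖u‖ = 1 → supportFun K u + supportFun K (-u) = d

/-- The space `𝒲ⁿ₁` of convex bodies of constant width `1`. As a subtype of Mathlib's
`ConvexBody` it carries the Hausdorff metric. -/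
abbrev ConstantWidthBody (n : ℕ) : Type :=
  {K : ConvexBody (E n) // IsOfConstantWidth K 1}

/-- The support set `F(K, u) = H(K, u) ∩ K`. -/
def supportSet (K : ConvexBody (E n)) (u : E n) : Set (E n) :=
  {x | x ∈ K ∧ ⟪x, u⟫ = supportFun K u}

/-- The radius `r(z)` of the circle with centre on the ray `{x - r u : r ≥ 0}` that passes through
`x` and through `z`. There is exactly one such circle if `⟨z - x, u⟩ < 0`; if `z ≠ x` lies on the
supporting line `⟨z - x, u⟩ = 0`, there is none and the value is `∞`. -/
def circleRadius (x u z : E n) : ℝ≥0∞ :=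
  ⨅ (r : ℝ≥0) (_ : dist z (x - (r : ℝ) • u) = r), (r : ℝ≥0∞)

/-- The filter of points `z → x` in the part of the relative boundary of the planar convex
set `C` that lies in the open half-plane `{x + λ u + μ t : μ > 0}` of its plane. -/
def boundaryApproach (C : Set (E n)) (x t : E n) : Filter (E n) :=
  𝓝[intrinsicFrontier ℝ C ∩ {z | 0 < ⟪z - x, t⟫}] x

/-- The lower radius of curvature of the two-dimensional convex set `C` (in a plane
`x + lin {u, t}`) at the support element `(x, u)` in direction `t`. -/
def planarLowerRadius (C : Set (E n)) (x u t : E n) : ℝ≥0∞ :=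
  liminf (circleRadius x u) (boundaryApproach C x t)

/-- The upper radius of curvature of the two-dimensional convex set `C` (in a plane
`x + lin {u, t}`) at the support element `(x, u)` in direction `t`. -/
def planarUpperRadius (C : Set (E n)) (x u t : E n) : ℝ≥0∞ :=
  limsup (circleRadius x u) (boundaryApproach C x t)

/-- The plane `x + lin {u, t}`. -/
def sectionPlane (x u t : E n) : AffineSubspace ℝ (E n) :=
  AffineSubspace.mk' x (Submodule.span ℝ {u, t})

/-- The planar section `K ∩ (x + lin {u, t})`. -/
def planarSection (K : ConvexBody (E n)) (x u t : E n) : Set (E n) :=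
  (K : Set (E n)) ∩ (sectionPlane x u t : Set (E n))

/-- `u` is a regular normal vector of `K`, with unique support point `x`, and the (sectional)
radius of curvature of `K` at `u` in direction `t` exists and equals `ρ`: the lower and the upper
radius of curvature of the planar section coincide and have the value `ρ`. -/
def HasRadiusOfCurvature (K : ConvexBody (E n)) (u t : E n) (ρ : ℝ≥0∞) : Prop :=
  ∃ x : E n, supportSet K u = {x} ∧
    planarLowerRadius (planarSection K x u t) x u t = ρ ∧
    planarUpperRadius (planarSection K x u t) x u t = ρ

end

end ConstWidth

/-!
Write `x(v)` for the point of `K` with outer normal `v`. Constant width makes `x` firmly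
nonexpansive on the sphere, so at a point `v` of differentiability its derivative `A` satisfies
`⟪A z, z⟫ ≥ ‖v‖ ‖A z‖ ^ 2`. Call the difference of the two sides the defect of `K` at `v` in
direction `z`. If it vanishes in all directions at a unit vector `u`, then `A` is an orthogonal
projection. Either `A` is the identity on the orthogonal complement of `u`, and all radii of
curvature at `u` are `1`, or `A` annihilates some `t` orthogonal to `u`, and the radius of curvature
in direction `t` is `0`.

It remains to see that the defect of a typical body vanishes almost everywhere, and by Baire's
theorem it is enough that the bodies with small total defect are dense, since replacing `A` by a
difference quotient makes the total defect continuous in `K`. Near a point with positive defect the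
support function can be perturbed by a high-frequency ridge `cos (k ⟪t, y⟫ + α) / k ^ 2`: it is
uniformly small but raises the mean square of the second derivative, the energy, by a definite
amount. A perturbation on one hemisphere, continued oddly to the opposite one, preserves constant
width. As the energy of all bodies is uniformly bounded, only finitely many such steps are possible.
-/

namespace ConstWidth

noncomputable section

open NormedSpace

section Gradient

variable {F : Type*} [NormedAddCommGroup F] [InnerProductSpace ℝ F]

theorem monotone_of_eventually_nhdsGT_le {α β : Type*} [ConditionallyCompleteLinearOrder α]
    [DenselyOrdered α] [TopologicalSpace α] [OrderTopology α] [Preorder β] [TopologicalSpace β]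
    [OrderClosedTopology β] {φ : α → β} (hφ : Continuous φ)
    (hloc : ∀ s, ∀ᶠ s' in 𝓝[>] s, φ s ≤ φ s') : Monotone φ := by
  intro a b hab
  have hclosed : IsClosed ({s | φ a ≤ φ s} ∩ Icc a b) :=
    (isClosed_le continuous_const hφ).inter isClosed_Icc
  refine hclosed.Icc_subset_of_forall_mem_nhdsWithin le_rfl (fun s hs => ?_) ⟨hab, le_rfl⟩
  filter_upwards [hloc s] with s' hs' using le_trans hs.1 hs'

theorem convexOn_univ_of_lineMap {V : Type*} [AddCommGroup V] [Module ℝ V] {f : V → ℝ}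
    (h : ∀ a b : V, ConvexOn ℝ univ fun s : ℝ => f (AffineMap.lineMap a b s)) :
    ConvexOn ℝ univ f := by
  refine ⟨convex_univ, fun a _ b _ p q hp hq hpq => ?_⟩
  have := (h a b).2 (mem_univ 0) (mem_univ 1) hp hq hpq
  simp only [smul_eq_mul, mul_zero, mul_one, zero_add, AffineMap.lineMap_apply_zero,
    AffineMap.lineMap_apply_one] at this
  rwa [AffineMap.lineMap_apply_module, ← eq_sub_of_add_eq hpq] at this

theorem hasDerivAt_comp_lineMap {V : Type*} [NormedAddCommGroup V] [NormedSpace ℝ V] {f : V → ℝ}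
    {f' : V →L[ℝ] ℝ} {a b : V} {s : ℝ} (hf : HasFDerivAt f f' (AffineMap.lineMap a b s)) :
    HasDerivAt (fun s : ℝ => f (AffineMap.lineMap a b s)) (f' (b - a)) s :=
  hf.comp_hasDerivAt s AffineMap.hasDerivAt_lineMap

theorem convexOn_univ_of_gradient {f : F → ℝ} {g : F → F}
    (hf : ∀ y, HasFDerivAt f (innerSL ℝ (g y)) y) (hg : Continuous g)
    (hloc : ∀ y, ∀ᶠ w in 𝓝 y, 0 ≤ ⟪g w - g y, w - y⟫) : ConvexOn ℝ univ f := by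
  refine convexOn_univ_of_lineMap fun a b => ?_
  have hderiv (s : ℝ) : HasDerivAt (fun s : ℝ => f (AffineMap.lineMap a b s))
      ⟪g (AffineMap.lineMap a b s), b - a⟫ s := hasDerivAt_comp_lineMap (hf _)
  have hline : Continuous (AffineMap.lineMap a b : ℝ → F) := AffineMap.lineMap_continuous
  refine Monotone.convexOn_univ_of_deriv (fun s => (hderiv s).differentiableAt) ?_
  rw [funext fun s => (hderiv s).deriv]
  refine monotone_of_eventually_nhdsGT_le (by fun_prop) fun s => ?_
  filter_upwards [nhdsWithin_le_nhds (hline.continuousAt.eventually (hloc _)),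
    self_mem_nhdsWithin] with s' hs' hlt
  have hdiff : (AffineMap.lineMap a b s' : F) - AffineMap.lineMap a b s = (s' - s) • (b - a) := by
    simp only [AffineMap.lineMap_apply_module', sub_smul]
    abel
  rw [hdiff, inner_smul_right, inner_sub_left] at hs'
  exact sub_nonneg.1 (nonneg_of_mul_nonneg_right hs' (sub_pos.2 hlt))

theorem hasFDerivAt_sub_gradient {f₁ f₂ : F → ℝ} {g₁ g₂ y : F}
    (h₁ : HasFDerivAt f₁ (innerSL ℝ g₁) y) (h₂ : HasFDerivAt f₂ (innerSL ℝ g₂) y) :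
    HasFDerivAt (fun y => f₁ y - f₂ y) (innerSL ℝ (g₁ - g₂)) y := by
  rw [map_sub]
  exact h₁.sub h₂

theorem abs_sub_le_of_gradient_norm_le {s : Set F} {f : F → ℝ} {g : F → F} {C : ℝ}
    (hs : Convex ℝ s) (hf : ∀ y ∈ s, HasFDerivAt f (innerSL ℝ (g y)) y)
    (hg : ∀ y ∈ s, ‖g y‖ ≤ C) {v w : F} (hv : v ∈ s) (hw : w ∈ s) :
    |f v - f w| ≤ C * ‖v - w‖ :=
  hs.norm_image_sub_le_of_norm_hasFDerivWithin_le (fun y hy => (hf y hy).hasFDerivWithinAt)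
    (fun y hy => (innerSL_apply_norm ℝ (g y)).trans_le (hg y hy)) hw hv

theorem hasFDerivAt_inner_sub (t y₀ y : F) :
    HasFDerivAt (fun y => ⟪t, y - y₀⟫) (innerSL ℝ t) y := by
  simp only [inner_sub_right]
  exact (innerSL ℝ t).hasFDerivAt.sub_const ⟪t, y₀⟫

theorem hasFDerivAt_quadratic (c : ℝ) (g₀ y₀ : F) {H : F →L[ℝ] F}
    (hsymm : ∀ a b, ⟪H a, b⟫ = ⟪a, H b⟫) (y : F) :
    HasFDerivAt (fun y => c + ⟪g₀, y - y₀⟫ + 1 / 2 * ⟪H (y - y₀), y - y₀⟫)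
      (innerSL ℝ (g₀ + H (y - y₀))) y := by
  have hsub : HasFDerivAt (fun y : F => y - y₀) (ContinuousLinearMap.id ℝ F) y :=
    (hasFDerivAt_id y).sub_const y₀
  have hlin : HasFDerivAt (fun y => ⟪g₀, y - y₀⟫) (innerSL ℝ g₀) y := hasFDerivAt_inner_sub g₀ y₀ y
  have hquad := (H.hasFDerivAt.comp y hsub).inner ℝ hsub
  refine ((hlin.const_add c).add (hquad.const_mul (1 / 2))).congr_fderiv ?_
  ext d
  have hswap : ⟪H d, y - y₀⟫ = ⟪H (y - y₀), d⟫ := by rw [hsymm, real_inner_comm]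
  simp only [add_apply, smul_apply, innerSL_apply_apply,
    ContinuousLinearMap.comp_apply, ContinuousLinearMap.prod_apply, ContinuousLinearMap.id_apply,
    fderivInnerCLM_apply, smul_eq_mul, inner_add_left, Function.comp, hswap]
  ring

theorem eventually_taylor_of_gradient {f : F → ℝ} {g : F → F} {y₀ : F} {H : F →L[ℝ] F}
    (hf : ∀ᶠ y in 𝓝 y₀, HasFDerivAt f (innerSL ℝ (g y)) y) (hg : HasFDerivAt g H y₀)
    (hsymm : ∀ a b, ⟪H a, b⟫ = ⟪a, H b⟫) {η : ℝ} (hη : 0 < η) :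
    ∀ᶠ y in 𝓝 y₀, ‖g y - (g y₀ + H (y - y₀))‖ ≤ η * ‖y - y₀‖ ∧
      |f y - (f y₀ + ⟪g y₀, y - y₀⟫ + 1 / 2 * ⟪H (y - y₀), y - y₀⟫)| ≤ η * ‖y - y₀‖ ^ 2 := by
  have hlin : ∀ᶠ y in 𝓝 y₀, ‖g y - (g y₀ + H (y - y₀))‖ ≤ η * ‖y - y₀‖ := by
    simpa only [sub_sub] using (hasFDerivAt_iff_isLittleO.1 hg).def hη
  obtain ⟨ρ, hρ, h⟩ := Metric.eventually_nhds_iff_ball.1 (hf.and hlin)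
  filter_upwards [Metric.ball_mem_nhds y₀ hρ] with y hy
  refine ⟨(h y hy).2, ?_⟩
  have hsub : Metric.closedBall y₀ ‖y - y₀‖ ⊆ Metric.ball y₀ ρ :=
    Metric.closedBall_subset_ball (mem_ball_iff_norm.1 hy)
  have hmv := abs_sub_le_of_gradient_norm_le (C := η * ‖y - y₀‖)
    (convex_closedBall y₀ ‖y - y₀‖)
    (fun w hw => hasFDerivAt_sub_gradient (h w (hsub hw)).1
      (hasFDerivAt_quadratic (f y₀) (g y₀) y₀ hsymm w))
    (fun w hw => (h w (hsub hw)).2.trans <| by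
      gcongr
      exact mem_closedBall_iff_norm.1 hw)
    (mem_closedBall_iff_norm.2 le_rfl) (Metric.mem_closedBall_self (norm_nonneg _))
  calc _ = |f y - (f y₀ + ⟪g y₀, y - y₀⟫ + 1 / 2 * ⟪H (y - y₀), y - y₀⟫)
        - (f y₀ - (f y₀ + ⟪g y₀, y₀ - y₀⟫ + 1 / 2 * ⟪H (y₀ - y₀), y₀ - y₀⟫))| := by simp
    _ ≤ η * ‖y - y₀‖ * ‖y - y₀‖ := hmv
    _ = η * ‖y - y₀‖ ^ 2 := by ring

theorem abs_inner_smul_le {a α β : ℝ} {x z : F} (ha : |a| ≤ α) (hx : ‖x‖ ≤ β) :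
    |⟪a • x, z⟫| ≤ α * β * ‖z‖ := by
  refine (abs_real_inner_le_norm _ _).trans ?_
  rw [norm_smul, Real.norm_eq_abs]
  gcongr
  exact (abs_nonneg a).trans ha

/-- The gradient of `χ (P - f)`, where `g`, `p`, `ξ` are the gradients of `f`, `P`, `χ`: for a
cutoff function `χ`, adding it to `g` glues `p` into `g`. -/
def gluingGradient (f P χ : F → ℝ) (g p ξ : F → F) (y : F) : F :=
  χ y • (p y - g y) + (P y - f y) • ξ y

theorem hasFDerivAt_mul_sub {f P χ : F → ℝ} {g p ξ : F → F} {y : F}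
    (hf : HasFDerivAt f (innerSL ℝ (g y)) y) (hP : HasFDerivAt P (innerSL ℝ (p y)) y)
    (hχ : HasFDerivAt χ (innerSL ℝ (ξ y)) y) :
    HasFDerivAt (fun y => χ y * (P y - f y)) (innerSL ℝ (gluingGradient f P χ g p ξ y)) y := by
  refine (hχ.mul (hasFDerivAt_sub_gradient hP hf)).congr_fderiv ?_
  simp only [gluingGradient, map_add, map_smul]

/-- The error is quadratic in `‖v - w‖` with a factor `η` because `P` is close to `f` to second
order, which compensates for the growth of the derivatives of the cutoff function as `ρ → 0`. -/
theorem abs_inner_gluingGradient_sub_le {f P χ : F → ℝ} {g p ξ : F → F} {y₀ : F} {ρ η C : ℝ}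
    (hρ : 0 < ρ) (hf : ∀ y, HasFDerivAt f (innerSL ℝ (g y)) y)
    (hP : ∀ y, HasFDerivAt P (innerSL ℝ (p y)) y) (hχ : ∀ y, HasFDerivAt χ (innerSL ℝ (ξ y)) y)
    (hξ : ∀ v, ‖ξ v‖ ≤ C / ρ) (hξ_lip : ∀ v w, ‖ξ v - ξ w‖ ≤ C / ρ ^ 2 * ‖v - w‖)
    (hdist : ∀ y ∈ Metric.ball y₀ ρ, |P y - f y| ≤ η * ρ ^ 2)
    (hgrad : ∀ y ∈ Metric.ball y₀ ρ, ‖p y - g y‖ ≤ η * ρ)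
    {v w : F} (hv : v ∈ Metric.ball y₀ ρ) (hw : w ∈ Metric.ball y₀ ρ) :
    |⟪(g v + gluingGradient f P χ g p ξ v) - (g w + gluingGradient f P χ g p ξ w), v - w⟫
      - ((1 - χ v) * ⟪g v - g w, v - w⟫ + χ v * ⟪p v - p w, v - w⟫)|
      ≤ 3 * C * η * ‖v - w‖ ^ 2 := by
  have hlip : |(P v - f v) - (P w - f w)| ≤ η * ρ * ‖v - w‖ :=
    abs_sub_le_of_gradient_norm_le (convex_ball _ _)
      (fun y _ => hasFDerivAt_sub_gradient (hP y) (hf y)) hgrad hv hw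
  have hχ_lip : |χ v - χ w| ≤ C / ρ * ‖v - w‖ :=
    abs_sub_le_of_gradient_norm_le convex_univ (fun y _ => hχ y) (fun y _ => hξ y)
      (mem_univ v) (mem_univ w)
  have hsplit : ⟪(g v + gluingGradient f P χ g p ξ v) - (g w + gluingGradient f P χ g p ξ w), v - w⟫
      - ((1 - χ v) * ⟪g v - g w, v - w⟫ + χ v * ⟪p v - p w, v - w⟫) =
      ⟪(χ v - χ w) • (p w - g w), v - w⟫ + ⟪((P v - f v) - (P w - f w)) • ξ v, v - w⟫
      + ⟪(P w - f w) • (ξ v - ξ w), v - w⟫ := by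
    simp only [gluingGradient, inner_sub_left, inner_add_left, inner_smul_left, RCLike.conj_to_real]
    ring
  rw [hsplit]
  calc _ ≤ C / ρ * ‖v - w‖ * (η * ρ) * ‖v - w‖ + η * ρ * ‖v - w‖ * (C / ρ) * ‖v - w‖
        + η * ρ ^ 2 * (C / ρ ^ 2 * ‖v - w‖) * ‖v - w‖ :=
      (abs_add_three _ _ _).trans (add_le_add_three (abs_inner_smul_le hχ_lip (hgrad w hw))
        (abs_inner_smul_le hlip (hξ v)) (abs_inner_smul_le (hdist w hw) (hξ_lip v w)))
    _ = 3 * C * η * ‖v - w‖ ^ 2 := by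
      field_simp
      ring

end Gradient

section Cutoff

variable {F : Type*} [NormedAddCommGroup F] [InnerProductSpace ℝ F]

/-- `χ` is a cutoff function with gradient `ξ`, equal to `1` on the ball of radius `(1 - θ) ρ`
around `y₀` and to `0` outside the ball of radius `(1 - θ / 2) ρ`; the constant `C` controls the
growth of its derivatives as `ρ → 0`. -/
structure IsCutoff (C θ : ℝ) (y₀ : F) (ρ : ℝ) (χ : F → ℝ) (ξ : F → F) : Prop where
  hasFDerivAt : ∀ y, HasFDerivAt χ (innerSL ℝ (ξ y)) y
  continuous_gradient : Continuous ξ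
  nonneg : ∀ y, 0 ≤ χ y
  le_one : ∀ y, χ y ≤ 1
  norm_gradient_le : ∀ v, ‖ξ v‖ ≤ C / ρ
  norm_gradient_sub_le : ∀ v w, ‖ξ v - ξ w‖ ≤ C / ρ ^ 2 * ‖v - w‖
  eq_one : ∀ y ∈ Metric.ball y₀ ((1 - θ) * ρ), χ y = 1
  eq_zero : ∀ y, (1 - θ / 2) * ρ ≤ ‖y - y₀‖ → χ y = 0

theorem gradient_eq_zero_of_isLocalExtr {f : F → ℝ} {g y : F} (h : IsLocalExtr f y)
    (hf : HasFDerivAt f (innerSL ℝ g) y) : g = 0 := by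
  rw [← norm_eq_zero, ← innerSL_apply_norm ℝ, h.hasFDerivAt_eq_zero hf, norm_zero]

namespace IsCutoff

variable {C θ ρ : ℝ} {y₀ y : F} {χ : F → ℝ} {ξ : F → F}

theorem gradient_eq_zero_of_eq_one (h : IsCutoff C θ y₀ ρ χ ξ) (hy : χ y = 1) : ξ y = 0 :=
  gradient_eq_zero_of_isLocalExtr
    (Or.inr (Eventually.of_forall fun w => (h.le_one w).trans_eq hy.symm)) (h.hasFDerivAt y)

theorem gradient_eq_zero_of_eq_zero (h : IsCutoff C θ y₀ ρ χ ξ) (hy : χ y = 0) : ξ y = 0 :=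
  gradient_eq_zero_of_isLocalExtr
    (Or.inl (Eventually.of_forall fun w => hy.trans_le (h.nonneg w))) (h.hasFDerivAt y)

theorem rescale (h : IsCutoff C θ 0 1 χ ξ) (y₀ : F) (hρ : 0 < ρ) :
    IsCutoff C θ y₀ ρ (fun y => χ (ρ⁻¹ • (y - y₀))) fun y => ρ⁻¹ • ξ (ρ⁻¹ • (y - y₀)) := by
  have hinv : ‖ρ⁻¹‖ = ρ⁻¹ := by rw [norm_inv, Real.norm_of_nonneg hρ.le]
  have hnorm (y : F) : ‖ρ⁻¹ • (y - y₀)‖ = ρ⁻¹ * ‖y - y₀‖ := by rw [norm_smul, hinv]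
  have hscale (y : F) : HasFDerivAt (fun y => ρ⁻¹ • (y - y₀))
      (ρ⁻¹ • ContinuousLinearMap.id ℝ F) y := ((hasFDerivAt_id y).sub_const y₀).const_smul ρ⁻¹
  have hξ := h.continuous_gradient
  refine ⟨fun y => ?_, by fun_prop, fun y => h.nonneg _, fun y => h.le_one _, fun v => ?_,
    fun v w => ?_, fun y hy => h.eq_one _ ?_, fun y hy => h.eq_zero _ ?_⟩
  · refine ((h.hasFDerivAt _).comp y (hscale y)).congr_fderiv ?_
    ext d
    simp only [ContinuousLinearMap.comp_apply, smul_apply, ContinuousLinearMap.id_apply,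
      innerSL_apply_apply, inner_smul_left, inner_smul_right, RCLike.conj_to_real]
  · rw [norm_smul, hinv, div_eq_inv_mul]
    gcongr
    simpa only [div_one] using h.norm_gradient_le (ρ⁻¹ • (v - y₀))
  · have hlip := h.norm_gradient_sub_le (ρ⁻¹ • (v - y₀)) (ρ⁻¹ • (w - y₀))
    rw [← smul_sub, sub_sub_sub_cancel_right, norm_smul, hinv] at hlip
    rw [← smul_sub, norm_smul, hinv]
    calc ρ⁻¹ * ‖ξ (ρ⁻¹ • (v - y₀)) - ξ (ρ⁻¹ • (w - y₀))‖
        ≤ ρ⁻¹ * (C / 1 ^ 2 * (ρ⁻¹ * ‖v - w‖)) := by gcongr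
      _ = C / ρ ^ 2 * ‖v - w‖ := by field_simp
  · rw [mem_ball_zero_iff, hnorm, inv_mul_lt_iff₀ hρ, mul_one, mul_comm]
    exact mem_ball_iff_norm.1 hy
  · rwa [mul_one, sub_zero, hnorm, le_inv_mul_iff₀ hρ, mul_comm]

end IsCutoff

theorem exists_isCutoff_zero_one [FiniteDimensional ℝ F] {θ : ℝ} (hθ : 0 < θ) (hθ₁ : θ < 1) :
    ∃ (C : ℝ) (χ : F → ℝ) (ξ : F → F), IsCutoff C θ 0 1 χ ξ := by
  let b : ContDiffBump (0 : F) := ⟨1 - θ, 1 - θ / 2, by linarith, by linarith⟩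
  have hb : ContDiff ℝ 2 b := b.contDiff
  have hb' : ContDiff ℝ 1 (fderiv ℝ b) := hb.fderiv_right (by norm_num)
  obtain ⟨C₁, hC₁⟩ := hb.lipschitzWith_of_hasCompactSupport b.hasCompactSupport (by norm_num)
  obtain ⟨C₂, hC₂⟩ := hb'.lipschitzWith_of_hasCompactSupport
    (b.hasCompactSupport.fderiv (𝕜 := ℝ)) (by norm_num)
  refine ⟨C₁ + C₂, b, fun y => (InnerProductSpace.toDual ℝ F).symm (fderiv ℝ b y), fun y => ?_,
    (InnerProductSpace.toDual ℝ F).symm.continuous.comp hb'.continuous, fun y => b.nonneg,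
    fun y => b.le_one, fun v => ?_, fun v w => ?_, fun y hy => ?_, fun y hy => ?_⟩
  · refine (hb.differentiable (by norm_num) y).hasFDerivAt.congr_fderiv ?_
    ext d
    rw [innerSL_apply_apply, InnerProductSpace.toDual_symm_apply]
  · rw [LinearIsometryEquiv.norm_map, div_one]
    exact (norm_fderiv_le_of_lipschitz ℝ hC₁).trans (le_add_of_nonneg_right C₂.2)
  · rw [← map_sub, LinearIsometryEquiv.norm_map, one_pow, div_one]
    refine (hC₂.norm_sub_le v w).trans ?_
    gcongr
    exact le_add_of_nonneg_left C₁.2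
  · rw [mul_one] at hy
    exact b.one_of_mem_closedBall (Metric.ball_subset_closedBall hy)
  · rw [mul_one, ← dist_eq_norm] at hy
    exact b.zero_of_le_dist hy

theorem exists_isCutoff [FiniteDimensional ℝ F] {θ : ℝ} (hθ : 0 < θ) (hθ₁ : θ < 1) :
    ∃ C ≥ 0, ∀ (y₀ : F) (ρ : ℝ), 0 < ρ → ∃ χ ξ, IsCutoff C θ y₀ ρ χ ξ := by
  obtain ⟨C, χ, ξ, h⟩ := exists_isCutoff_zero_one (F := F) hθ hθ₁
  refine ⟨C, ?_, fun y₀ ρ hρ => ⟨_, _, h.rescale y₀ hρ⟩⟩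
  simpa only [div_one] using (norm_nonneg _).trans (h.norm_gradient_le 0)

end Cutoff

section Pinching

variable {F : Type*} [NormedAddCommGroup F] [InnerProductSpace ℝ F]

/-- The increments of `g` in the direction of the increment of the argument lie between the `ε`-fold
and the `(1 - ε)`-fold of those of `ν`. For gradients `ν` and `g` of functions `F` and `f` this
says that `f - ε F` and `(1 - ε) F - f` are convex. -/
def IsPinchedOn (ε : ℝ) (ν g : F → F) (s : Set F) : Prop :=
  ∀ v ∈ s, ∀ w ∈ s, ε * ⟪ν v - ν w, v - w⟫ ≤ ⟪g v - g w, v - w⟫ ∧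
    ⟪g v - g w, v - w⟫ ≤ (1 - ε) * ⟪ν v - ν w, v - w⟫

theorem tendsto_add_smul_nhdsGT_zero (y d : F) :
    Tendsto (fun s : ℝ => y + s • d) (𝓝[>] 0) (𝓝 y) := by
  have hcont : Continuous fun s : ℝ => y + s • d := by fun_prop
  simpa only [zero_smul, add_zero] using (hcont.tendsto 0).mono_left nhdsWithin_le_nhds

theorem inner_fderiv_nonneg {q : F → F} {Q : F →L[ℝ] F} {y₀ : F}
    (hq : ∀ᶠ v in 𝓝 y₀, 0 ≤ ⟪q v - q y₀, v - y₀⟫) (hQ : HasFDerivAt q Q y₀) (d : F) :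
    0 ≤ ⟪Q d, d⟫ := by
  refine ge_of_tendsto
    ((hQ.hasLineDerivAt d).tendsto_slope_zero_right.inner (tendsto_const_nhds (x := d))) ?_
  filter_upwards [self_mem_nhdsWithin, (tendsto_add_smul_nhdsGT_zero y₀ d).eventually hq]
    with s (hs : 0 < s) hqs
  rw [add_sub_cancel_left, inner_smul_right] at hqs
  rw [real_inner_smul_left]
  exact mul_nonneg (inv_pos.2 hs).le (nonneg_of_mul_nonneg_right hqs hs)

theorem IsPinchedOn.fderiv {ε : ℝ} {ν g : F → F} {s : Set F} {y₀ : F} {M H : F →L[ℝ] F}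
    (h : IsPinchedOn ε ν g s) (hs : s ∈ 𝓝 y₀) (hν : HasFDerivAt ν M y₀) (hg : HasFDerivAt g H y₀)
    (d : F) : ε * ⟪M d, d⟫ ≤ ⟪H d, d⟫ ∧ ⟪H d, d⟫ ≤ (1 - ε) * ⟪M d, d⟫ := by
  have hpinched : ∀ᶠ v in 𝓝 y₀, ε * ⟪ν v - ν y₀, v - y₀⟫ ≤ ⟪g v - g y₀, v - y₀⟫ ∧
      ⟪g v - g y₀, v - y₀⟫ ≤ (1 - ε) * ⟪ν v - ν y₀, v - y₀⟫ :=
    eventually_of_mem hs fun v hv => h v hv y₀ (mem_of_mem_nhds hs)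
  have hlow := inner_fderiv_nonneg (q := g - ε • ν) (hpinched.mono fun v hv => by
    simp only [Pi.sub_apply, Pi.smul_apply, inner_sub_left, real_inner_smul_left] at hv ⊢
    linarith [hv.1]) (hg.sub (hν.const_smul ε)) d
  have hup := inner_fderiv_nonneg (q := (1 - ε) • ν - g) (hpinched.mono fun v hv => by
    simp only [Pi.sub_apply, Pi.smul_apply, inner_sub_left, real_inner_smul_left] at hv ⊢
    linarith [hv.2]) ((hν.const_smul (1 - ε)).sub hg) d
  simp only [sub_apply, smul_apply, inner_sub_left, real_inner_smul_left] at hlow hup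
  exact ⟨sub_nonneg.1 hlow, sub_nonneg.1 hup⟩

theorem isPinchedOn_add_gluingGradient {f P χ : F → ℝ} {g p ξ ν : F → F} {y₀ : F}
    {C θ ρ η ε lam : ℝ} (hρ : 0 < ρ) (hη : 0 ≤ η) (hε : 0 ≤ ε) (hlam : 0 ≤ lam)
    (hη_le : (1 + 3 * C) * η ≤ ε / 4 * lam) (hf : ∀ y, HasFDerivAt f (innerSL ℝ (g y)) y)
    (hP : ∀ y, HasFDerivAt P (innerSL ℝ (p y)) y) (hχ : IsCutoff C θ y₀ ρ χ ξ)
    (hclose : ∀ y ∈ Metric.ball y₀ ρ, |P y - f y| ≤ η * ρ ^ 2 ∧ ‖p y - g y‖ ≤ η * ρ)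
    (hν : ∀ v ∈ Metric.ball y₀ ρ, ∀ w ∈ Metric.ball y₀ ρ,
      lam * ‖v - w‖ ^ 2 ≤ ⟪ν v - ν w, v - w⟫)
    (hg : IsPinchedOn ε ν g (Metric.ball y₀ ρ))
    (hp : ∀ v ∈ Metric.ball y₀ ρ, ∀ w ∈ Metric.ball y₀ ρ, ⟪p v - p w, v - w⟫ ∈
      Icc (ε / 2 * ⟪ν v - ν w, v - w⟫ - η * ‖v - w‖ ^ 2)
        ((1 - ε / 2) * ⟪ν v - ν w, v - w⟫ + η * ‖v - w‖ ^ 2)) :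
    IsPinchedOn (ε / 4) ν (fun y => g y + gluingGradient f P χ g p ξ y) (Metric.ball y₀ ρ) := by
  intro v hv w hw
  set L := ⟪ν v - ν w, v - w⟫
  have hL : ε / 4 * (lam * ‖v - w‖ ^ 2) ≤ ε / 4 * L := by gcongr; exact hν v hv w hw
  have hL_nonneg : 0 ≤ ε * L := mul_nonneg hε (le_trans (by positivity) (hν v hv w hw))
  have hη_sq : 0 ≤ η * ‖v - w‖ ^ 2 := by positivity
  have hη_le_sq : (1 + 3 * C) * η * ‖v - w‖ ^ 2 ≤ ε / 4 * lam * ‖v - w‖ ^ 2 := by gcongr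
  have hgv : ⟪g v - g w, v - w⟫ ∈
      Icc (ε / 2 * L - η * ‖v - w‖ ^ 2) ((1 - ε / 2) * L + η * ‖v - w‖ ^ 2) := by
    obtain ⟨hlow, hup⟩ := hg v hv w hw
    constructor <;> linarith
  have hcombination := convex_Icc _ _ hgv (hp v hv w hw) (sub_nonneg.2 (hχ.le_one v))
    (hχ.nonneg v) (sub_add_cancel 1 (χ v))
  have herror := abs_le.1 (abs_inner_gluingGradient_sub_le hρ hf hP hχ.hasFDerivAt
    hχ.norm_gradient_le hχ.norm_gradient_sub_le (fun y hy => (hclose y hy).1)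
    (fun y hy => (hclose y hy).2) hv hw)
  simp only [smul_eq_mul, mem_Icc] at hcombination
  constructor <;> linarith [hcombination.1, hcombination.2, herror.1, herror.2]

end Pinching

section Ridge

variable {F : Type*} [NormedAddCommGroup F] [InnerProductSpace ℝ F]

/-- A second-order Taylor polynomial at `y₀` plus an oscillation of frequency `k` and phase `α` in
the direction `t`, with an amplitude for which its second derivative is `½ cos(…) t ⊗ t`. -/
def ridgeModel (c₀ : ℝ) (g₀ y₀ t : F) (H : F →L[ℝ] F) (k α : ℝ) (y : F) : ℝ :=
  c₀ + ⟪g₀, y - y₀⟫ + 1 / 2 * ⟪H (y - y₀), y - y₀⟫ +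
    -(1 / (2 * k ^ 2)) * Real.cos (k * ⟪t, y - y₀⟫ + α)

/-- The gradient of `ridgeModel`. -/
def ridgeField (g₀ y₀ t : F) (H : F →L[ℝ] F) (k α : ℝ) (y : F) : F :=
  g₀ + H (y - y₀) + (1 / (2 * k) * Real.sin (k * ⟪t, y - y₀⟫ + α)) • t

variable {g₀ y₀ t : F} {H : F →L[ℝ] F} {k α : ℝ}

theorem continuous_ridgeField : Continuous (ridgeField g₀ y₀ t H k α) := by
  unfold ridgeField
  fun_prop

theorem hasFDerivAt_ridgeModel (c₀ : ℝ) (hsymm : ∀ a b, ⟪H a, b⟫ = ⟪a, H b⟫) (hk : 0 < k) (y : F) :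
    HasFDerivAt (ridgeModel c₀ g₀ y₀ t H k α) (innerSL ℝ (ridgeField g₀ y₀ t H k α y)) y := by
  have hosc := ((((hasFDerivAt_inner_sub t y₀ y).const_mul k).add_const α).cos).const_mul
    (-(1 / (2 * k ^ 2)))
  refine ((hasFDerivAt_quadratic c₀ g₀ y₀ hsymm y).add hosc).congr_fderiv ?_
  rw [ridgeField, map_add (innerSL ℝ) (g₀ + _)]
  congr 1
  ext d
  simp only [smul_apply, innerSL_apply_apply, real_inner_smul_left, smul_eq_mul]
  field_simp

theorem abs_ridgeModel_sub_le (c₀ : ℝ) (y : F) :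
    |ridgeModel c₀ g₀ y₀ t H k α y - (c₀ + ⟪g₀, y - y₀⟫ + 1 / 2 * ⟪H (y - y₀), y - y₀⟫)| ≤
      1 / (2 * k ^ 2) := by
  rw [ridgeModel, add_sub_cancel_left, abs_mul, abs_neg, abs_of_nonneg (by positivity)]
  exact mul_le_of_le_one_right (by positivity) (Real.abs_cos_le_one _)

theorem norm_ridgeField_sub_le (hk : 0 < k) (y : F) :
    ‖ridgeField g₀ y₀ t H k α y - (g₀ + H (y - y₀))‖ ≤ 1 / (2 * k) * ‖t‖ := by
  rw [ridgeField, add_sub_cancel_left, norm_smul, Real.norm_eq_abs, abs_mul,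
    abs_of_pos (by positivity : 0 < 1 / (2 * k))]
  gcongr
  exact mul_le_of_le_one_right (by positivity) (Real.abs_sin_le_one _)

theorem abs_inner_ridgeField_sub_le (hk : 0 < k) (v w : F) :
    |⟪ridgeField g₀ y₀ t H k α v - ridgeField g₀ y₀ t H k α w, v - w⟫ - ⟪H (v - w), v - w⟫| ≤
      1 / 2 * ⟪t, v - w⟫ ^ 2 := by
  set a := k * ⟪t, v - y₀⟫ + α
  set b := k * ⟪t, w - y₀⟫ + α
  have hab : a - b = k * ⟪t, v - w⟫ := by
    simp only [a, b, inner_sub_right]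
    ring
  have hsplit : ⟪ridgeField g₀ y₀ t H k α v - ridgeField g₀ y₀ t H k α w, v - w⟫
      - ⟪H (v - w), v - w⟫ = 1 / (2 * k) * (Real.sin a - Real.sin b) * ⟪t, v - w⟫ := by
    simp only [ridgeField, map_sub, inner_sub_left, inner_add_left, real_inner_smul_left, a, b]
    ring
  rw [hsplit, abs_mul, abs_mul, abs_of_pos (by positivity : 0 < 1 / (2 * k))]
  calc _ ≤ 1 / (2 * k) * |a - b| * |⟪t, v - w⟫| := by
        gcongr ?_ * ?_ * _
        exact Real.abs_sin_sub_sin_le a b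
    _ = 1 / 2 * |⟪t, v - w⟫| ^ 2 := by
        rw [hab, abs_mul, abs_of_pos hk]
        field_simp
    _ = _ := by rw [sq_abs]

theorem hasFDerivAt_ridgeField (hk : k ≠ 0) (y : F) :
    HasFDerivAt (ridgeField g₀ y₀ t H k α)
      (H + (1 / 2 * Real.cos (k * ⟪t, y - y₀⟫ + α)) • (innerSL ℝ t).smulRight t) y := by
  have hosc := ((((hasFDerivAt_inner_sub t y₀ y).const_mul k).add_const α).sin).const_mul
    (1 / (2 * k))
  have hlin := (H.hasFDerivAt.comp y ((hasFDerivAt_id y).sub_const y₀)).const_add g₀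
  refine (hlin.add (hosc.smul_const t)).congr_fderiv ?_
  ext1 d
  simp only [add_apply, smul_apply, ContinuousLinearMap.comp_id, innerSL_apply_apply,
    ContinuousLinearMap.smulRight_apply, smul_smul, smul_eq_mul]
  congr 2
  field_simp

theorem inner_ridgeField_sub_mem_Icc {ν : F → F} {M : F →L[ℝ] F} {ε η : ℝ} {v w : F} (hk : 0 < k)
    (hε : 0 ≤ ε) (hε₁ : ε ≤ 1) (hη : 0 ≤ η)
    (hH : ∀ d, ε * ⟪M d, d⟫ ≤ ⟪H d, d⟫ ∧ ⟪H d, d⟫ ≤ (1 - ε) * ⟪M d, d⟫)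
    (ht : ∀ d, ⟪t, d⟫ ^ 2 ≤ ⟪H d, d⟫ ∧ ⟪t, d⟫ ^ 2 ≤ ⟪M d, d⟫ - ⟪H d, d⟫)
    (hM : |⟪ν v - ν w, v - w⟫ - ⟪M (v - w), v - w⟫| ≤ η * ‖v - w‖ ^ 2) :
    ⟪ridgeField g₀ y₀ t H k α v - ridgeField g₀ y₀ t H k α w, v - w⟫ ∈
      Icc (ε / 2 * ⟪ν v - ν w, v - w⟫ - η * ‖v - w‖ ^ 2)
        ((1 - ε / 2) * ⟪ν v - ν w, v - w⟫ + η * ‖v - w‖ ^ 2) := by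
  have hfield := abs_le.1 (abs_inner_ridgeField_sub_le (g₀ := g₀) (y₀ := y₀) (t := t) (H := H)
    (α := α) hk v w)
  obtain ⟨hM_low, hM_up⟩ := abs_le.1 hM
  obtain ⟨hH_low, hH_up⟩ := hH (v - w)
  obtain ⟨ht_low, ht_up⟩ := ht (v - w)
  have hsq : 0 ≤ η * ‖v - w‖ ^ 2 := by positivity
  have hlow := mul_le_mul_of_nonneg_left hM_up (div_nonneg hε zero_le_two)
  have hup := mul_le_mul_of_nonneg_left hM_low (sub_nonneg.2 (by linarith : ε / 2 ≤ 1))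
  have hlow_sq : ε / 2 * (η * ‖v - w‖ ^ 2) ≤ η * ‖v - w‖ ^ 2 :=
    mul_le_of_le_one_left hsq (by linarith)
  have hup_sq : (1 - ε / 2) * (η * ‖v - w‖ ^ 2) ≤ η * ‖v - w‖ ^ 2 :=
    mul_le_of_le_one_left hsq (by linarith)
  constructor
  · linarith [hlow_sq]
  · linarith [hup_sq]

theorem eventually_forall_mem_ball {X : Type*} [PseudoMetricSpace X] {x₀ : X} {p : X → Prop}
    (h : ∀ᶠ x in 𝓝 x₀, p x) : ∀ᶠ ρ in 𝓝[>] (0 : ℝ), ∀ x ∈ Metric.ball x₀ ρ, p x := by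
  obtain ⟨ρ₀, hρ₀, hp⟩ := Metric.eventually_nhds_iff_ball.1 h
  filter_upwards [Ioo_mem_nhdsGT hρ₀] with ρ hρ x hx
  exact hp x (Metric.ball_subset_ball hρ.2.le hx)

theorem eventually_abs_inner_sub_le_of_hasStrictFDerivAt {ν : F → F} {M : F →L[ℝ] F}
    (hν : HasStrictFDerivAt ν M y₀) {η : ℝ} (hη : 0 < η) :
    ∀ᶠ ρ in 𝓝[>] 0, ∀ v ∈ Metric.ball y₀ ρ, ∀ w ∈ Metric.ball y₀ ρ,
      |⟪ν v - ν w, v - w⟫ - ⟪M (v - w), v - w⟫| ≤ η * ‖v - w‖ ^ 2 := by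
  have hlittleO := (hasStrictFDerivAt_iff_isLittleO.1 hν).def hη
  filter_upwards [eventually_forall_mem_ball hlittleO] with ρ hρ v hv w hw
  have hvw : ‖ν v - ν w - M (v - w)‖ ≤ η * ‖v - w‖ :=
    hρ (v, w) (by rw [← ball_prod_same]; exact ⟨hv, hw⟩)
  rw [← inner_sub_left]
  calc _ ≤ ‖ν v - ν w - M (v - w)‖ * ‖v - w‖ := abs_real_inner_le_norm _ _
    _ ≤ η * ‖v - w‖ * ‖v - w‖ := by gcongr
    _ = η * ‖v - w‖ ^ 2 := by ring

theorem eventually_exists_ridgeModel_close {f : F → ℝ} {g : F → F}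
    (hf : ∀ᶠ y in 𝓝 y₀, HasFDerivAt f (innerSL ℝ (g y)) y) (hg : HasFDerivAt g H y₀)
    (hsymm : ∀ a b, ⟪H a, b⟫ = ⟪a, H b⟫) (t : F) {η : ℝ} (hη : 0 < η) :
    ∀ᶠ ρ in 𝓝[>] 0, ∃ k > 0, ∀ α, ∀ y ∈ Metric.ball y₀ ρ,
      |ridgeModel (f y₀) (g y₀) y₀ t H k α y - f y| ≤ η * ρ ^ 2 ∧
        ‖ridgeField (g y₀) y₀ t H k α y - g y‖ ≤ η * ρ := by
  filter_upwards [eventually_forall_mem_ball (eventually_taylor_of_gradient hf hg hsymm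
    (half_pos hη)), self_mem_nhdsWithin] with ρ htaylor (hρ : 0 < ρ)
  have hfield : ∀ᶠ k : ℝ in atTop, 1 / (2 * k) * ‖t‖ < η / 2 * ρ := by
    refine Tendsto.eventually_lt_const (v := 0) (by positivity) ?_
    simpa only [one_div, mul_inv, mul_zero, zero_mul] using
      (tendsto_inv_atTop_zero.const_mul (2 : ℝ)⁻¹).mul_const ‖t‖
  have hmodel : ∀ᶠ k : ℝ in atTop, 1 / (2 * k ^ 2) < η / 2 * ρ ^ 2 := by
    refine Tendsto.eventually_lt_const (v := 0) (by positivity) ?_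
    simpa only [one_div, mul_inv, mul_zero, Function.comp_apply] using
      (tendsto_inv_atTop_zero.comp (tendsto_pow_atTop two_ne_zero)).const_mul (2 : ℝ)⁻¹
  obtain ⟨k, hkfield, hkmodel, hk⟩ := (hfield.and (hmodel.and (eventually_gt_atTop 0))).exists
  refine ⟨k, hk, fun α y hy => ?_⟩
  obtain ⟨htaylor_g, htaylor_f⟩ := htaylor y hy
  have hy_le : ‖y - y₀‖ ≤ ρ := (mem_ball_iff_norm.1 hy).le
  rw [norm_sub_rev] at htaylor_g
  rw [abs_sub_comm] at htaylor_f
  constructor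
  · calc _ ≤ 1 / (2 * k ^ 2) + η / 2 * ‖y - y₀‖ ^ 2 :=
        (abs_sub_le _ _ _).trans (add_le_add (abs_ridgeModel_sub_le (f y₀) y) htaylor_f)
      _ ≤ η / 2 * ρ ^ 2 + η / 2 * ρ ^ 2 := by gcongr
      _ = η * ρ ^ 2 := by ring
  · calc _ ≤ 1 / (2 * k) * ‖t‖ + η / 2 * ‖y - y₀‖ :=
        (norm_sub_le_norm_sub_add_norm_sub _ _ _).trans
          (add_le_add (norm_ridgeField_sub_le hk y) htaylor_g)
      _ ≤ η / 2 * ρ + η / 2 * ρ := by gcongr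
      _ = η * ρ := by ring

end Ridge

section LocalPerturbation

variable {F : Type*} [NormedAddCommGroup F] [InnerProductSpace ℝ F]

/-- A perturbation `φ` with gradient `γ`, bounded by `σ` and supported in the ball of radius `ρ`
around `y₀`, that keeps the gradient field `g + γ` pinched on this ball. -/
structure IsLocalPerturbation (g ν : F → F) (ε σ : ℝ) (y₀ : F) (ρ : ℝ) (φ : F → ℝ) (γ : F → F) :
    Prop where
  continuous_gradient : Continuous γ
  hasFDerivAt : ∀ y, HasFDerivAt φ (innerSL ℝ (γ y)) y
  abs_le : ∀ y, |φ y| ≤ σ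
  eq_zero : ∃ r < ρ, ∀ y, r ≤ ‖y - y₀‖ → φ y = 0 ∧ γ y = 0
  isPinchedOn : IsPinchedOn ε ν (fun y => g y + γ y) (Metric.ball y₀ ρ)

variable {f P χ : F → ℝ} {g p ξ ν : F → F} {y₀ : F} {C θ ρ ε σ η : ℝ}

theorem isLocalPerturbation_gluingGradient (hρ : 0 < ρ) (hθ : 0 < θ) (hσ : 0 ≤ σ)
    (hησ : η * ρ ^ 2 ≤ σ) (hf : ∀ y, HasFDerivAt f (innerSL ℝ (g y)) y) (hg : Continuous g)
    (hP : ∀ y, HasFDerivAt P (innerSL ℝ (p y)) y) (hp : Continuous p)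
    (hχ : IsCutoff C θ y₀ ρ χ ξ) (hclose : ∀ y ∈ Metric.ball y₀ ρ, |P y - f y| ≤ η * ρ ^ 2)
    (hpinched :
      IsPinchedOn ε ν (fun y => g y + gluingGradient f P χ g p ξ y) (Metric.ball y₀ ρ)) :
    IsLocalPerturbation g ν ε σ y₀ ρ (fun y => χ y * (P y - f y))
      (gluingGradient f P χ g p ξ) where
  continuous_gradient := by
    have hf' : Continuous f := continuous_iff_continuousAt.2 fun y => (hf y).continuousAt
    have hP' : Continuous P := continuous_iff_continuousAt.2 fun y => (hP y).continuousAt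
    have hχ' : Continuous χ :=
      continuous_iff_continuousAt.2 fun y => (hχ.hasFDerivAt y).continuousAt
    have hξ := hχ.continuous_gradient
    unfold gluingGradient
    fun_prop
  hasFDerivAt y := hasFDerivAt_mul_sub (hf y) (hP y) (hχ.hasFDerivAt y)
  abs_le y := by
    by_cases hy : y ∈ Metric.ball y₀ ρ
    · rw [abs_mul, abs_of_nonneg (hχ.nonneg y)]
      exact (mul_le_of_le_one_left (abs_nonneg _) (hχ.le_one y)).trans ((hclose y hy).trans hησ)
    · rw [mem_ball_iff_norm, not_lt] at hy
      rw [hχ.eq_zero y (le_trans (mul_le_of_le_one_left hρ.le (by linarith)) hy), zero_mul,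
        abs_zero]
      exact hσ
  eq_zero := by
    refine ⟨(1 - θ / 2) * ρ, mul_lt_of_lt_one_left hρ (by linarith), fun y hy => ?_⟩
    have hy₀ := hχ.eq_zero y hy
    simp only [gluingGradient, hy₀, hχ.gradient_eq_zero_of_eq_zero hy₀, zero_mul, zero_smul,
      smul_zero, add_zero, and_self]
  isPinchedOn := hpinched

theorem eventually_exists_isLocalPerturbation_ridgeField [FiniteDimensional ℝ F] {t : F}
    {H M : F →L[ℝ] F} {lam : ℝ} (hf : ∀ y, HasFDerivAt f (innerSL ℝ (g y)) y) (hg : Continuous g)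
    (hgH : HasFDerivAt g H y₀) (hsymm : ∀ a b, ⟪H a, b⟫ = ⟪a, H b⟫) (hε : 0 < ε) (hε₁ : ε ≤ 1)
    (hpinched : IsPinchedOn ε ν g univ) (hν : HasStrictFDerivAt ν M y₀) (hlam : 0 < lam)
    (hM : ∀ d, lam * ‖d‖ ^ 2 ≤ ⟪M d, d⟫)
    (ht : ∀ d, ⟪t, d⟫ ^ 2 ≤ ⟪H d, d⟫ ∧ ⟪t, d⟫ ^ 2 ≤ ⟪M d, d⟫ - ⟪H d, d⟫)
    (hθ : 0 < θ) (hθ₁ : θ < 1) (hσ : 0 < σ) :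
    ∀ᶠ ρ in 𝓝[>] 0, ∃ k > 0, ∀ α, ∃ φ γ, IsLocalPerturbation g ν (ε / 4) σ y₀ ρ φ γ ∧
      ∀ y ∈ Metric.ball y₀ ((1 - θ) * ρ), g y + γ y = ridgeField (g y₀) y₀ t H k α y := by
  obtain ⟨C, hC, hcutoff⟩ := exists_isCutoff (F := F) hθ hθ₁
  have hH := hpinched.fderiv univ_mem hν.hasFDerivAt hgH
  obtain ⟨η, hη, hη_eq⟩ : ∃ η > 0, (2 + 3 * C) * η = ε / 4 * lam :=
    ⟨ε / 4 * lam / (2 + 3 * C), by positivity, by field_simp⟩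
  have hη_le : (1 + 3 * C) * η ≤ ε / 4 * (lam - η) := by nlinarith
  have hη_lam : 0 ≤ lam - η := by nlinarith
  have hησ : ∀ᶠ ρ : ℝ in 𝓝[>] 0, η * ρ ^ 2 < σ := by
    refine Tendsto.eventually_lt_const hσ (tendsto_nhdsWithin_of_tendsto_nhds ?_)
    exact Continuous.tendsto' (by fun_prop) _ _ (by norm_num)
  filter_upwards [self_mem_nhdsWithin, hησ, eventually_abs_inner_sub_le_of_hasStrictFDerivAt hν hη,
    eventually_exists_ridgeModel_close (Eventually.of_forall hf) hgH hsymm t hη]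
    with ρ (hρ : 0 < ρ) hρσ hρν ⟨k, hk, hclose⟩
  refine ⟨k, hk, fun α => ?_⟩
  obtain ⟨χ, ξ, hχ⟩ := hcutoff y₀ ρ hρ
  have hP := hasFDerivAt_ridgeModel (g₀ := g y₀) (y₀ := y₀) (t := t) (α := α) (f y₀) hsymm hk
  have hν_coercive : ∀ v ∈ Metric.ball y₀ ρ, ∀ w ∈ Metric.ball y₀ ρ,
      (lam - η) * ‖v - w‖ ^ 2 ≤ ⟪ν v - ν w, v - w⟫ := fun v hv w hw => by
    linarith [hM (v - w), (abs_le.1 (hρν v hv w hw)).1]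
  refine ⟨_, _, isLocalPerturbation_gluingGradient hρ hθ hσ.le hρσ.le hf hg hP
    continuous_ridgeField hχ (fun y hy => (hclose α y hy).1)
    (isPinchedOn_add_gluingGradient hρ hη.le hε.le hη_lam hη_le hf hP hχ (hclose α) hν_coercive
      (fun v _ w _ => hpinched v (mem_univ v) w (mem_univ w))
      fun v hv w hw => inner_ridgeField_sub_mem_Icc hk hε.le hε₁ hη.le hH ht (hρν v hv w hw)),
    fun y hy => ?_⟩
  have hy₁ := hχ.eq_one y hy
  simp only [gluingGradient, hy₁, hχ.gradient_eq_zero_of_eq_one hy₁, one_smul, smul_zero, add_zero,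
    add_sub_cancel]

end LocalPerturbation

section SupportFunction

variable {n : ℕ} {K L : ConvexBody (E n)} {u v x : E n}

theorem inner_le_supportFun (hx : x ∈ K) (u : E n) : ⟪x, u⟫ ≤ supportFun K u :=
  le_csSup (K.isCompact.image (by fun_prop)).bddAbove ⟨x, hx, rfl⟩

theorem exists_inner_eq_supportFun (K : ConvexBody (E n)) (u : E n) :
    ∃ x ∈ K, ⟪x, u⟫ = supportFun K u := by
  obtain ⟨x, hx, hsup⟩ := K.isCompact.exists_sSup_image_eq (f := fun x : E n => ⟪x, u⟫)
    K.nonempty (by fun_prop)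
  exact ⟨x, hx, hsup.symm⟩

/-- A point of `K` at which `⟪·, u⟫` is maximal. The choice is immaterial for bodies of constant
width and `u ≠ 0`, by `IsOfConstantWidth.eq_supportPoint`. -/
def supportPoint (K : ConvexBody (E n)) (u : E n) : E n :=
  (exists_inner_eq_supportFun K u).choose

theorem supportPoint_mem (K : ConvexBody (E n)) (u : E n) : supportPoint K u ∈ K :=
  (exists_inner_eq_supportFun K u).choose_spec.1

theorem inner_supportPoint (K : ConvexBody (E n)) (u : E n) :
    ⟪supportPoint K u, u⟫ = supportFun K u :=
  (exists_inner_eq_supportFun K u).choose_spec.2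

theorem supportFun_le {c : ℝ} (h : ∀ x ∈ K, ⟪x, u⟫ ≤ c) : supportFun K u ≤ c :=
  (inner_supportPoint K u).symm.trans_le (h _ (supportPoint_mem K u))

theorem supportFun_smul (K : ConvexBody (E n)) {c : ℝ} (hc : 0 ≤ c) (u : E n) :
    supportFun K (c • u) = c * supportFun K u := by
  apply le_antisymm
  · refine supportFun_le fun x hx => ?_
    rw [inner_smul_right]
    exact mul_le_mul_of_nonneg_left (inner_le_supportFun hx u) hc
  · rw [← inner_supportPoint K u, ← inner_smul_right]
    exact inner_le_supportFun (supportPoint_mem K u) _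

theorem supportFun_zero (K : ConvexBody (E n)) : supportFun K 0 = 0 := by
  simpa using supportFun_smul K le_rfl 0

theorem supportFun_add_le (K : ConvexBody (E n)) (u v : E n) :
    supportFun K (u + v) ≤ supportFun K u + supportFun K v := by
  refine supportFun_le fun x hx => ?_
  rw [inner_add_right]
  exact add_le_add (inner_le_supportFun hx u) (inner_le_supportFun hx v)

theorem supportFun_le_add_dist (K L : ConvexBody (E n)) (u : E n) :
    supportFun K u ≤ supportFun L u + dist K L * ‖u‖ := by
  refine supportFun_le fun x hx => ?_
  obtain ⟨y, hy, hxy⟩ := L.isCompact.exists_infDist_eq_dist L.nonempty x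
  have hdist : ‖x - y‖ ≤ dist K L := by
    rw [← dist_eq_norm, ← hxy, ← ConvexBody.hausdorffDist_coe]
    exact Metric.infDist_le_hausdorffDist_of_mem hx ConvexBody.hausdorffEDist_ne_top
  calc ⟪x, u⟫ = ⟪y, u⟫ + ⟪x - y, u⟫ := by rw [inner_sub_left]; ring
    _ ≤ supportFun L u + ‖x - y‖ * ‖u‖ :=
      add_le_add (inner_le_supportFun hy u) (real_inner_le_norm _ _)
    _ ≤ supportFun L u + dist K L * ‖u‖ := by gcongr

theorem inner_normalize_self (v : E n) : ⟪v, NormedSpace.normalize v⟫ = ‖v‖ := by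
  by_cases hv : v = 0
  · simp [hv]
  · rw [NormedSpace.normalize, inner_smul_right, real_inner_self_eq_norm_sq]
    field_simp [norm_ne_zero_iff.2 hv]

theorem exists_mem_dist_le_of_inner_le {c : ℝ} (hc : 0 ≤ c)
    (h : ∀ u : E n, ‖u‖ = 1 → ⟪x, u⟫ ≤ supportFun L u + c) : ∃ y ∈ L, dist x y ≤ c := by
  obtain ⟨y, hy, hxy⟩ := exists_norm_eq_iInf_of_complete_convex L.nonempty
    L.isCompact.isComplete L.convex x
  rw [norm_eq_iInf_iff_real_inner_le_zero L.convex hy] at hxy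
  refine ⟨y, hy, ?_⟩
  rw [dist_eq_norm]
  by_cases hne : x - y = 0
  · simpa only [hne, norm_zero]
  have hsupport :
      supportFun L (NormedSpace.normalize (x - y)) ≤ ⟪y, NormedSpace.normalize (x - y)⟫ := by
    refine supportFun_le fun w hw => sub_nonpos.1 ?_
    rw [← inner_sub_left, NormedSpace.normalize, inner_smul_right, real_inner_comm]
    exact mul_nonpos_of_nonneg_of_nonpos (by positivity) (hxy w hw)
  have hbound := h (NormedSpace.normalize (x - y)) (norm_normalize_eq_one_iff.2 hne)
  have hself := inner_normalize_self (x - y)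
  rw [inner_sub_left] at hself
  linarith

theorem dist_le_of_supportFun {c : ℝ} (hc : 0 ≤ c)
    (h : ∀ u : E n, ‖u‖ = 1 → |supportFun K u - supportFun L u| ≤ c) : dist K L ≤ c := by
  rw [← ConvexBody.hausdorffDist_coe]
  refine Metric.hausdorffDist_le_of_mem_dist hc (fun x hx => ?_) fun x hx => ?_
  · refine exists_mem_dist_le_of_inner_le hc fun u hu => (inner_le_supportFun hx u).trans ?_
    linarith [(abs_le.1 (h u hu)).2]
  · refine exists_mem_dist_le_of_inner_le hc fun u hu => (inner_le_supportFun hx u).trans ?_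
    linarith [(abs_le.1 (h u hu)).1]

theorem inner_normalize_supportPoint (K : ConvexBody (E n)) (v : E n) :
    ⟪supportPoint K v, NormedSpace.normalize v⟫ = supportFun K (NormedSpace.normalize v) := by
  rw [NormedSpace.normalize, supportFun_smul K (by positivity), inner_smul_right,
    inner_supportPoint]

end SupportFunction

section Sublinear

variable {F : Type*} [NormedAddCommGroup F] [InnerProductSpace ℝ F] [FiniteDimensional ℝ F]
  {h : F → ℝ}

theorem smul_le_of_sublinear {V : Type*} [AddCommGroup V] [Module ℝ V] {h : V → ℝ}
    (hsmul : ∀ c : ℝ, 0 < c → ∀ x, h (c • x) = c * h x) (hadd : ∀ x y, h (x + y) ≤ h x + h y)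
    (c : ℝ) (u : V) : c * h u ≤ h (c • u) := by
  have hzero : h 0 = 0 := by
    have := hsmul 2 two_pos 0
    rw [smul_zero] at this
    linarith
  rcases lt_trichotomy c 0 with hc | rfl | hc
  · have hcancel := hadd (c • u) ((-c) • u)
    rw [← add_smul, add_neg_cancel, zero_smul, hzero, hsmul (-c) (neg_pos.2 hc)] at hcancel
    linarith
  · simp [hzero]
  · exact (hsmul c hc u).ge

theorem exists_inner_eq_of_sublinear (hsmul : ∀ c : ℝ, 0 < c → ∀ x, h (c • x) = c * h x)
    (hadd : ∀ x y, h (x + y) ≤ h x + h y) (u : F) :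
    ∃ p : F, (∀ x, ⟪p, x⟫ ≤ h x) ∧ ⟪p, u⟫ = h u := by
  have hle := smul_le_of_sublinear hsmul hadd
  have hwell : ∀ c : ℝ, c • u = 0 → c • h u = 0 := by
    intro c hc
    rcases smul_eq_zero.1 hc with rfl | rfl
    · exact zero_smul _ _
    · have := hle 2 0
      have := hle (-1) 0
      simp only [smul_zero] at *
      rw [show h 0 = 0 by linarith, smul_zero]
  obtain ⟨g, hgu, hgh⟩ := exists_extension_of_le_sublinear
    (LinearPMap.mkSpanSingleton' u (h u) hwell) h hsmul hadd (by
      rintro ⟨_, hx⟩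
      obtain ⟨c, rfl⟩ := Submodule.mem_span_singleton.1 hx
      rw [LinearPMap.mkSpanSingleton'_apply]
      exact hle c u)
  refine ⟨(InnerProductSpace.toDual ℝ F).symm (LinearMap.toContinuousLinearMap g),
    fun x => by simpa using hgh x, ?_⟩
  rw [← LinearPMap.mkSpanSingleton'_apply_self (σ := RingHom.id ℝ) u (h u) hwell
      (Submodule.mem_span_singleton_self u),
    ← hgu]
  simp

theorem isBounded_setOf_inner_le (h : F → ℝ) :
    Bornology.IsBounded {p : F | ∀ x, ⟪p, x⟫ ≤ h x} := by
  let b := stdOrthonormalBasis ℝ F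
  refine isBounded_iff_forall_norm_le.2 ⟨∑ i, max (h (b i)) (h (-b i)), fun p hp => ?_⟩
  calc ‖p‖ = ‖∑ i, b.repr p i • b i‖ := by rw [b.sum_repr]
    _ ≤ ∑ i, ‖b.repr p i • b i‖ := norm_sum_le _ _
    _ = ∑ i, |⟪p, b i⟫| := by
      simp only [norm_smul, b.norm_eq_one, mul_one, b.repr_apply_apply, Real.norm_eq_abs,
        real_inner_comm]
    _ ≤ ∑ i, max (h (b i)) (h (-b i)) := by
      refine Finset.sum_le_sum fun i _ => max_le_max (hp _) ?_
      rw [← inner_neg_right]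
      exact hp _

theorem exists_supportFun_eq_of_sublinear {n : ℕ} {h : E n → ℝ}
    (hsmul : ∀ c : ℝ, 0 < c → ∀ x, h (c • x) = c * h x) (hadd : ∀ x y, h (x + y) ≤ h x + h y) :
    ∃ K : ConvexBody (E n), supportFun K = h := by
  let S : Set (E n) := {p | ∀ x, ⟪p, x⟫ ≤ h x}
  have hS : S = ⋂ x, {p | ⟪p, x⟫ ≤ h x} := by ext; simp [S]
  have hconvex : Convex ℝ S := by
    simp only [hS, real_inner_comm]
    exact convex_iInter fun x => convex_halfSpace_le (innerₗ (E n) x).isLinear (h x)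
  have hclosed : IsClosed S := by
    rw [hS]
    exact isClosed_iInter fun x => isClosed_le (by fun_prop) continuous_const
  have hexists := exists_inner_eq_of_sublinear hsmul hadd
  let K : ConvexBody (E n) := ⟨S, hconvex,
    Metric.isCompact_of_isClosed_isBounded hclosed (isBounded_setOf_inner_le h),
    (hexists 0).imp fun _ hp => hp.1⟩
  refine ⟨K, funext fun u => le_antisymm (supportFun_le fun x hx => hx u) ?_⟩
  obtain ⟨p, hp, hpu⟩ := hexists u
  exact hpu.symm.trans_le (inner_le_supportFun (K := K) hp u)

end Sublinear

section ConstantWidth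

variable {n : ℕ} {K : ConvexBody (E n)} {u v w x y : E n}

theorem IsOfConstantWidth.add_neg (hK : IsOfConstantWidth K 1) (u : E n) :
    supportFun K u + supportFun K (-u) = ‖u‖ := by
  by_cases hu : u = 0
  · simp [hu, supportFun_zero]
  have hwidth := hK _ (norm_normalize_eq_one_iff.2 hu)
  rw [← normalize_neg] at hwidth
  simp only [NormedSpace.normalize, norm_neg] at hwidth
  rw [supportFun_smul K (by positivity), supportFun_smul K (by positivity), ← mul_add] at hwidth
  rwa [inv_mul_eq_one₀ (norm_ne_zero_iff.2 hu), eq_comm] at hwidth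

theorem IsOfConstantWidth.norm_sub_le_one (hK : IsOfConstantWidth K 1)
    (hx : x ∈ K) (hy : y ∈ K) : ‖x - y‖ ≤ 1 := by
  have hwidth := hK.add_neg (x - y)
  have hx_le := inner_le_supportFun hx (x - y)
  have hy_le := inner_le_supportFun hy (-(x - y))
  have hself : ⟪x - y, x - y⟫ = ‖x - y‖ ^ 2 := real_inner_self_eq_norm_sq _
  rw [inner_sub_left] at hself
  rw [inner_neg_right] at hy_le
  by_contra hlt
  nlinarith

theorem IsOfConstantWidth.sub_mem (hK : IsOfConstantWidth K 1) (hx : x ∈ K) (hu : ‖u‖ = 1)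
    (hxu : ⟪x, u⟫ = supportFun K u) : x - u ∈ K := by
  set y := supportPoint K (-u)
  have hy : y ∈ K := supportPoint_mem K (-u)
  have hinner : ⟪x - y, u⟫ = 1 := by
    have hyu : ⟪y, -u⟫ = supportFun K (-u) := inner_supportPoint K (-u)
    rw [inner_neg_right] at hyu
    rw [inner_sub_left, ← hK u hu, hxu, ← hyu, sub_eq_add_neg]
  have hnorm : ‖x - y‖ = 1 := by
    refine le_antisymm (hK.norm_sub_le_one hx hy) ?_
    simpa only [hinner, hu, mul_one] using real_inner_le_norm (x - y) u
  have hu_eq : x - y = u := (inner_eq_one_iff_of_norm_eq_one (𝕜 := ℝ) hnorm hu).1 hinner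
  rwa [← hu_eq, sub_sub_cancel]

/-- The whole body lies in the unit ball that touches it at a support point. -/
theorem IsOfConstantWidth.norm_sq_le (hK : IsOfConstantWidth K 1) (hx : x ∈ K) (hu : ‖u‖ = 1)
    (hxu : ⟪x, u⟫ = supportFun K u) (hy : y ∈ K) : ‖y - x‖ ^ 2 ≤ -2 * ⟪y - x, u⟫ := by
  have hle := hK.norm_sub_le_one hy (hK.sub_mem hx hu hxu)
  have hsq := norm_add_sq_real (y - x) u
  rw [sub_sub_eq_add_sub, add_sub_right_comm] at hle
  rw [hu] at hsq
  nlinarith [norm_nonneg (y - x + u)]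

theorem IsOfConstantWidth.firmly_nonexpansive (hK : IsOfConstantWidth K 1) (hv : v ≠ 0)
    (hw : w ≠ 0) : ‖supportPoint K v - supportPoint K w‖ ^ 2 ≤
      ⟪supportPoint K v - supportPoint K w, NormedSpace.normalize v - NormedSpace.normalize w⟫ := by
  have hle_v := hK.norm_sq_le (supportPoint_mem K v) (norm_normalize hv)
    (inner_normalize_supportPoint K v) (supportPoint_mem K w)
  have hle_w := hK.norm_sq_le (supportPoint_mem K w) (norm_normalize hw)
    (inner_normalize_supportPoint K w) (supportPoint_mem K v)
  rw [norm_sub_rev, ← neg_sub (supportPoint K v), inner_neg_left] at hle_v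
  rw [inner_sub_right]
  linarith

theorem IsOfConstantWidth.norm_supportPoint_sub_le (hK : IsOfConstantWidth K 1) (hv : v ≠ 0)
    (hw : w ≠ 0) :
    ‖supportPoint K v - supportPoint K w‖ ≤
      ‖NormedSpace.normalize v - NormedSpace.normalize w‖ := by
  have hle := (hK.firmly_nonexpansive hv hw).trans (real_inner_le_norm _ _)
  by_contra hlt
  nlinarith [norm_nonneg (NormedSpace.normalize v - NormedSpace.normalize w),
    norm_nonneg (supportPoint K v - supportPoint K w)]

theorem IsOfConstantWidth.eq_supportPoint (hK : IsOfConstantWidth K 1) (hv : v ≠ 0)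
    (hx : x ∈ K) (hxv : ⟪x, v⟫ = supportFun K v) : x = supportPoint K v := by
  have hle := hK.norm_sq_le (supportPoint_mem K v) (norm_normalize hv)
    (inner_normalize_supportPoint K v) hx
  have horth : ⟪x - supportPoint K v, NormedSpace.normalize v⟫ = 0 := by
    rw [NormedSpace.normalize, inner_smul_right, inner_sub_left, hxv, inner_supportPoint,
      sub_self, mul_zero]
  rw [horth, mul_zero] at hle
  exact sub_eq_zero.1 (norm_eq_zero.1 (pow_eq_zero_iff two_ne_zero |>.1
    (le_antisymm hle (sq_nonneg _))))

theorem IsOfConstantWidth.supportPoint_smul (hK : IsOfConstantWidth K 1) {c : ℝ} (hc : 0 < c)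
    (hv : v ≠ 0) : supportPoint K (c • v) = supportPoint K v := by
  refine (hK.eq_supportPoint (smul_ne_zero hc.ne' hv) (supportPoint_mem K v) ?_).symm
  rw [inner_smul_right, inner_supportPoint, supportFun_smul K hc.le]

theorem continuousAt_normalize (hv : v ≠ 0) : ContinuousAt (NormedSpace.normalize : E n → E n) v :=
  (continuous_norm.continuousAt.inv₀ (norm_ne_zero_iff.2 hv)).smul continuousAt_id

theorem norm_normalize_sub_le (hv : 1 ≤ ‖v‖) (hw : 1 ≤ ‖w‖) :
    ‖NormedSpace.normalize v - NormedSpace.normalize w‖ ≤ ‖v - w‖ := by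
  have hnormalize : ∀ z : E n, 1 ≤ ‖z‖ → ‖NormedSpace.normalize z‖ = 1 := fun z hz =>
    norm_normalize (norm_pos_iff.1 (one_pos.trans_le hz))
  set c := ⟪NormedSpace.normalize v, NormedSpace.normalize w⟫
  have hc : c ≤ 1 := by
    simpa only [hnormalize v hv, hnormalize w hw, mul_one] using
      real_inner_le_norm (NormedSpace.normalize v) (NormedSpace.normalize w)
  have hinner : ⟪v, w⟫ = ‖v‖ * ‖w‖ * c := by
    conv_lhs => rw [← norm_smul_normalize v, ← norm_smul_normalize w]
    rw [real_inner_smul_left, real_inner_smul_right, mul_assoc]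
  refine le_of_sq_le_sq ?_ (norm_nonneg _)
  rw [norm_sub_sq_real, norm_sub_sq_real v w, hnormalize v hv, hnormalize w hw, hinner]
  have hone_le : 1 ≤ ‖v‖ * ‖w‖ := one_le_mul_of_one_le_of_one_le hv hw
  nlinarith [sq_nonneg (‖v‖ - ‖w‖), mul_nonneg (sub_nonneg.2 hone_le) (sub_nonneg.2 hc)]

theorem IsOfConstantWidth.continuousAt_supportPoint (hK : IsOfConstantWidth K 1) (hv : v ≠ 0) :
    ContinuousAt (supportPoint K) v := by
  rw [ContinuousAt, tendsto_iff_norm_sub_tendsto_zero]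
  refine squeeze_zero' (Eventually.of_forall fun _ => norm_nonneg _) ?_
    (tendsto_iff_norm_sub_tendsto_zero.1 (continuousAt_normalize hv))
  filter_upwards [isOpen_ne.mem_nhds hv] with w hw
  exact hK.norm_supportPoint_sub_le hw hv

theorem IsOfConstantWidth.hasFDerivAt_supportFun (hK : IsOfConstantWidth K 1) (hv : v ≠ 0) :
    HasFDerivAt (supportFun K) (innerSL ℝ (supportPoint K v)) v := by
  rw [hasFDerivAt_iff_isLittleO, Asymptotics.isLittleO_iff]
  intro c hc
  filter_upwards [(hK.continuousAt_supportPoint hv).eventually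
    (Metric.closedBall_mem_nhds _ hc)] with w hw
  replace hw : ‖supportPoint K w - supportPoint K v‖ ≤ c := mem_closedBall_iff_norm.1 hw
  have hvw := inner_le_supportFun (supportPoint_mem K v) w
  have hwv := inner_le_supportFun (supportPoint_mem K w) v
  have hsmall : ⟪supportPoint K w - supportPoint K v, w - v⟫ ≤ c * ‖w - v‖ :=
    (real_inner_le_norm _ _).trans (by gcongr)
  simp only [inner_sub_left, inner_sub_right, inner_supportPoint] at hsmall
  rw [innerSL_apply_apply, inner_sub_right, inner_supportPoint, Real.norm_eq_abs, abs_le]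
  constructor <;> linarith [mul_nonneg hc.le (norm_nonneg (w - v))]

theorem IsOfConstantWidth.norm_supportPoint_sub_supportPoint_le (hK : IsOfConstantWidth K 1)
    (L : ConvexBody (E n)) (hv : v ≠ 0) :
    ‖supportPoint L v - supportPoint K v‖ ≤ dist L K + √(4 * dist L K) := by
  set u := NormedSpace.normalize v
  have hu : ‖u‖ = 1 := norm_normalize hv
  obtain ⟨p, hp, hdist⟩ := exists_mem_dist_le_of_inner_le (L := K) (x := supportPoint L v)
    (dist_nonneg (x := L) (y := K)) fun w hw => by
      simpa only [hw, mul_one] using (inner_le_supportFun (supportPoint_mem L v) w).trans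
        (supportFun_le_add_dist L K w)
  rw [dist_eq_norm] at hdist
  have hsupport : supportFun K u ≤ supportFun L u + dist L K := by
    simpa only [hu, mul_one, dist_comm] using supportFun_le_add_dist K L u
  have hinner : ⟪supportPoint L v - p, u⟫ ≤ dist L K := by
    simpa only [hu, mul_one] using (real_inner_le_norm _ u).trans
      (mul_le_mul_of_nonneg_right hdist (norm_nonneg u))
  have hball := hK.norm_sq_le (supportPoint_mem K v) hu (inner_normalize_supportPoint K v) hp
  rw [inner_sub_left, inner_normalize_supportPoint] at hball hinner
  refine (norm_sub_le_norm_sub_add_norm_sub _ p _).trans (add_le_add hdist ?_)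
  exact Real.le_sqrt_of_sq_le (by linarith)

theorem continuous_supportPoint_body (hv : v ≠ 0) :
    Continuous fun K : ConstantWidthBody n => supportPoint K.1 v := by
  refine continuous_iff_continuousAt.2 fun K => tendsto_iff_norm_sub_tendsto_zero.2 ?_
  have hlim : Tendsto (fun L : ConstantWidthBody n => dist L.1 K.1 + √(4 * dist L.1 K.1))
      (𝓝 K) (𝓝 0) := by
    have hcont : Continuous fun L : ConstantWidthBody n => dist L.1 K.1 + √(4 * dist L.1 K.1) := by
      fun_prop
    simpa using hcont.tendsto K
  exact squeeze_zero (fun _ => norm_nonneg _)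
    (fun L => K.2.norm_supportPoint_sub_supportPoint_le L.1 hv) hlim

end ConstantWidth

section NormalizeDeriv

variable {F : Type*} [NormedAddCommGroup F] [InnerProductSpace ℝ F]

/-- The derivative of `NormedSpace.normalize` at `v ≠ 0`. -/
def normalizeDeriv (v : F) : F →L[ℝ] F := ‖v‖⁻¹ • (ℝ ∙ v)ᗮ.starProjection

theorem normalizeDeriv_apply (v a : F) :
    normalizeDeriv v a = ‖v‖⁻¹ • (a - ((‖v‖ ^ 2)⁻¹ * ⟪v, a⟫) • v) := by
  rw [normalizeDeriv, smul_apply, Submodule.starProjection_orthogonal_val,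
    Submodule.starProjection_singleton, div_eq_inv_mul, RCLike.ofReal_real_eq_id, id_eq]

theorem normalizeDeriv_apply_of_inner_eq_zero {v a : F} (hva : ⟪v, a⟫ = 0) :
    normalizeDeriv v a = ‖v‖⁻¹ • a := by
  rw [normalizeDeriv_apply, hva, mul_zero, zero_smul, sub_zero]

theorem inner_normalizeDeriv_self (v a : F) :
    ⟪normalizeDeriv v a, a⟫ = ‖v‖⁻¹ * ‖(ℝ ∙ v)ᗮ.starProjection a‖ ^ 2 := by
  rw [normalizeDeriv, smul_apply, real_inner_smul_left, ← real_inner_self_eq_norm_sq,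
    ← Submodule.inner_starProjection_left_eq_right,
    Submodule.starProjection_eq_self_iff.2 (Submodule.starProjection_apply_mem _ a)]

theorem hasStrictFDerivAt_norm {v : F} (hv : v ≠ 0) :
    HasStrictFDerivAt (fun w : F => ‖w‖) (innerSL ℝ (NormedSpace.normalize v)) v := by
  have hsqrt := (hasStrictFDerivAt_norm_sq v).sqrt (by positivity)
  simp only [Real.sqrt_sq (norm_nonneg _)] at hsqrt
  refine hsqrt.congr_fderiv ?_
  ext a
  simp [NormedSpace.normalize]
  field_simp

theorem hasStrictFDerivAt_normalize {v : F} (hv : v ≠ 0) :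
    HasStrictFDerivAt (NormedSpace.normalize : F → F) (normalizeDeriv v) v := by
  have hsmul := ((hasStrictDerivAt_inv (norm_ne_zero_iff.2 hv)).comp_hasStrictFDerivAt v
    (hasStrictFDerivAt_norm hv)).smul (hasStrictFDerivAt_id v)
  refine hsmul.congr_fderiv ?_
  ext1 a
  rw [normalizeDeriv_apply]
  simp [NormedSpace.normalize, smul_smul, sub_eq_add_neg]
  field_simp

end NormalizeDeriv

section Derivative

variable {n : ℕ} {K : ConvexBody (E n)} {v z : E n} {A : E n →L[ℝ] E n}

theorem IsOfConstantWidth.inner_deriv_comm (hK : IsOfConstantWidth K 1) (hv : v ≠ 0)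
    (hA : HasFDerivAt (supportPoint K) A v) (a b : E n) : ⟪A a, b⟫ = ⟪a, A b⟫ := by
  have hgrad : ∀ᶠ y in 𝓝 v, HasFDerivAt (supportFun K) (innerSL ℝ (supportPoint K y)) y := by
    filter_upwards [isOpen_ne.mem_nhds hv] with y hy using hK.hasFDerivAt_supportFun hy
  have hsymm : ⟪A a, b⟫ = ⟪A b, a⟫ := second_derivative_symmetric_of_eventually_of_real hgrad
    ((innerSL ℝ).hasFDerivAt.comp v hA) a b
  rw [hsymm, real_inner_comm]

theorem IsOfConstantWidth.deriv_apply_self (hK : IsOfConstantWidth K 1) (hv : v ≠ 0)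
    (hA : HasFDerivAt (supportPoint K) A v) : A v = 0 := by
  refine tendsto_nhds_unique (hA.hasLineDerivAt v).tendsto_slope_zero_right
    (tendsto_const_nhds.congr' ?_)
  filter_upwards [self_mem_nhdsWithin] with s (hs : 0 < s)
  have hline : v + s • v = (1 + s) • v := by rw [add_smul, one_smul]
  rw [hline, hK.supportPoint_smul (by positivity) hv, sub_self, smul_zero]

theorem IsOfConstantWidth.inner_deriv_self (hK : IsOfConstantWidth K 1) (hv : v ≠ 0)
    (hA : HasFDerivAt (supportPoint K) A v) (a : E n) : ⟪A a, v⟫ = 0 := by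
  rw [hK.inner_deriv_comm hv hA, hK.deriv_apply_self hv hA, inner_zero_right]

theorem IsOfConstantWidth.norm_mul_norm_deriv_sq_le (hK : IsOfConstantWidth K 1) (hv : v ≠ 0)
    (hA : HasFDerivAt (supportPoint K) A v) (z : E n) : ‖v‖ * ‖A z‖ ^ 2 ≤ ⟪A z, z⟫ := by
  have hslope := (hA.hasLineDerivAt z).tendsto_slope_zero_right
  have hslope_normalize :=
    ((hasStrictFDerivAt_normalize hv).hasFDerivAt.hasLineDerivAt z).tendsto_slope_zero_right
  have hle : ‖A z‖ ^ 2 ≤ ⟪A z, normalizeDeriv v z⟫ := by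
    refine le_of_tendsto_of_tendsto (hslope.norm.pow 2) (hslope.inner hslope_normalize) ?_
    filter_upwards [(tendsto_add_smul_nhdsGT_zero v z).eventually (isOpen_ne.mem_nhds hv)]
      with s hs
    rw [norm_smul, mul_pow, Real.norm_eq_abs, sq_abs, real_inner_smul_left,
      real_inner_smul_right, ← mul_assoc, ← pow_two]
    exact mul_le_mul_of_nonneg_left (hK.firmly_nonexpansive hs hv) (sq_nonneg _)
  rw [normalizeDeriv_apply, inner_smul_right, inner_sub_right, inner_smul_right,
    hK.inner_deriv_self hv hA, mul_zero, sub_zero] at hle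
  rwa [← le_inv_mul_iff₀ (norm_pos_iff.2 hv)]

theorem IsOfConstantWidth.norm_mul_inner_deriv_le (hK : IsOfConstantWidth K 1) (hv : v ≠ 0)
    (hA : HasFDerivAt (supportPoint K) A v) (a : E n) : ‖v‖ * ⟪A a, a⟫ ≤ ‖a‖ ^ 2 := by
  have hfirm := mul_le_mul_of_nonneg_left (hK.norm_mul_norm_deriv_sq_le hv hA a) (norm_nonneg v)
  have hsq := norm_sub_sq_real (‖v‖ • A a) a
  rw [norm_smul, norm_norm, real_inner_smul_left] at hsq
  nlinarith [sq_nonneg ‖‖v‖ • A a - a‖]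

theorem IsOfConstantWidth.isPositive_deriv (hK : IsOfConstantWidth K 1) (hv : v ≠ 0)
    (hA : HasFDerivAt (supportPoint K) A v) : A.IsPositive :=
  A.isPositive_iff.2 ⟨hK.inner_deriv_comm hv hA, fun a =>
    (by positivity : 0 ≤ ‖v‖ * ‖A a‖ ^ 2).trans (hK.norm_mul_norm_deriv_sq_le hv hA a)⟩

theorem IsOfConstantWidth.isPositive_normalizeDeriv_sub_deriv (hK : IsOfConstantWidth K 1)
    (hv : v ≠ 0) (hA : HasFDerivAt (supportPoint K) A v) : (normalizeDeriv v - A).IsPositive := by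
  refine (ContinuousLinearMap.isPositive_iff _).2 ⟨fun a b => ?_, fun a => ?_⟩
  · simp only [ContinuousLinearMap.coe_coe, sub_apply, inner_sub_left, inner_sub_right,
      hK.inner_deriv_comm hv hA, normalizeDeriv, smul_apply, real_inner_smul_left,
      real_inner_smul_right, Submodule.inner_starProjection_left_eq_right]
  · set b := (ℝ ∙ v)ᗮ.starProjection a
    obtain ⟨c, hc⟩ : ∃ c : ℝ, a = b + c • v := by
      obtain ⟨c, hc⟩ := Submodule.mem_span_singleton.1
        ((ℝ ∙ v).starProjection_apply_mem a)
      refine ⟨c, ?_⟩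
      rw [hc, add_comm]
      exact ((ℝ ∙ v).starProjection_add_starProjection_orthogonal a).symm
    have hquad : ⟪A a, a⟫ = ⟪A b, b⟫ := by
      rw [hc, map_add, map_smul, hK.deriv_apply_self hv hA, smul_zero, add_zero,
        inner_add_right, inner_smul_right, hK.inner_deriv_self hv hA, mul_zero, add_zero]
    rw [sub_apply, inner_sub_left, inner_normalizeDeriv_self, hquad, sub_nonneg,
      le_inv_mul_iff₀ (norm_pos_iff.2 hv)]
    exact hK.norm_mul_inner_deriv_le hv hA b

theorem inner_sq_le_of_isPositive {F : Type*} [NormedAddCommGroup F] [InnerProductSpace ℝ F]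
    {B : F →L[ℝ] F} (hB : B.IsPositive) (w d : F) : ⟪B w, d⟫ ^ 2 ≤ ⟪B w, w⟫ * ⟪B d, d⟫ :=
  LinearMap.BilinForm.apply_sq_le_of_symm ((innerₗ F).comp B.toLinearMap) hB.inner_nonneg_left
    ⟨fun a b => (real_inner_comm _ _).trans (hB.inner_left_eq_inner_right b a).symm⟩ w d

/-- The vector `A z - ‖v‖ A² z` is the value of `A` at `z - ‖v‖ A z`, and of the complementary
form `normalizeDeriv v - A` at `‖v‖ A z`. -/
theorem IsOfConstantWidth.inner_deriv_sub_sq_le (hK : IsOfConstantWidth K 1) (hv : 1 ≤ ‖v‖)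
    (hA : HasFDerivAt (supportPoint K) A v) (hz : ‖z‖ ≤ 1) (d : E n) :
    ⟪A z - ‖v‖ • A (A z), d⟫ ^ 2 ≤ ⟪A d, d⟫ := by
  have hv₀ : v ≠ 0 := norm_pos_iff.1 (one_pos.trans_le hv)
  have hpos := hK.isPositive_deriv hv₀ hA
  set w := z - ‖v‖ • A z with hw
  have hnorm_w : ‖w‖ ^ 2 ≤ ‖z‖ ^ 2 := by
    rw [hw, norm_sub_sq_real, inner_smul_right, norm_smul, norm_norm, real_inner_comm]
    have hfirm := mul_le_mul_of_nonneg_left (hK.norm_mul_norm_deriv_sq_le hv₀ hA z)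
      (norm_nonneg v)
    nlinarith [mul_nonneg (norm_nonneg v) (hpos.inner_nonneg_left z)]
  have hone : ⟪A w, w⟫ ≤ 1 := by
    have hle := hK.norm_mul_inner_deriv_le hv₀ hA w
    nlinarith [hpos.inner_nonneg_left w, norm_nonneg z]
  rw [show A z - ‖v‖ • A (A z) = A w by rw [hw, map_sub, map_smul]]
  exact (inner_sq_le_of_isPositive hpos w d).trans
    (mul_le_of_le_one_left (hpos.inner_nonneg_left d) hone)

theorem IsOfConstantWidth.inner_deriv_sub_sq_le_compl (hK : IsOfConstantWidth K 1) (hv : 1 ≤ ‖v‖)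
    (hA : HasFDerivAt (supportPoint K) A v) (hz : ‖z‖ ≤ 1) (d : E n) :
    ⟪A z - ‖v‖ • A (A z), d⟫ ^ 2 ≤ ⟪normalizeDeriv v d, d⟫ - ⟪A d, d⟫ := by
  have hv_pos : 0 < ‖v‖ := one_pos.trans_le hv
  have hv₀ : v ≠ 0 := norm_pos_iff.1 hv_pos
  have hpos := hK.isPositive_normalizeDeriv_sub_deriv hv₀ hA
  set w := ‖v‖ • A z with hw
  have hN_w : normalizeDeriv v w = A z := by
    rw [normalizeDeriv_apply_of_inner_eq_zero, hw, inv_smul_smul₀ hv_pos.ne']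
    rw [hw, inner_smul_right, real_inner_comm, hK.inner_deriv_self hv₀ hA, mul_zero]
  have hone : ⟪(normalizeDeriv v - A) w, w⟫ ≤ 1 := by
    have hle_sq := hK.norm_mul_inner_deriv_le hv₀ hA z
    have hfirm := hK.norm_mul_norm_deriv_sq_le hv₀ hA z
    have hw_nonneg := (hK.isPositive_deriv hv₀ hA).inner_nonneg_left w
    have hz_nonneg := (hK.isPositive_deriv hv₀ hA).inner_nonneg_left z
    rw [sub_apply, inner_sub_left, hN_w, hw, inner_smul_right, real_inner_self_eq_norm_sq, ← hw]
    nlinarith [norm_nonneg z]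
  have heq : A z - ‖v‖ • A (A z) = (normalizeDeriv v - A) w := by
    rw [sub_apply, hN_w, hw, map_smul]
  rw [← inner_sub_left, ← sub_apply, heq]
  exact (inner_sq_le_of_isPositive hpos w d).trans
    (mul_le_of_le_one_left (hpos.inner_nonneg_left d) hone)

end Derivative

section Curvature

variable {n : ℕ} {K : ConvexBody (E n)} {u t x z : E n}

theorem circleRadius_eq (hu : ‖u‖ = 1) (hz : ⟪z - x, u⟫ < 0) :
    circleRadius x u z = ENNReal.ofReal (‖z - x‖ ^ 2 / (-2 * ⟪z - x, u⟫)) := by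
  set R := ‖z - x‖ ^ 2 / (-2 * ⟪z - x, u⟫) with hR
  have hR_nonneg : 0 ≤ R := div_nonneg (sq_nonneg _) (by linarith)
  have dist_eq_iff (r : ℝ≥0) : dist z (x - (r : ℝ) • u) = r ↔ r = R.toNNReal := by
    have hsq := norm_add_sq_real (z - x) ((r : ℝ) • u)
    rw [norm_smul, hu, inner_smul_right, mul_one, Real.norm_eq_abs, sq_abs] at hsq
    rw [dist_eq_norm, sub_sub_eq_add_sub, add_sub_right_comm,
      ← sq_eq_sq₀ (norm_nonneg _) r.coe_nonneg,
      hsq, ← NNReal.coe_inj, Real.coe_toNNReal _ hR_nonneg, hR, eq_div_iff (by linarith)]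
    constructor <;> intro h <;> linarith
  simp only [circleRadius, dist_eq_iff, iInf_iInf_eq_left, ENNReal.ofReal]

theorem circleRadius_le_ofReal (hu : ‖u‖ = 1) (hz : ⟪z - x, u⟫ < 0) {c : ℝ}
    (h : ‖z - x‖ ^ 2 ≤ c * (-2 * ⟪z - x, u⟫)) : circleRadius x u z ≤ ENNReal.ofReal c := by
  rw [circleRadius_eq hu hz]
  exact ENNReal.ofReal_le_ofReal ((div_le_iff₀ (by linarith)).2 h)

theorem ofReal_le_circleRadius (hu : ‖u‖ = 1) (hz : ⟪z - x, u⟫ < 0) {c : ℝ}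
    (h : c * (-2 * ⟪z - x, u⟫) ≤ ‖z - x‖ ^ 2) : ENNReal.ofReal c ≤ circleRadius x u z := by
  rw [circleRadius_eq hu hz]
  exact ENNReal.ofReal_le_ofReal ((le_div_iff₀ (by linarith)).2 h)

theorem continuous_supportFun (K : ConvexBody (E n)) : Continuous (supportFun K) := by
  have hconvex : ConvexOn ℝ univ (supportFun K) :=
    ⟨convex_univ, fun v _ w _ a b ha hb _ => by
      simpa only [supportFun_smul K ha, supportFun_smul K hb, smul_eq_mul] using
        supportFun_add_le K (a • v) (b • w)⟩
  exact continuousOn_univ.1 (hconvex.continuousOn isOpen_univ)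

theorem exists_inner_add_le_supportFun {S : Set (E n)} (hS : IsCompact S)
    (h : ∀ v ∈ S, ⟪z, v⟫ < supportFun K v) : ∃ m > 0, ∀ v ∈ S, ⟪z, v⟫ + m ≤ supportFun K v := by
  obtain ⟨m, hm, hmS⟩ := hS.exists_forall_le' (f := fun v => supportFun K v - ⟪z, v⟫)
    ((continuous_supportFun K).sub (by fun_prop)).continuousOn fun v hv => sub_pos.2 (h v hv)
  exact ⟨m, hm, fun v hv => by linarith [hmS v hv]⟩

theorem mem_interior_of_inner_lt_supportFun (h : ∀ v : E n, ‖v‖ = 1 → ⟪z, v⟫ < supportFun K v) :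
    z ∈ interior (K : Set (E n)) := by
  obtain ⟨m, hm, hsupport⟩ := exists_inner_add_le_supportFun (isCompact_sphere (0 : E n) 1)
    fun v hv => h v (mem_sphere_zero_iff_norm.1 hv)
  rw [mem_interior_iff_mem_nhds]
  filter_upwards [Metric.ball_mem_nhds z hm] with y hy
  obtain ⟨p, hp, hyp⟩ := exists_mem_dist_le_of_inner_le (L := K) (x := y) le_rfl fun v hv => by
    have hle := real_inner_le_norm (y - z) v
    rw [hv, mul_one, inner_sub_left] at hle
    linarith [hsupport v (mem_sphere_zero_iff_norm.2 hv), mem_ball_iff_norm.1 hy]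
  rwa [dist_le_zero.1 hyp]

theorem eventually_mem_of_supportFun_le_inner (hx : ∀ v, ‖v‖ = 1 → v ≠ u → ⟪x, v⟫ < supportFun K v)
    {U : Set (E n)} (hU : U ∈ 𝓝 u) :
    ∀ᶠ z in 𝓝 x, ∀ v, ‖v‖ = 1 → supportFun K v ≤ ⟪z, v⟫ → v ∈ U := by
  obtain ⟨m, hm, hsupport⟩ := exists_inner_add_le_supportFun (z := x) (K := K)
    ((isCompact_sphere (0 : E n) 1).inter_right isOpen_interior.isClosed_compl)
    fun v hv => hx v (mem_sphere_zero_iff_norm.1 hv.1) fun hvu =>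
      hv.2 (hvu ▸ mem_interior_iff_mem_nhds.2 hU)
  filter_upwards [Metric.ball_mem_nhds x hm] with z hz v hv hzv
  refine interior_subset (not_not.1 fun hvU => ?_)
  have hle := real_inner_le_norm (z - x) v
  rw [hv, mul_one, inner_sub_left] at hle
  linarith [hsupport v ⟨mem_sphere_zero_iff_norm.2 hv, hvU⟩, mem_ball_iff_norm.1 hz]

theorem isClosed_planarSection (K : ConvexBody (E n)) (x u t : E n) :
    IsClosed (planarSection K x u t) :=
  K.isClosed.inter (AffineSubspace.closed_of_finiteDimensional _)

theorem mem_planarSection_iff :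
    z ∈ planarSection K x u t ↔ z ∈ K ∧ ∃ a b : ℝ, a • u + b • t = z - x := by
  simp only [planarSection, sectionPlane, mem_inter_iff, SetLike.mem_coe,
    AffineSubspace.mem_mk', vsub_eq_sub, Submodule.mem_span_pair]

theorem norm_sub_sq_of_mem_planarSection (hu : ‖u‖ = 1) (ht : ‖t‖ = 1) (hut : ⟪u, t⟫ = 0)
    (hz : z ∈ planarSection K x u t) : ‖z - x‖ ^ 2 = ⟪z - x, u⟫ ^ 2 + ⟪z - x, t⟫ ^ 2 := by
  obtain ⟨-, a, b, hab⟩ := mem_planarSection_iff.1 hz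
  have htu : ⟪t, u⟫ = 0 := by rw [real_inner_comm, hut]
  rw [← hab, norm_add_sq_real]
  simp [inner_add_left, inner_smul_left, inner_smul_right, norm_smul, hu, ht, hut, htu]

theorem notMem_interior_of_mem_intrinsicFrontier
    (hz : z ∈ intrinsicFrontier ℝ (planarSection K x u t)) : z ∉ interior (K : Set (E n)) := by
  intro hz_interior
  obtain ⟨y, hy, rfl⟩ := mem_intrinsicFrontier.1 hz
  refine hy.2 (mem_interior.2 ⟨Subtype.val ⁻¹' interior (K : Set (E n)),
    fun w hw => ⟨interior_subset (s := (K : Set (E n))) hw, ?_⟩,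
    isOpen_interior.preimage continuous_subtype_val, hz_interior⟩)
  exact affineSpan_le.2 (fun q hq => hq.2 : planarSection K x u t ⊆ sectionPlane x u t) w.2

theorem eventually_boundaryApproach_planarSection :
    ∀ᶠ z in boundaryApproach (planarSection K x u t) x t, z ∈ planarSection K x u t ∧
      z ∉ interior (K : Set (E n)) ∧ 0 < ⟪z - x, t⟫ := by
  filter_upwards [self_mem_nhdsWithin] with z hz
  exact ⟨intrinsicFrontier_subset (isClosed_planarSection K x u t) hz.1,
    notMem_interior_of_mem_intrinsicFrontier hz.1, hz.2⟩

theorem exists_mem_segment_mem_intrinsicFrontier {F : Type*} [NormedAddCommGroup F]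
    [NormedSpace ℝ F] {C : Set F} {p q : F} (hp : p ∈ C) (hq_span : q ∈ affineSpan ℝ C)
    (hq : q ∉ C) : ∃ z ∈ segment ℝ p q, z ∈ intrinsicFrontier ℝ C := by
  let line : unitInterval → affineSpan ℝ C := fun s =>
    ⟨AffineMap.lineMap p q (s : ℝ), AffineMap.lineMap_mem _ (subset_affineSpan ℝ C hp) hq_span⟩
  have hline : Continuous line := by
    refine Continuous.subtype_mk ?_ _
    simp only [AffineMap.lineMap_apply_module]
    fun_prop
  obtain ⟨s, hs⟩ : (frontier (line ⁻¹' (Subtype.val ⁻¹' C))).Nonempty := by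
    refine nonempty_frontier_iff.2 ⟨⟨0, ?_⟩, fun huniv => hq ?_⟩
    · simpa [line] using hp
    · simpa [line] using huniv.ge (mem_univ (1 : unitInterval))
  refine ⟨line s, ?_, mem_intrinsicFrontier.2
    ⟨line s, hline.frontier_preimage_subset _ hs, rfl⟩⟩
  rw [segment_eq_image_lineMap]
  exact mem_image_of_mem _ s.2

theorem IsOfConstantWidth.inner_sub_supportPoint_neg (hK : IsOfConstantWidth K 1) (hu : ‖u‖ = 1)
    (hz : z ∈ K) (hne : z ≠ supportPoint K u) : ⟪z - supportPoint K u, u⟫ < 0 := by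
  have hle := hK.norm_sq_le (supportPoint_mem K u) hu (inner_supportPoint K u) hz
  have hpos : 0 < ‖z - supportPoint K u‖ := norm_pos_iff.2 (sub_ne_zero.2 hne)
  nlinarith

theorem IsOfConstantWidth.midpoint_mem_interior (hK : IsOfConstantWidth K 1) (hu : ‖u‖ = 1) :
    supportPoint K u - (1 / 2 : ℝ) • u ∈ interior (K : Set (E n)) := by
  have hu₀ : u ≠ 0 := norm_ne_zero_iff.1 (hu ▸ one_ne_zero)
  have hmem := supportPoint_mem K u
  have hmem_opp := hK.sub_mem hmem hu (inner_supportPoint K u)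
  refine mem_interior_of_inner_lt_supportFun fun w hw => lt_of_not_ge fun hge => hu₀ ?_
  have hw₀ : w ≠ 0 := norm_ne_zero_iff.1 (hw ▸ one_ne_zero)
  have hle := inner_le_supportFun hmem w
  have hle_opp := inner_le_supportFun hmem_opp w
  rw [inner_sub_left] at hle_opp
  rw [inner_sub_left, real_inner_smul_left] at hge
  have heq := hK.eq_supportPoint hw₀ hmem (by linarith)
  have heq_opp := hK.eq_supportPoint hw₀ hmem_opp (by rw [inner_sub_left]; linarith)
  exact sub_eq_self.1 (heq_opp.trans heq.symm)

theorem IsOfConstantWidth.exists_mem_planarSection_inner_pos (hK : IsOfConstantWidth K 1)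
    (hu : ‖u‖ = 1) (ht : ‖t‖ = 1) (hut : ⟪u, t⟫ = 0) :
    ∃ q ∈ planarSection K (supportPoint K u) u t, 0 < ⟪q - supportPoint K u, t⟫ := by
  have hnear := (tendsto_add_smul_nhdsGT_zero (supportPoint K u - (1 / 2 : ℝ) • u) t).eventually
    (mem_interior_iff_mem_nhds.1 (hK.midpoint_mem_interior hu))
  obtain ⟨δ, hδK, hδ⟩ := (hnear.and self_mem_nhdsWithin).exists
  refine ⟨_, mem_planarSection_iff.2 ⟨hδK, -(1 / 2), δ, by module⟩, ?_⟩
  have hδ : 0 < δ := hδ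
  rwa [sub_add, sub_sub_cancel_left, neg_sub, inner_sub_left, real_inner_smul_left,
    real_inner_smul_left, hut, real_inner_self_eq_norm_sq, ht, mul_zero, sub_zero, one_pow, mul_one]

/-- A small homothetic copy, with centre `x`, of the side `q q'` of the triangle `x q q'` runs from
`C` to its complement and meets the relative boundary near `x`. -/
theorem boundaryApproach_neBot_of_convex {C : Set (E n)} {q q' : E n} (hC : Convex ℝ C)
    (hx : x ∈ C) (hq : q ∈ C) (hq' : q' ∈ affineSpan ℝ C)
    (hout : ∀ s ∈ Ioo (0 : ℝ) 1, x + s • (q' - x) ∉ C)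
    (hqt : 0 < ⟪q - x, t⟫) (hq't : 0 < ⟪q' - x, t⟫) : (boundaryApproach C x t).NeBot := by
  rw [boundaryApproach, ← mem_closure_iff_nhdsWithin_neBot, Metric.mem_closure_iff]
  intro ε hε
  have hnear (d : E n) : ∀ᶠ s in 𝓝[>] (0 : ℝ), x + s • d ∈ Metric.ball x ε :=
    (tendsto_add_smul_nhdsGT_zero x d).eventually (Metric.ball_mem_nhds x hε)
  obtain ⟨s, ⟨hqs, hq's⟩, hs⟩ :=
    (((hnear (q - x)).and (hnear (q' - x))).and (Ioo_mem_nhdsGT one_pos)).exists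
  have hspan : x + s • (q' - x) ∈ affineSpan ℝ C := by
    rw [add_comm]
    exact AffineMap.lineMap_mem s (subset_affineSpan ℝ C hx) hq'
  obtain ⟨z, hz, hz_frontier⟩ := exists_mem_segment_mem_intrinsicFrontier
    (hC.add_smul_sub_mem hx hq ⟨hs.1.le, hs.2.le⟩) hspan (hout s hs)
  refine ⟨z, ⟨hz_frontier, ?_⟩, ?_⟩
  · have hhalf (y : E n) (hy : 0 < ⟪y - x, t⟫) :
        x + s • (y - x) ∈ {z : E n | ⟪t, x⟫ < innerₗ (E n) t z} := by
      have := mul_pos hs.1 hy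
      simpa [inner_add_right, inner_smul_right, real_inner_comm t] using this
    have := (convex_halfSpace_gt (innerₗ (E n) t).isLinear ⟪t, x⟫).segment_subset
      (hhalf q hqt) (hhalf q' hq't) hz
    rw [mem_ofPred_eq, inner_sub_left, sub_pos, real_inner_comm, real_inner_comm t z]
    exact this
  · rw [dist_comm]
    exact (convex_ball x ε).segment_subset hqs hq's hz

theorem IsOfConstantWidth.boundaryApproach_neBot (hK : IsOfConstantWidth K 1) (hu : ‖u‖ = 1)
    (ht : ‖t‖ = 1) (hut : ⟪u, t⟫ = 0) :
    (boundaryApproach (planarSection K (supportPoint K u) u t) (supportPoint K u) t).NeBot := by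
  obtain ⟨q, hq, hqt⟩ := hK.exists_mem_planarSection_inner_pos hu ht hut
  set x := supportPoint K u
  set C := planarSection K x u t
  have hx_mem : x ∈ C := mem_planarSection_iff.2 ⟨supportPoint_mem K u, 0, 0, by simp⟩
  have hx_opp : x - u ∈ C := mem_planarSection_iff.2
    ⟨hK.sub_mem (supportPoint_mem K u) hu (inner_supportPoint K u), -1, 0, by module⟩
  set q' := q - ⟪q - x, u⟫ • u with hq'
  have hq'_span : q' ∈ affineSpan ℝ C := by
    have := AffineSubspace.smul_vsub_vadd_mem (affineSpan ℝ C) ⟪q - x, u⟫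
      (subset_affineSpan ℝ _ hx_opp) (subset_affineSpan ℝ _ hx_mem) (subset_affineSpan ℝ _ hq)
    convert this using 1
    simp only [vsub_eq_sub, vadd_eq_add, hq']
    module
  have hq'u : ⟪q' - x, u⟫ = 0 := by
    rw [hq', sub_right_comm, inner_sub_left, real_inner_smul_left, real_inner_self_eq_norm_sq, hu]
    ring
  have hq't : 0 < ⟪q' - x, t⟫ := by
    rwa [hq', sub_right_comm, inner_sub_left, real_inner_smul_left, hut, mul_zero, sub_zero]
  have hconvex : Convex ℝ C := K.convex.inter (sectionPlane x u t).convex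
  refine boundaryApproach_neBot_of_convex hconvex hx_mem hq hq'_span (fun s hs hsC => ?_) hqt hq't
  have hne : x + s • (q' - x) ≠ x := fun h => by
    rcases smul_eq_zero.1 (add_eq_left.1 h) with hs₀ | hq'x
    · exact hs.1.ne' hs₀
    · simp [hq'x] at hq't
  have hneg := hK.inner_sub_supportPoint_neg hu hsC.1 hne
  rw [add_sub_cancel_left, real_inner_smul_left, hq'u, mul_zero] at hneg
  exact hneg.false

theorem IsOfConstantWidth.supportSet_eq (hK : IsOfConstantWidth K 1) (hu : ‖u‖ = 1) :
    supportSet K u = {supportPoint K u} := by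
  ext y
  constructor
  · rintro ⟨hy, hyu⟩
    exact hK.eq_supportPoint (norm_ne_zero_iff.1 (hu ▸ one_ne_zero)) hy hyu
  · rintro rfl
    exact ⟨supportPoint_mem K u, inner_supportPoint K u⟩

theorem IsOfConstantWidth.hasRadiusOfCurvature (hK : IsOfConstantWidth K 1) (hu : ‖u‖ = 1)
    (ht : ‖t‖ = 1) (hut : ⟪u, t⟫ = 0) {ρ : ℝ≥0∞}
    (h : Tendsto (circleRadius (supportPoint K u) u)
      (boundaryApproach (planarSection K (supportPoint K u) u t) (supportPoint K u) t) (𝓝 ρ)) :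
    HasRadiusOfCurvature K u t ρ := by
  have := hK.boundaryApproach_neBot hu ht hut
  exact ⟨supportPoint K u, hK.supportSet_eq hu, h.liminf_eq, h.limsup_eq⟩

theorem IsOfConstantWidth.eventually_supportFun_taylor (hK : IsOfConstantWidth K 1) (hu : u ≠ 0)
    {A : E n →L[ℝ] E n} (hA : HasFDerivAt (supportPoint K) A u) {η : ℝ} (hη : 0 < η) :
    ∀ᶠ v in 𝓝 u, |supportFun K v - (supportFun K u + ⟪supportPoint K u, v - u⟫ +
      1 / 2 * ⟪A (v - u), v - u⟫)| ≤ η * ‖v - u‖ ^ 2 := by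
  have hgrad : ∀ᶠ v in 𝓝 u, HasFDerivAt (supportFun K) (innerSL ℝ (supportPoint K v)) v := by
    filter_upwards [isOpen_ne.mem_nhds hu] with v hv using hK.hasFDerivAt_supportFun hv
  exact (eventually_taylor_of_gradient hgrad hA (hK.inner_deriv_comm hu hA) hη).mono
    fun v hv => hv.2

theorem inner_sub_sq_le_of_supportFun_le (hz : z ∈ K) (hzt : 0 < ⟪z - x, t⟫) {η s₀ : ℝ}
    (hη : 0 < η) (hzs₀ : ⟪z - x, t⟫ < 2 * η * s₀)
    (h : ∀ s ∈ Ioo 0 s₀, supportFun K (u + s • t) ≤ ⟪x, u + s • t⟫ + η * s ^ 2) :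
    ⟪z - x, t⟫ ^ 2 ≤ 2 * η * (-2 * ⟪z - x, u⟫) := by
  set s := ⟪z - x, t⟫ / (2 * η) with hs
  have hmul : ⟪z - x, t⟫ = 2 * η * s := by rw [hs]; field_simp
  have hle := (inner_le_supportFun hz (u + s • t)).trans (h s ⟨by positivity, by
    rw [hs, div_lt_iff₀ (by positivity)]
    linarith⟩)
  have hquad : ⟪z - x, u⟫ + s * ⟪z - x, t⟫ ≤ η * s ^ 2 := by
    rw [← sub_le_iff_le_add', ← inner_sub_left, inner_add_right, inner_smul_right] at hle
    exact hle
  rw [hmul] at hquad ⊢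
  nlinarith

theorem eventually_boundaryApproach_norm_sub_lt {C : Set (E n)} {c : ℝ} (hc : 0 < c) :
    ∀ᶠ z in boundaryApproach C x t, ‖z - x‖ < c := by
  filter_upwards [mem_nhdsWithin_of_mem_nhds (Metric.ball_mem_nhds x hc)] with z hz
  exact mem_ball_iff_norm.1 hz

theorem IsOfConstantWidth.eventually_circleRadius_le (hK : IsOfConstantWidth K 1) (hu : ‖u‖ = 1)
    {A : E n →L[ℝ] E n} (hA : HasFDerivAt (supportPoint K) A u) (ht : ‖t‖ = 1)
    (hut : ⟪u, t⟫ = 0) (hAt : A t = 0) {c : ℝ} (hc : 0 < c) :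
    ∀ᶠ z in boundaryApproach (planarSection K (supportPoint K u) u t) (supportPoint K u) t,
      circleRadius (supportPoint K u) u z ≤ ENNReal.ofReal c := by
  have hu₀ : u ≠ 0 := norm_ne_zero_iff.1 (hu ▸ one_ne_zero)
  set x := supportPoint K u
  have hη : 0 < c / 4 := by positivity
  have htaylor := (tendsto_add_smul_nhdsGT_zero u t).eventually
    (hK.eventually_supportFun_taylor hu₀ hA hη)
  obtain ⟨s₀, hs₀, htaylor⟩ := (nhdsGT_basis (0 : ℝ)).eventually_iff.1 htaylor
  have hquad : ∀ s ∈ Ioo 0 s₀, supportFun K (u + s • t) ≤ ⟪x, u + s • t⟫ + c / 4 * s ^ 2 := by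
    intro s hs
    have hle := (abs_le.1 (htaylor hs)).2
    rw [add_sub_cancel_left, map_smul, hAt, smul_zero, inner_zero_left, norm_smul, ht, mul_one,
      Real.norm_eq_abs, sq_abs, ← inner_supportPoint K u, ← inner_add_right] at hle
    linarith
  filter_upwards [eventually_boundaryApproach_planarSection,
    eventually_boundaryApproach_norm_sub_lt (c := 2 * (c / 4) * s₀) (by positivity),
    eventually_boundaryApproach_norm_sub_lt hc] with z ⟨hzC, _, hzt⟩ hz_near hz_near'
  have hneg := hK.inner_sub_supportPoint_neg hu hzC.1 fun h => by simp [h, x] at hzt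
  have hzt_le : ⟪z - x, t⟫ ≤ ‖z - x‖ := by simpa [ht] using real_inner_le_norm (z - x) t
  have hzu_le : -⟪z - x, u⟫ ≤ ‖z - x‖ := by
    simpa [hu] using (neg_le_abs _).trans (abs_real_inner_le_norm (z - x) u)
  have hsq := inner_sub_sq_le_of_supportFun_le hzC.1 hzt hη (hzt_le.trans_lt hz_near) hquad
  refine circleRadius_le_ofReal hu hneg ?_
  rw [norm_sub_sq_of_mem_planarSection hu ht hut hzC]
  nlinarith

theorem IsOfConstantWidth.hasRadiusOfCurvature_zero (hK : IsOfConstantWidth K 1) (hu : ‖u‖ = 1)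
    {A : E n →L[ℝ] E n} (hA : HasFDerivAt (supportPoint K) A u) (ht : ‖t‖ = 1)
    (hut : ⟪u, t⟫ = 0) (hAt : A t = 0) : HasRadiusOfCurvature K u t 0 := by
  refine hK.hasRadiusOfCurvature hu ht hut (ENNReal.tendsto_nhds_zero.2 fun ε hε => ?_)
  obtain ⟨c, hc, hcε⟩ := ENNReal.lt_iff_exists_nnreal_btwn.1 hε
  have hc : 0 < (c : ℝ) := NNReal.coe_pos.2 (ENNReal.coe_pos.1 hc)
  filter_upwards [hK.eventually_circleRadius_le hu hA ht hut hAt hc] with z hz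
  exact hz.trans (by rw [ENNReal.ofReal_coe_nnreal]; exact hcε.le)

theorem IsOfConstantWidth.deriv_apply_eq_zero_of_inner_eq (hK : IsOfConstantWidth K 1)
    (hu : u ≠ 0) {A : E n →L[ℝ] E n} (hA : HasFDerivAt (supportPoint K) A u) {v : E n}
    (hv : ⟪supportPoint K u, v⟫ = supportFun K v) : A v = 0 := by
  refine tendsto_nhds_unique (hA.hasLineDerivAt v).tendsto_slope_zero_right
    (tendsto_const_nhds.congr' ?_)
  filter_upwards [self_mem_nhdsWithin, (tendsto_add_smul_nhdsGT_zero u v).eventually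
    (isOpen_ne.mem_nhds hu)] with s (hs : 0 < s) hne
  have heq : supportPoint K u = supportPoint K (u + s • v) := by
    refine hK.eq_supportPoint hne (supportPoint_mem K u)
      (le_antisymm (inner_le_supportFun (supportPoint_mem K u) _) ?_)
    refine (supportFun_add_le K _ _).trans_eq ?_
    rw [supportFun_smul K hs.le, inner_add_right, inner_smul_right, hv, inner_supportPoint]
  rw [← heq, sub_self, smul_zero]

theorem IsOfConstantWidth.inner_supportPoint_lt (hK : IsOfConstantWidth K 1) (hu : ‖u‖ = 1)
    {A : E n →L[ℝ] E n} (hA : HasFDerivAt (supportPoint K) A u)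
    (hinj : ∀ w, ⟪u, w⟫ = 0 → A w = 0 → w = 0) {v : E n} (hv : ‖v‖ = 1) (hvu : v ≠ u) :
    ⟪supportPoint K u, v⟫ < supportFun K v := by
  have hu₀ : u ≠ 0 := norm_ne_zero_iff.1 (hu ▸ one_ne_zero)
  refine lt_of_le_of_ne (inner_le_supportFun (supportPoint_mem K u) v) fun heq => ?_
  have hA_zero : A (v - ⟪u, v⟫ • u) = 0 := by
    rw [map_sub, map_smul, hK.deriv_apply_self hu₀ hA,
      hK.deriv_apply_eq_zero_of_inner_eq hu₀ hA heq, smul_zero, sub_zero]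
  have hv_eq : v = ⟪u, v⟫ • u := by
    refine sub_eq_zero.1 (hinj _ ?_ hA_zero)
    rw [inner_sub_right, inner_smul_right, real_inner_self_eq_norm_sq, hu]
    ring
  have habs : |⟪u, v⟫| = 1 := by
    have := congrArg norm hv_eq
    rwa [norm_smul, hu, hv, mul_one, Real.norm_eq_abs, eq_comm] at this
  rcases eq_or_eq_neg_of_abs_eq habs with hone | hone <;> rw [hone] at hv_eq
  · exact hvu (hv_eq.trans (one_smul ℝ u))
  · rw [hv_eq, neg_one_smul, inner_neg_right, inner_supportPoint] at heq
    linarith [hK u hu]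

theorem IsOfConstantWidth.circleRadius_le_one (hK : IsOfConstantWidth K 1) (hu : ‖u‖ = 1)
    (hz : z ∈ K) (hne : z ≠ supportPoint K u) : circleRadius (supportPoint K u) u z ≤ 1 := by
  rw [← ENNReal.ofReal_one]
  refine circleRadius_le_ofReal hu (hK.inner_sub_supportPoint_neg hu hz hne) ?_
  rw [one_mul]
  exact hK.norm_sq_le (supportPoint_mem K u) hu (inner_supportPoint K u) hz

theorem mul_neg_inner_sub_le_norm_sq {w : E n} {r : ℝ} (hr : 0 ≤ r)
    (hz : supportFun K (u + w) ≤ ⟪z, u + w⟫)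
    (h : ⟪x, u + w⟫ + r / 2 * ‖w‖ ^ 2 ≤ supportFun K (u + w)) :
    r * (-2 * ⟪z - x, u⟫) ≤ ‖z - x‖ ^ 2 := by
  have hquad : r / 2 * ‖w‖ ^ 2 ≤ ⟪z - x, u⟫ + ‖z - x‖ * ‖w‖ := by
    have hsum : ⟪z, u + w⟫ = ⟪x, u + w⟫ + ⟪z - x, u⟫ + ⟪z - x, w⟫ := by
      rw [add_assoc, ← inner_add_right, ← inner_add_left, add_sub_cancel]
    linarith [real_inner_le_norm (z - x) w]
  nlinarith [mul_le_mul_of_nonneg_left hquad hr, sq_nonneg (‖z - x‖ - r * ‖w‖)]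

/-- A boundary point `z` near `supportPoint K u` has an outer normal `v` near `u`; comparing the
expansion of the support function at `v` with `⟪z, v⟫` bounds the radius from below. -/
theorem IsOfConstantWidth.eventually_le_circleRadius (hK : IsOfConstantWidth K 1) (hu : ‖u‖ = 1)
    {A : E n →L[ℝ] E n} (hA : HasFDerivAt (supportPoint K) A u)
    (hAw : ∀ w, ⟪u, w⟫ = 0 → A w = w) {r : ℝ} (hr : 0 ≤ r) (hr₁ : r < 1) :
    ∀ᶠ z in boundaryApproach (planarSection K (supportPoint K u) u t) (supportPoint K u) t,
      ENNReal.ofReal r ≤ circleRadius (supportPoint K u) u z := by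
  have hu₀ : u ≠ 0 := norm_ne_zero_iff.1 (hu ▸ one_ne_zero)
  have huu : ⟪u, u⟫ = 1 := by rw [real_inner_self_eq_norm_sq, hu, one_pow]
  have htaylor := hK.eventually_supportFun_taylor hu₀ hA (η := (1 - r) / 2) (by linarith)
  have hscale : Tendsto (fun v : E n => ⟪v, u⟫⁻¹ • v) (𝓝 u) (𝓝 u) := by
    have hinner : ContinuousAt (fun v : E n => ⟪v, u⟫) u := by fun_prop
    have hscaled : ContinuousAt (fun v : E n => ⟪v, u⟫⁻¹ • v) u :=
      (hinner.inv₀ (by rw [huu]; exact one_ne_zero)).smul continuousAt_id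
    rwa [ContinuousAt, huu, inv_one, one_smul] at hscaled
  have hpos : ∀ᶠ v : E n in 𝓝 u, 0 < ⟪v, u⟫ :=
    continuousAt_const.eventually_lt (by fun_prop) (by rw [huu]; exact one_pos)
  have hnormal := eventually_mem_of_supportFun_le_inner (x := supportPoint K u)
    (fun v hv hvu => hK.inner_supportPoint_lt hu hA (fun w huw hw => (hAw w huw).symm.trans hw)
      hv hvu) (hpos.and (hscale.eventually htaylor))
  filter_upwards [eventually_boundaryApproach_planarSection, mem_nhdsWithin_of_mem_nhds hnormal]
    with z ⟨hzC, hz_frontier, hzt⟩ hz_normal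
  obtain ⟨v, hv, hzv⟩ : ∃ v : E n, ‖v‖ = 1 ∧ supportFun K v ≤ ⟪z, v⟫ := by
    by_contra! h
    exact hz_frontier (mem_interior_of_inner_lt_supportFun h)
  obtain ⟨hvu, hv_taylor⟩ := hz_normal v hv hzv
  obtain ⟨w, hw⟩ : ∃ w, ⟪v, u⟫⁻¹ • v = u + w := ⟨_, (add_sub_cancel _ _).symm⟩
  have huw : ⟪u, w⟫ = 0 := by
    have := congrArg (inner ℝ u) hw
    rwa [inner_smul_right, real_inner_comm v u, inv_mul_cancel₀ hvu.ne', inner_add_right, huu,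
      left_eq_add] at this
  rw [hw, add_sub_cancel_left, hAw w huw, real_inner_self_eq_norm_sq, ← inner_supportPoint K u,
    ← inner_add_right] at hv_taylor
  have hneg := hK.inner_sub_supportPoint_neg hu hzC.1 fun h => by simp [h] at hzt
  refine ofReal_le_circleRadius hu hneg (mul_neg_inner_sub_le_norm_sq (K := K) (w := w) hr ?_ ?_)
  · rw [← hw, supportFun_smul K (by positivity), inner_smul_right]
    gcongr
  · linarith [(abs_le.1 hv_taylor).1]

theorem IsOfConstantWidth.hasRadiusOfCurvature_one (hK : IsOfConstantWidth K 1) (hu : ‖u‖ = 1)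
    {A : E n →L[ℝ] E n} (hA : HasFDerivAt (supportPoint K) A u)
    (hAw : ∀ w, ⟪u, w⟫ = 0 → A w = w) (ht : ‖t‖ = 1) (hut : ⟪u, t⟫ = 0) :
    HasRadiusOfCurvature K u t 1 := by
  refine hK.hasRadiusOfCurvature hu ht hut (tendsto_order.2 ⟨fun a ha => ?_, fun b hb => ?_⟩)
  · obtain ⟨r, har, hr⟩ := ENNReal.lt_iff_exists_nnreal_btwn.1 ha
    filter_upwards [hK.eventually_le_circleRadius hu hA hAw r.coe_nonneg
      (by exact_mod_cast hr)] with z hz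
    rw [ENNReal.ofReal_coe_nnreal] at hz
    exact har.trans_le hz
  · filter_upwards [eventually_boundaryApproach_planarSection] with z hz
    exact (hK.circleRadius_le_one hu hz.1.1 fun h => by simp [h] at hz).trans_lt hb

/-- The support point map of `K` is differentiable at `u` and its derivative, the reverse Weingarten
map, is an orthogonal projection. -/
def HasProjectionDeriv (K : ConvexBody (E n)) (u : E n) : Prop :=
  ∃ A : E n →L[ℝ] E n, HasFDerivAt (supportPoint K) A u ∧ ∀ x, ⟪A x, x⟫ = ‖A x‖ ^ 2

theorem apply_apply_of_inner_eq_norm_sq {F : Type*} [NormedAddCommGroup F] [InnerProductSpace ℝ F]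
    {A : F →L[ℝ] F} (hsymm : ∀ a b, ⟪A a, b⟫ = ⟪a, A b⟫) (hA : ∀ x, ⟪A x, x⟫ = ‖A x‖ ^ 2) (x : F) :
    A (A x) = A x := by
  have hsymm_sub : (A.toLinearMap ∘ₗ A.toLinearMap - A.toLinearMap).IsSymmetric := fun a b => by
    simp [inner_sub_left, inner_sub_right, hsymm]
  have hzero := hsymm_sub.inner_map_self_eq_zero.1 fun x => by
    simp [inner_sub_left, hA, hsymm (A x)]
  exact sub_eq_zero.1 (LinearMap.congr_fun hzero x)

theorem IsOfConstantWidth.curvature_alternative (hK : IsOfConstantWidth K 1) (hu : ‖u‖ = 1)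
    (hKu : HasProjectionDeriv K u) :
    (∀ t : E n, ‖t‖ = 1 → ⟪u, t⟫ = 0 → HasRadiusOfCurvature K u t 1) ∨
      ∃ t : E n, ‖t‖ = 1 ∧ ⟪u, t⟫ = 0 ∧ HasRadiusOfCurvature K u t 0 := by
  obtain ⟨A, hA, hproj⟩ := hKu
  have hu₀ : u ≠ 0 := norm_ne_zero_iff.1 (hu ▸ one_ne_zero)
  by_cases hid : ∀ w, ⟪u, w⟫ = 0 → A w = w
  · exact Or.inl fun t ht hut => hK.hasRadiusOfCurvature_one hu hA hid ht hut
  push Not at hid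
  obtain ⟨w, huw, hAw⟩ := hid
  have hne : w - A w ≠ 0 := sub_ne_zero.2 hAw.symm
  have hu_orthogonal : ⟪u, NormedSpace.normalize (w - A w)⟫ = 0 := by
    rw [NormedSpace.normalize, inner_smul_right, inner_sub_right, huw, real_inner_comm,
      hK.inner_deriv_self hu₀ hA, sub_zero, mul_zero]
  refine Or.inr ⟨_, norm_normalize hne, hu_orthogonal,
    hK.hasRadiusOfCurvature_zero hu hA (norm_normalize hne) hu_orthogonal ?_⟩
  rw [NormedSpace.normalize, map_smul, map_sub,
    apply_apply_of_inner_eq_norm_sq (hK.inner_deriv_comm hu₀ hA) hproj, sub_self, smul_zero]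

end Curvature

section Sublinear

variable {V : Type*} [NormedAddCommGroup V] [NormedSpace ℝ V] {k : V → ℝ} {k' : V →L[ℝ] ℝ} {p x : V}

theorem fderiv_apply_le_of_homogeneous (hsmul : ∀ c : ℝ, 0 ≤ c → ∀ x, k (c • x) = c * k x)
    (hk : HasFDerivAt k k' p) (hadd : ∀ s : ℝ, 0 < s → k (p + s • x) ≤ k p + k (s • x)) :
    k' x ≤ k x := by
  refine le_of_tendsto (hk.hasLineDerivAt x).tendsto_slope_zero_right ?_
  filter_upwards [self_mem_nhdsWithin] with s (hs : 0 < s)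
  rw [smul_eq_mul, inv_mul_le_iff₀ hs, ← hsmul s hs.le]
  exact sub_le_iff_le_add'.2 (hadd s hs)

theorem fderiv_apply_self_of_homogeneous (hsmul : ∀ c : ℝ, 0 ≤ c → ∀ x, k (c • x) = c * k x)
    (hk : HasFDerivAt k k' p) : k' p = k p := by
  refine tendsto_nhds_unique (hk.hasLineDerivAt p).tendsto_slope_zero_right
    (tendsto_const_nhds.congr' ?_)
  filter_upwards [self_mem_nhdsWithin] with s (hs : 0 < s)
  have hps : p + s • p = (1 + s) • p := by module
  rw [hps, hsmul _ (by positivity), add_mul, one_mul, add_sub_cancel_left, smul_eq_mul,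
    inv_mul_cancel_left₀ hs.ne']

theorem add_le_of_halfSpaces_of_nonneg {l : V →ₗ[ℝ] ℝ}
    (hsmul : ∀ c : ℝ, 0 ≤ c → ∀ x, k (c • x) = c * k x)
    (hpos : ∀ x y, 0 ≤ l x → 0 ≤ l y → k (x + y) ≤ k x + k y)
    (hneg : ∀ x y, l x ≤ 0 → l y ≤ 0 → k (x + y) ≤ k x + k y)
    (hdiff : ∀ p ≠ 0, l p = 0 → DifferentiableAt ℝ k p) (hsum : ∀ x, 0 ≤ k x + k (-x)) {a b : V}
    (ha : 0 < l a) (hb : l b < 0) (hab : 0 ≤ l (a + b)) : k (a + b) ≤ k a + k b := by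
  obtain ⟨c, hc⟩ : ∃ c, c * l a = -l b := ⟨-l b / l a, div_mul_cancel₀ _ ha.ne'⟩
  have hc_pos : 0 < c := pos_of_mul_pos_left (by linarith) ha.le
  have hc_le : c ≤ 1 := by
    rw [map_add] at hab
    exact le_of_mul_le_mul_right (by linarith) ha
  obtain ⟨p, hp⟩ : ∃ p, p = b + c • a := ⟨_, rfl⟩
  have hlp : l p = 0 := by
    rw [hp, map_add, map_smul, smul_eq_mul, hc]
    ring
  have hab_eq : a + b = (1 - c) • a + p := by
    rw [hp]
    module
  by_cases hp₀ : p = 0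
  · have hb_eq : b = c • -a := by
      rw [smul_neg]
      exact eq_neg_of_add_eq_zero_left (hp ▸ hp₀)
    rw [hab_eq, hp₀, add_zero, hsmul _ (by linarith), hb_eq, hsmul c hc_pos.le]
    nlinarith [hsum a]
  · have hk := (hdiff p hp₀ hlp).hasFDerivAt
    have hsmul_a : 0 ≤ l ((1 - c) • a) := by
      rw [map_smul, smul_eq_mul]
      exact mul_nonneg (by linarith) ha.le
    have hadd := hpos _ p hsmul_a hlp.ge
    have hka : fderiv ℝ k p a ≤ k a := fderiv_apply_le_of_homogeneous hsmul hk fun s hs =>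
      hpos _ _ hlp.ge (by rw [map_smul, smul_eq_mul]; positivity)
    have hkb : fderiv ℝ k p b ≤ k b := fderiv_apply_le_of_homogeneous hsmul hk fun s hs =>
      hneg _ _ hlp.le (by rw [map_smul, smul_eq_mul]; nlinarith)
    have hkp := congrArg (fderiv ℝ k p) hp
    rw [map_add, map_smul, smul_eq_mul, fderiv_apply_self_of_homogeneous hsmul hk] at hkp
    rw [← hab_eq, hsmul _ (by linarith)] at hadd
    linarith [mul_le_mul_of_nonneg_left hka hc_pos.le]

theorem add_le_of_halfSpaces {l : V →ₗ[ℝ] ℝ} (hsmul : ∀ c : ℝ, 0 ≤ c → ∀ x, k (c • x) = c * k x)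
    (hpos : ∀ x y, 0 ≤ l x → 0 ≤ l y → k (x + y) ≤ k x + k y)
    (hneg : ∀ x y, l x ≤ 0 → l y ≤ 0 → k (x + y) ≤ k x + k y)
    (hdiff : ∀ p ≠ 0, l p = 0 → DifferentiableAt ℝ k p) (hsum : ∀ x, 0 ≤ k x + k (-x)) (a b : V) :
    k (a + b) ≤ k a + k b := by
  have hopposite : ∀ a b, 0 < l a → l b < 0 → k (a + b) ≤ k a + k b := by
    intro a b ha hb
    rcases le_total 0 (l (a + b)) with hab | hab
    · exact add_le_of_halfSpaces_of_nonneg hsmul hpos hneg hdiff hsum ha hb hab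
    · rw [add_comm a, add_comm (k a)]
      exact add_le_of_halfSpaces_of_nonneg (l := -l) hsmul
        (fun x y hx hy => hneg x y (neg_nonneg.1 hx) (neg_nonneg.1 hy))
        (fun x y hx hy => hpos x y (neg_nonpos.1 hx) (neg_nonpos.1 hy))
        (fun p hp hlp => hdiff p hp (neg_eq_zero.1 hlp)) hsum (neg_pos.2 hb) (neg_neg_iff_pos.2 ha)
        (neg_nonneg.2 (by rwa [add_comm]))
  rcases le_or_gt 0 (l a) with ha | ha <;> rcases le_or_gt 0 (l b) with hb | hb
  · exact hpos a b ha hb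
  · rcases ha.eq_or_lt with ha | ha
    · exact hneg a b ha.ge hb.le
    · exact hopposite a b ha hb
  · rcases hb.eq_or_lt with hb | hb
    · exact hneg a b ha.le hb.ge
    · rw [add_comm a, add_comm (k a)]
      exact hopposite b a hb ha
  · exact hneg a b ha.le hb.le

end Sublinear

section Rounded

variable {n : ℕ} {K : ConvexBody (E n)} {ε ε' : ℝ} {v w : E n}

/-- The function `h(K, ·) - ε ‖·‖` is subadditive. For `ε ≥ 0` this means that `K` is the Minkowski
sum of a convex body and a ball of radius `ε`. -/
def IsRounded (K : ConvexBody (E n)) (ε : ℝ) : Prop :=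
  ∀ x y : E n, supportFun K (x + y) - ε * ‖x + y‖ ≤
    (supportFun K x - ε * ‖x‖) + (supportFun K y - ε * ‖y‖)

theorem supportFun_sub_norm_smul (K : ConvexBody (E n)) (ε : ℝ) {c : ℝ} (hc : 0 ≤ c) (x : E n) :
    supportFun K (c • x) - ε * ‖c • x‖ = c * (supportFun K x - ε * ‖x‖) := by
  rw [supportFun_smul K hc, norm_smul, Real.norm_eq_abs, abs_of_nonneg hc]
  ring

theorem IsOfConstantWidth.hasFDerivAt_supportFun_sub_norm (hK : IsOfConstantWidth K 1) (ε : ℝ)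
    (hv : v ≠ 0) : HasFDerivAt (fun x => supportFun K x - ε * ‖x‖)
      (innerSL ℝ (supportPoint K v - ε • NormedSpace.normalize v)) v := by
  rw [map_sub, map_smul]
  exact (hK.hasFDerivAt_supportFun hv).sub ((hasStrictFDerivAt_norm hv).hasFDerivAt.const_mul ε)

theorem IsRounded.mono (h : IsRounded K ε) (hε : ε' ≤ ε) : IsRounded K ε' := fun x y => by
  have hadd := h x y
  have hnorm := norm_add_le x y
  nlinarith

theorem IsRounded.le_inner (h : IsRounded K ε) (hK : IsOfConstantWidth K 1) (hv : v ≠ 0)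
    (hw : w ≠ 0) : ε * ⟪NormedSpace.normalize v - NormedSpace.normalize w, v - w⟫ ≤
      ⟪supportPoint K v - supportPoint K w, v - w⟫ := by
  have hsmul (c : ℝ) (hc : 0 ≤ c) (x : E n) := supportFun_sub_norm_smul K ε hc x
  have hv' := hK.hasFDerivAt_supportFun_sub_norm ε hv
  have hw' := hK.hasFDerivAt_supportFun_sub_norm ε hw
  have hvv := fderiv_apply_self_of_homogeneous hsmul hv'
  have hww := fderiv_apply_self_of_homogeneous hsmul hw'
  have hvw := fderiv_apply_le_of_homogeneous (x := w) hsmul hv' fun s _ => h _ _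
  have hwv := fderiv_apply_le_of_homogeneous (x := v) hsmul hw' fun s _ => h _ _
  simp only [innerSL_apply_apply, inner_sub_left, real_inner_smul_left] at hvv hww hvw hwv
  simp only [inner_sub_left, inner_sub_right]
  linarith

theorem IsOfConstantWidth.supportPoint_neg (hK : IsOfConstantWidth K 1) (hv : v ≠ 0) :
    supportPoint K (-v) = supportPoint K v - NormedSpace.normalize v := by
  have hmem := hK.sub_mem (supportPoint_mem K v) (norm_normalize hv)
    (inner_normalize_supportPoint K v)
  refine (hK.eq_supportPoint (neg_ne_zero.2 hv) hmem ?_).symm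
  rw [inner_neg_right, inner_sub_left, inner_supportPoint, real_inner_comm, inner_normalize_self]
  linarith [hK.add_neg v]

theorem IsRounded.isPinchedOn (h : IsRounded K ε) (hK : IsOfConstantWidth K 1) :
    IsPinchedOn ε NormedSpace.normalize (supportPoint K) {0}ᶜ := by
  intro v hv w hw
  refine ⟨h.le_inner hK hv hw, ?_⟩
  have hle := h.le_inner hK (neg_ne_zero.2 hv) (neg_ne_zero.2 hw)
  rw [hK.supportPoint_neg hv, hK.supportPoint_neg hw, normalize_neg, normalize_neg, neg_sub_neg,
    neg_sub_neg, ← neg_sub v w, sub_sub_sub_comm] at hle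
  simp only [inner_neg_right, inner_sub_left] at hle ⊢
  linarith

theorem exists_isRounded_supportFun_eq {h : E n → ℝ} (hε : 0 ≤ ε)
    (hsmul : ∀ c : ℝ, 0 < c → ∀ x, h (c • x) = c * h x)
    (hadd : ∀ x y, h (x + y) - ε * ‖x + y‖ ≤ (h x - ε * ‖x‖) + (h y - ε * ‖y‖))
    (hwidth : ∀ u, ‖u‖ = 1 → h u + h (-u) = 1) :
    ∃ L : ConstantWidthBody n, supportFun L.1 = h ∧ IsRounded L.1 ε := by
  obtain ⟨L, rfl⟩ := exists_supportFun_eq_of_sublinear hsmul fun x y => by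
    linarith [hadd x y, mul_le_mul_of_nonneg_left (norm_add_le x y) hε]
  exact ⟨⟨L, hwidth⟩, rfl, hadd⟩

theorem exists_isRounded_dist_le (K : ConstantWidthBody n) {C : ℝ} (hC : ∀ x ∈ K.1, ‖x‖ ≤ C)
    (hε : 0 ≤ ε) (hε₁ : ε ≤ 1 / 2) :
    ∃ L : ConstantWidthBody n, IsRounded L.1 ε ∧ dist L K ≤ ε * (2 * C + 1) := by
  have hC_nonneg : 0 ≤ C := (norm_nonneg _).trans (hC _ (supportPoint_mem K.1 0))
  obtain ⟨L, hLK, hL⟩ := exists_isRounded_supportFun_eq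
    (h := fun x : E n => (1 - 2 * ε) * supportFun K.1 x + ε * ‖x‖) hε
    (fun c hc x => by
      rw [supportFun_smul K.1 hc.le, norm_smul, Real.norm_eq_abs, abs_of_pos hc]
      ring)
    (fun x y => by
      linarith [mul_le_mul_of_nonneg_left (supportFun_add_le K.1 x y)
        (by linarith : 0 ≤ 1 - 2 * ε)])
    (fun u hu => by
      rw [norm_neg, hu]
      linear_combination (1 - 2 * ε) * K.2 u hu)
  refine ⟨L, hL, dist_le_of_supportFun (by positivity) fun u hu => ?_⟩
  have hsupport : |supportFun K.1 u| ≤ C := by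
    rw [← inner_supportPoint]
    refine (abs_real_inner_le_norm _ _).trans ?_
    rw [hu, mul_one]
    exact hC _ (supportPoint_mem K.1 u)
  have hdiff : supportFun L.1 u - supportFun K.1 u = ε * (-2 * supportFun K.1 u + 1) := by
    simp only [hLK, hu]
    ring
  rw [hdiff, abs_mul, abs_of_nonneg hε]
  gcongr
  rw [abs_le] at hsupport ⊢
  constructor <;> linarith

theorem exists_isRounded_dist_lt (K : ConstantWidthBody n) {δ : ℝ} (hδ : 0 < δ) :
    ∃ L : ConstantWidthBody n, ∃ ε, 0 < ε ∧ ε < 1 / 2 ∧ IsRounded L.1 ε ∧ dist L K < δ := by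
  obtain ⟨C, hC⟩ := isBounded_iff_forall_norm_le.1 K.1.isBounded
  have hsmall : Tendsto (fun ε : ℝ => ε * (2 * C + 1)) (𝓝[>] 0) (𝓝 0) := by
    have hcont : Continuous fun ε : ℝ => ε * (2 * C + 1) := by fun_prop
    exact (hcont.tendsto' 0 0 (zero_mul _)).mono_left nhdsWithin_le_nhds
  obtain ⟨ε, hεδ, hε, hε₁⟩ :=
    ((hsmall.eventually_lt_const hδ).and (Ioo_mem_nhdsGT (one_half_pos (α := ℝ)))).exists
  obtain ⟨L, hL, hLK⟩ := exists_isRounded_dist_le K hC hε.le hε₁.le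
  exact ⟨L, ε, hε, hε₁, hL, hLK.trans_lt hεδ⟩

end Rounded

/-- A gnomonic chart: `F` is identified with the orthogonal complement of the unit vector `e` by
the isometry `ι`, whose adjoint is `π`. The open hemisphere around `e` is parametrized by the
directions of the points `e + ι y`. -/
structure Chart (n : ℕ) (F : Type*) [NormedAddCommGroup F] [InnerProductSpace ℝ F] where
  e : E n
  norm_e : ‖e‖ = 1
  ι : F →ₗᵢ[ℝ] E n
  π : E n →L[ℝ] F
  inner_e_ι : ∀ y, ⟪e, ι y⟫ = 0
  inner_π : ∀ x y, ⟪π x, y⟫ = ⟪x, ι y⟫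
  decomp : ∀ x, ⟪e, x⟫ • e + ι (π x) = x

namespace Chart

variable {n : ℕ} {F : Type*} [NormedAddCommGroup F] [InnerProductSpace ℝ F] (c : Chart n F)

section Point

/-- The point of the affine hyperplane `{x | ⟪e, x⟫ = 1}` with coordinate `y`. -/
def pt (y : F) : E n := c.e + c.ι y

theorem inner_e_pt (y : F) : ⟪c.e, c.pt y⟫ = 1 := by
  rw [pt, inner_add_right, c.inner_e_ι, real_inner_self_eq_norm_sq, c.norm_e, one_pow, add_zero]

theorem one_le_norm_pt (y : F) : 1 ≤ ‖c.pt y‖ := by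
  simpa only [c.inner_e_pt, c.norm_e, one_mul] using real_inner_le_norm c.e (c.pt y)

theorem norm_pt_pos (y : F) : 0 < ‖c.pt y‖ := one_pos.trans_le (c.one_le_norm_pt y)

theorem pt_ne_zero (y : F) : c.pt y ≠ 0 := norm_pos_iff.1 (c.norm_pt_pos y)

theorem pt_sub_pt (v w : F) : c.pt v - c.pt w = c.ι (v - w) := by
  rw [pt, pt, map_sub, add_sub_add_left_eq_sub]

theorem continuous_pt : Continuous c.pt := continuous_const.add c.ι.continuous

theorem π_e : c.π c.e = 0 := by
  rw [← inner_self_eq_zero (𝕜 := ℝ), c.inner_π, c.inner_e_ι]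

theorem π_ι (y : F) : c.π (c.ι y) = y :=
  ext_inner_right ℝ fun w => by rw [c.inner_π, LinearIsometry.inner_map_map]

theorem π_pt (y : F) : c.π (c.pt y) = y := by rw [pt, map_add, c.π_e, c.π_ι, zero_add]

theorem smul_pt {x : E n} (hx : ⟪c.e, x⟫ ≠ 0) : ⟪c.e, x⟫ • c.pt (⟪c.e, x⟫⁻¹ • c.π x) = x := by
  rw [pt, smul_add, ← map_smul, smul_inv_smul₀ hx, c.decomp]

theorem pt_add {a b : ℝ} (hab : a + b = 1) (v w : F) :
    c.pt (a • v + b • w) = a • c.pt v + b • c.pt w := by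
  obtain rfl : b = 1 - a := by linarith
  simp only [pt, map_add, map_smul]
  module

theorem hasFDerivAt_pt (y : F) : HasFDerivAt c.pt c.ι.toContinuousLinearMap y :=
  c.ι.toContinuousLinearMap.hasFDerivAt.const_add c.e

theorem hasFDerivAt_comp_pt {h : E n → ℝ} {g : E n} {y : F}
    (hh : HasFDerivAt h (innerSL ℝ g) (c.pt y)) :
    HasFDerivAt (fun y => h (c.pt y)) (innerSL ℝ (c.π g)) y := by
  refine (hh.comp y (c.hasFDerivAt_pt y)).congr_fderiv ?_
  ext d
  simp [c.inner_π]

end Point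

section Perspective

/-- The odd homogeneous extension of degree one of a function on the chart. On the boundary
`{x | ⟪e, x⟫ = 0}` of the half-space it takes the junk value `0`, which makes it continuous when `φ`
is bounded. -/
def persp (φ : F → ℝ) (x : E n) : ℝ := ⟪c.e, x⟫ * φ (⟪c.e, x⟫⁻¹ • c.π x)

variable {φ : F → ℝ} {σ : ℝ}

theorem persp_smul (a : ℝ) (x : E n) : c.persp φ (a • x) = a * c.persp φ x := by
  rcases eq_or_ne a 0 with rfl | ha
  · simp [persp]
  · rw [persp, persp, real_inner_smul_right, map_smul, smul_smul, mul_inv_rev,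
      inv_mul_cancel_right₀ ha, mul_assoc]

theorem persp_neg (x : E n) : c.persp φ (-x) = -c.persp φ x := by
  rw [← neg_one_smul ℝ x, persp_smul, neg_one_mul]

theorem persp_pt (y : F) : c.persp φ (c.pt y) = φ y := by
  rw [persp, c.inner_e_pt, c.π_pt, inv_one, one_smul, one_mul]

theorem abs_persp_le (hφ : ∀ y, |φ y| ≤ σ) (x : E n) : |c.persp φ x| ≤ σ * |⟪c.e, x⟫| := by
  rw [persp, abs_mul, mul_comm]
  gcongr
  exact hφ _

theorem continuous_persp (hc : Continuous φ) (hφ : ∀ y, |φ y| ≤ σ) : Continuous (c.persp φ) := by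
  refine continuous_iff_continuousAt.2 fun x => ?_
  have hinner : ContinuousAt (fun x => ⟪c.e, x⟫) x := by fun_prop
  by_cases hx : ⟪c.e, x⟫ = 0
  · have hlim : Tendsto (fun x => σ * |⟪c.e, x⟫|) (𝓝 x) (𝓝 0) := by
      simpa only [hx, abs_zero, mul_zero] using (hinner.tendsto.abs).const_mul σ
    rw [ContinuousAt, persp, hx, zero_mul]
    exact squeeze_zero_norm (c.abs_persp_le hφ) hlim
  · exact hinner.mul
      (hc.continuousAt.comp ((hinner.inv₀ hx).smul c.π.continuous.continuousAt))

theorem persp_eventually_eq_zero {R : ℝ} (hR : ∀ y, R ≤ ‖y‖ → φ y = 0) {p : E n} (hp : p ≠ 0)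
    (hep : ⟪c.e, p⟫ = 0) : c.persp φ =ᶠ[𝓝 p] 0 := by
  have hπ : 0 < ‖c.π p‖ := by
    refine norm_pos_iff.2 fun hπ => hp ?_
    rw [← c.decomp p, hep, hπ, zero_smul, map_zero, add_zero]
  have hcont : Continuous fun x => ‖c.π x‖ - R * |⟪c.e, x⟫| := by fun_prop
  have hpos : ∀ᶠ x in 𝓝 p, 0 < ‖c.π x‖ - R * |⟪c.e, x⟫| :=
    hcont.continuousAt.eventually_const_lt (by simpa [hep] using hπ)
  filter_upwards [hpos] with x hx
  rw [Pi.zero_apply, persp, mul_eq_zero, or_iff_not_imp_left]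
  refine fun hxe => hR _ ?_
  rw [norm_smul, norm_inv, Real.norm_eq_abs, le_inv_mul_iff₀ (abs_pos.2 hxe)]
  linarith

end Perspective

section Subadditive

variable {k : E n → ℝ} {x y : E n}

theorem add_le_of_convexOn_of_pos (hsmul : ∀ a : ℝ, 0 ≤ a → ∀ x, k (a • x) = a * k x)
    (hk : ConvexOn ℝ univ fun y => k (c.pt y)) (hx : 0 < ⟪c.e, x⟫) (hy : 0 < ⟪c.e, y⟫) :
    k (x + y) ≤ k x + k y := by
  obtain ⟨a, v, ha, rfl⟩ : ∃ a v, 0 < a ∧ x = a • c.pt v := ⟨_, _, hx, (c.smul_pt hx.ne').symm⟩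
  obtain ⟨b, w, hb, rfl⟩ : ∃ b w, 0 < b ∧ y = b • c.pt w := ⟨_, _, hy, (c.smul_pt hy.ne').symm⟩
  have hab : 0 < a + b := add_pos ha hb
  have hsum : a / (a + b) + b / (a + b) = 1 := by field_simp
  have hconvex := hk.2 (mem_univ v) (mem_univ w) (by positivity) (by positivity) hsum
  have hcombination : a • c.pt v + b • c.pt w =
      (a + b) • c.pt ((a / (a + b)) • v + (b / (a + b)) • w) := by
    rw [c.pt_add hsum, smul_add, smul_smul, smul_smul, mul_div_cancel₀ _ hab.ne',
      mul_div_cancel₀ _ hab.ne']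
  rw [hcombination, hsmul _ hab.le, hsmul _ ha.le, hsmul _ hb.le]
  refine (mul_le_mul_of_nonneg_left hconvex hab.le).trans_eq ?_
  simp only [smul_eq_mul]
  field_simp

theorem add_le_of_convexOn_of_nonneg (hcont : Continuous k)
    (hsmul : ∀ a : ℝ, 0 ≤ a → ∀ x, k (a • x) = a * k x)
    (hk : ConvexOn ℝ univ fun y => k (c.pt y)) (hx : 0 ≤ ⟪c.e, x⟫) (hy : 0 ≤ ⟪c.e, y⟫) :
    k (x + y) ≤ k x + k y := by
  have hsum : Continuous fun s : ℝ => k ((x + s • c.e) + (y + s • c.e)) := by fun_prop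
  have hadd : Continuous fun s : ℝ => k (x + s • c.e) + k (y + s • c.e) := by fun_prop
  refine le_of_tendsto_of_tendsto
    ((hsum.tendsto' 0 (k (x + y)) (by simp)).mono_left (nhdsWithin_le_nhds (s := Ioi 0)))
    ((hadd.tendsto' 0 (k x + k y) (by simp)).mono_left nhdsWithin_le_nhds) ?_
  have hpos {x : E n} (hx : 0 ≤ ⟪c.e, x⟫) {s : ℝ} (hs : 0 < s) : 0 < ⟪c.e, x + s • c.e⟫ := by
    rw [inner_add_right, real_inner_smul_right, real_inner_self_eq_norm_sq, c.norm_e]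
    linarith
  filter_upwards [self_mem_nhdsWithin] with s hs
  exact c.add_le_of_convexOn_of_pos hsmul hk (hpos hx hs) (hpos hy hs)

theorem add_le_of_convexOn (hcont : Continuous k)
    (hsmul : ∀ a : ℝ, 0 ≤ a → ∀ x, k (a • x) = a * k x)
    (hk : ConvexOn ℝ univ fun y => k (c.pt y)) (hk_neg : ConvexOn ℝ univ fun y => k (-c.pt y))
    (hdiff : ∀ p ≠ 0, ⟪c.e, p⟫ = 0 → DifferentiableAt ℝ k p) (hsum : ∀ x, 0 ≤ k x + k (-x))
    (x y : E n) : k (x + y) ≤ k x + k y := by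
  refine add_le_of_halfSpaces (l := innerₛₗ ℝ c.e) hsmul
    (fun x y hx hy => c.add_le_of_convexOn_of_nonneg hcont hsmul hk hx hy) (fun x y hx hy => ?_)
    hdiff hsum x y
  have hopposite := c.add_le_of_convexOn_of_nonneg (k := fun x => k (-x)) (x := -x) (y := -y)
    (hcont.comp continuous_neg) (fun a ha x => by rw [← smul_neg, hsmul a ha]) hk_neg
    (by rw [inner_neg_right]; exact neg_nonneg.2 hx)
    (by rw [inner_neg_right]; exact neg_nonneg.2 hy)
  simpa only [neg_add, neg_neg] using hopposite

end Subadditive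

theorem exists_isRounded_supportFun_pt_eq (K : ConstantWidthBody n) {φ : F → ℝ} {ε σ R : ℝ}
    (hε : 0 ≤ ε) (hε₁ : ε ≤ 1 / 2) (hc : Continuous φ) (hφ : ∀ y, |φ y| ≤ σ)
    (hR : ∀ y, R ≤ ‖y‖ → φ y = 0)
    (hlow : ConvexOn ℝ univ fun y => supportFun K.1 (c.pt y) + φ y - ε * ‖c.pt y‖)
    (hup : ConvexOn ℝ univ fun y => (1 - ε) * ‖c.pt y‖ - (supportFun K.1 (c.pt y) + φ y)) :
    ∃ L : ConstantWidthBody n, IsRounded L.1 ε ∧ dist L K ≤ σ ∧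
      ∀ y, supportFun L.1 (c.pt y) = supportFun K.1 (c.pt y) + φ y := by
  let k : E n → ℝ := fun x => supportFun K.1 x + c.persp φ x - ε * ‖x‖
  have hwidth (x : E n) : k x + k (-x) = (1 - 2 * ε) * ‖x‖ := by
    simp only [k, persp_neg, norm_neg]
    linear_combination K.2.add_neg x
  have hadd : ∀ x y, k (x + y) ≤ k x + k y := by
    refine c.add_le_of_convexOn ?_ (fun a ha x => ?_) ?_ ?_ (fun p hp hep => ?_) fun x => ?_
    · exact ((continuous_supportFun K.1).add (c.continuous_persp hc hφ)).sub (by fun_prop)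
    · simp only [k, supportFun_smul K.1 ha, persp_smul, norm_smul, Real.norm_of_nonneg ha]
      ring
    · simpa only [k, persp_pt] using hlow
    · convert hup using 2 with y
      have hy := hwidth (c.pt y)
      simp only [k, persp_pt] at hy ⊢
      linarith
    · refine (K.2.hasFDerivAt_supportFun_sub_norm ε hp).differentiableAt.congr_of_eventuallyEq ?_
      filter_upwards [c.persp_eventually_eq_zero hR hp hep] with x hx
      simp only [k, hx, Pi.zero_apply, add_zero]
    · rw [hwidth]
      exact mul_nonneg (by linarith) (norm_nonneg x)
  obtain ⟨L, hLK, hL⟩ := exists_isRounded_supportFun_eq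
    (h := fun x => supportFun K.1 x + c.persp φ x) hε
    (fun a ha x => by rw [supportFun_smul K.1 ha.le, persp_smul, mul_add]) hadd
    (fun u hu => by linear_combination K.2 u hu + c.persp_neg (φ := φ) u)
  have hσ : 0 ≤ σ := (abs_nonneg _).trans (hφ 0)
  refine ⟨L, hL, dist_le_of_supportFun hσ fun u hu => ?_, fun y => ?_⟩
  · simp only [hLK, add_sub_cancel_left]
    refine (c.abs_persp_le hφ u).trans (mul_le_of_le_one_right hσ ?_)
    simpa only [c.norm_e, hu, one_mul] using abs_real_inner_le_norm c.e u
  · simp only [hLK, persp_pt]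

end Chart

section SecondDeriv

variable {F : Type*} [NormedAddCommGroup F] [InnerProductSpace ℝ F] {g g' : F → F} {z y : F}

/-- The second derivative in direction `z` of a function with gradient field `g`. -/
def secondDeriv (g : F → F) (z y : F) : ℝ := lineDeriv ℝ (fun y => ⟪g y, z⟫) y z

theorem secondDeriv_congr (h : g =ᶠ[𝓝 y] g') : secondDeriv g z y = secondDeriv g' z y :=
  EventuallyEq.lineDeriv_eq (h.fun_comp fun x => ⟪x, z⟫)

theorem secondDeriv_eq {H : F →L[ℝ] F} (hg : HasFDerivAt g H y) :
    secondDeriv g z y = ⟪H z, z⟫ := by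
  have hinner := (hg.inner ℝ (hasFDerivAt_const z y)).hasLineDerivAt z
  rw [secondDeriv, hinner.lineDeriv]
  simp [fderivInnerCLM_apply]

theorem secondDeriv_ridgeField {g₀ y₀ t : F} {H : F →L[ℝ] F} {k : ℝ} (hk : k ≠ 0) (α : ℝ) :
    secondDeriv (ridgeField g₀ y₀ t H k α) z y =
      ⟪H z, z⟫ + 1 / 2 * ⟪t, z⟫ ^ 2 * Real.cos (k * ⟪t, y - y₀⟫ + α) := by
  rw [secondDeriv_eq (hasFDerivAt_ridgeField hk y)]
  simp only [add_apply, smul_apply, ContinuousLinearMap.smulRight_apply, innerSL_apply_apply,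
    inner_add_left, real_inner_smul_left]
  ring

end SecondDeriv

section Phase

theorem sum_sq_add_mul_cos (a κ x : ℝ) :
    ∑ j ∈ Finset.range 4, (a + κ * Real.cos (x + j * (Real.pi / 2))) ^ 2 =
      4 * (a ^ 2 + κ ^ 2 / 2) := by
  have htwo : x + 2 * (Real.pi / 2) = x + Real.pi := by ring
  have hthree : x + 3 * (Real.pi / 2) = x + Real.pi / 2 + Real.pi := by ring
  simp only [Finset.sum_range_succ, Finset.sum_range_zero, Nat.cast_zero, Nat.cast_one,
    Nat.cast_ofNat, zero_mul, one_mul, htwo, hthree, Real.cos_add_pi, Real.cos_add_pi_div_two]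
  rw [zero_add, add_zero]
  linear_combination 2 * κ ^ 2 * Real.sin_sq_add_cos_sq x

theorem exists_le_integral_sq_add_mul_cos {X : Type*} [MeasurableSpace X] (μ : Measure X)
    [IsFiniteMeasure μ] (a κ : ℝ) {s : X → ℝ} (hs : Measurable s) :
    ∃ α, (a ^ 2 + κ ^ 2 / 2) * μ.real univ ≤ ∫ x, (a + κ * Real.cos (s x + α)) ^ 2 ∂μ := by
  have hint (α : ℝ) : Integrable (fun x => (a + κ * Real.cos (s x + α)) ^ 2) μ := by
    refine Integrable.of_bound (by fun_prop) ((|a| + |κ|) ^ 2) (Eventually.of_forall fun x => ?_)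
    rw [norm_pow, Real.norm_eq_abs]
    gcongr
    refine (abs_add_le _ _).trans (add_le_add_right ?_ _)
    rw [abs_mul]
    exact mul_le_of_le_one_right (abs_nonneg κ) (Real.abs_cos_le_one _)
  have haverage : ∑ _j ∈ Finset.range 4, (a ^ 2 + κ ^ 2 / 2) * μ.real univ ≤
      ∑ j ∈ Finset.range 4, ∫ x, (a + κ * Real.cos (s x + j * (Real.pi / 2))) ^ 2 ∂μ := by
    rw [← integral_finsetSum _ fun j _ => hint _]
    simp only [sum_sq_add_mul_cos, integral_const, Finset.sum_const, Finset.card_range,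
      smul_eq_mul, nsmul_eq_mul, Nat.cast_ofNat]
    exact le_of_eq (by ring)
  obtain ⟨j, -, hj⟩ := Finset.exists_le_of_sum_le (by simp) haverage
  exact ⟨_, hj⟩

theorem exists_lt_one_sub_pow_mul {b B : ℝ} (h : b < B) (m : ℕ) :
    ∃ θ ∈ Ioo (0 : ℝ) 1, b < (1 - θ) ^ m * B := by
  have hcont : ContinuousAt (fun θ : ℝ => (1 - θ) ^ m * B) 0 := by fun_prop
  have hev : ∀ᶠ θ in 𝓝[>] (0 : ℝ), b < (1 - θ) ^ m * B :=
    (hcont.eventually_const_lt (by simpa using h)).filter_mono nhdsWithin_le_nhds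
  exact ((show ∀ᶠ θ in 𝓝[>] (0 : ℝ), θ ∈ Ioo (0 : ℝ) 1 from Ioo_mem_nhdsGT one_pos).and hev).exists

end Phase

section EnergyGain

variable {F : Type*} [NormedAddCommGroup F] [InnerProductSpace ℝ F] [FiniteDimensional ℝ F]
  [MeasurableSpace F] (μ : Measure F) [μ.IsAddHaarMeasure]

theorem eventually_integral_closedBall_le {q : F → ℝ} {y₀ : F} {b B : ℝ} (hb : b < B)
    (hq : Tendsto (fun ρ => ⨍ y in Metric.closedBall y₀ ρ, q y ∂μ) (𝓝[>] 0) (𝓝 b)) :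
    ∀ᶠ ρ in 𝓝[>] 0, ∫ y in Metric.closedBall y₀ ρ, q y ∂μ ≤
      B * μ.real (Metric.closedBall y₀ ρ) := by
  filter_upwards [hq.eventually (gt_mem_nhds hb), self_mem_nhdsWithin] with ρ hρ (hpos : 0 < ρ)
  have hvol : 0 < μ.real (Metric.closedBall y₀ ρ) :=
    ENNReal.toReal_pos (Metric.measure_closedBall_pos μ y₀ hpos).ne' measure_closedBall_lt_top.ne
  rw [setAverage_eq, smul_eq_mul, inv_mul_lt_iff₀ hvol, mul_comm] at hρ
  exact hρ.le

variable [BorelSpace F]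

theorem measureReal_ball_mul {a ρ : ℝ} (ha : 0 < a) (hρ : 0 < ρ) (y : F) :
    μ.real (Metric.ball y (a * ρ)) =
      a ^ Module.finrank ℝ F * μ.real (Metric.closedBall y ρ) := by
  rw [measureReal_def, measureReal_def, Measure.addHaar_ball_of_pos μ y (mul_pos ha hρ),
    Measure.addHaar_closedBall μ y hρ.le, ENNReal.toReal_mul, ENNReal.toReal_mul,
    ENNReal.toReal_ofReal (by positivity), ENNReal.toReal_ofReal (by positivity), mul_pow,
    mul_assoc]

variable {f : F → ℝ} {g ν : F → F} {y₀ t z : F} {H M : F →L[ℝ] F} {lam ε σ c₀ : ℝ}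

/-- The rank-one oscillation adds `κ² / 2` to the mean of the squared second derivative, where
`κ = ⟪t, z⟫² / 2`; half of this is spent on the cutoff and on the passage to the mean. -/
theorem eventually_exists_isLocalPerturbation_integral_le
    (hf : ∀ y, HasFDerivAt f (innerSL ℝ (g y)) y) (hg : Continuous g) (hgH : HasFDerivAt g H y₀)
    (hsymm : ∀ a b, ⟪H a, b⟫ = ⟪a, H b⟫) (hε : 0 < ε) (hε₁ : ε ≤ 1)
    (hpinched : IsPinchedOn ε ν g univ) (hν : HasStrictFDerivAt ν M y₀) (hlam : 0 < lam)
    (hM : ∀ d, lam * ‖d‖ ^ 2 ≤ ⟪M d, d⟫)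
    (ht : ∀ d, ⟪t, d⟫ ^ 2 ≤ ⟪H d, d⟫ ∧ ⟪t, d⟫ ^ 2 ≤ ⟪M d, d⟫ - ⟪H d, d⟫)
    (hσ : 0 < σ) (hc₀ : 0 < c₀) (htz : c₀ ≤ ⟪t, z⟫)
    (hlebesgue : Tendsto (fun ρ => ⨍ y in Metric.closedBall y₀ ρ, secondDeriv g z y ^ 2 ∂μ)
      (𝓝[>] 0) (𝓝 (secondDeriv g z y₀ ^ 2))) :
    ∀ᶠ ρ in 𝓝[>] 0, ∃ φ γ, IsLocalPerturbation g ν (ε / 4) σ y₀ ρ φ γ ∧ ∃ r ≤ ρ,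
      (∫ y in Metric.closedBall y₀ ρ, secondDeriv g z y ^ 2 ∂μ)
          + c₀ ^ 4 / 16 * μ.real (Metric.closedBall y₀ ρ) ≤
        ∫ y in Metric.ball y₀ r, secondDeriv (fun y => g y + γ y) z y ^ 2 ∂μ := by
  rw [secondDeriv_eq hgH] at hlebesgue
  set a := ⟪H z, z⟫
  set κ := 1 / 2 * ⟪t, z⟫ ^ 2 with hκ_def
  have hκ : c₀ ^ 4 / 16 ≤ κ ^ 2 / 4 := by
    have := pow_le_pow_left₀ hc₀.le htz 4
    rw [hκ_def]
    linarith
  have hκ_pos : 0 < κ ^ 2 := by linarith [pow_pos hc₀ 4]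
  obtain ⟨θ, ⟨hθ, hθ₁⟩, hθ_energy⟩ := exists_lt_one_sub_pow_mul
    (show a ^ 2 + 3 * κ ^ 2 / 8 < a ^ 2 + κ ^ 2 / 2 by linarith) (Module.finrank ℝ F)
  filter_upwards [self_mem_nhdsWithin, eventually_integral_closedBall_le μ
      (show a ^ 2 < a ^ 2 + κ ^ 2 / 8 by linarith) hlebesgue,
    eventually_exists_isLocalPerturbation_ridgeField hf hg hgH hsymm hε hε₁ hpinched hν hlam hM ht
      hθ hθ₁ hσ] with ρ (hρ : 0 < ρ) hmean ⟨k, hk, hperturbation⟩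
  set r := (1 - θ) * ρ
  have := isFiniteMeasure_restrict.2 (measure_ball_lt_top (μ := μ) (x := y₀) (r := r)).ne
  obtain ⟨α, hα⟩ := exists_le_integral_sq_add_mul_cos (μ.restrict (Metric.ball y₀ r)) a κ
    (s := fun y => k * ⟪t, y - y₀⟫) (Continuous.measurable (by fun_prop))
  obtain ⟨φ, γ, hφ, hγ⟩ := hperturbation α
  refine ⟨φ, γ, hφ, r, mul_le_of_le_one_left hρ.le (by linarith), ?_⟩
  have hoscillation : ∀ y ∈ Metric.ball y₀ r, secondDeriv (fun y => g y + γ y) z y ^ 2 =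
      (a + κ * Real.cos (k * ⟪t, y - y₀⟫ + α)) ^ 2 := fun y hy => by
    rw [secondDeriv_congr (mem_of_superset (Metric.isOpen_ball.mem_nhds hy) hγ),
      secondDeriv_ridgeField hk.ne']
  rw [setIntegral_congr_fun Metric.isOpen_ball.measurableSet hoscillation]
  refine le_trans ?_ hα
  rw [measureReal_restrict_apply_univ, measureReal_ball_mul μ (by linarith) hρ, ← mul_assoc]
  have hvol : 0 ≤ μ.real (Metric.closedBall y₀ ρ) := measureReal_nonneg
  nlinarith

end EnergyGain

namespace Chart

section Calculus

variable {n : ℕ} {F : Type*} [NormedAddCommGroup F] [InnerProductSpace ℝ F] (c : Chart n F)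

/-- The coordinate expression of a vector field: if `q` is the gradient of `h`, then `c.pullback q`
is the gradient of `h ∘ c.pt`. -/
def pullback (q : E n → E n) (y : F) : F := c.π (q (c.pt y))

/-- The compression of a linear map to the coordinate space of a chart. -/
def compress (A : E n →L[ℝ] E n) : F →L[ℝ] F :=
  c.π ∘L A ∘L c.ι.toContinuousLinearMap

theorem inner_compress (A : E n →L[ℝ] E n) (a b : F) :
    ⟪c.compress A a, b⟫ = ⟪A (c.ι a), c.ι b⟫ := c.inner_π _ _

variable {q ν : E n → E n} {A : E n →L[ℝ] E n} {y : F}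

theorem hasFDerivAt_pullback (hq : HasFDerivAt q A (c.pt y)) :
    HasFDerivAt (c.pullback q) (c.compress A) y :=
  c.π.hasFDerivAt.comp y (hq.comp y (c.hasFDerivAt_pt y))

theorem hasStrictFDerivAt_pullback (hq : HasStrictFDerivAt q A (c.pt y)) :
    HasStrictFDerivAt (c.pullback q) (c.compress A) y :=
  c.π.hasStrictFDerivAt.comp y
    (hq.comp y (c.ι.toContinuousLinearMap.hasStrictFDerivAt.const_add c.e))

theorem continuous_pullback (hq : ∀ v ≠ 0, ContinuousAt q v) : Continuous (c.pullback q) :=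
  c.π.continuous.comp <| continuous_iff_continuousAt.2 fun y =>
    (hq _ (c.pt_ne_zero y)).comp c.continuous_pt.continuousAt

theorem inner_pullback_sub (q : E n → E n) (v w : F) :
    ⟪c.pullback q v - c.pullback q w, v - w⟫ =
      ⟪q (c.pt v) - q (c.pt w), c.pt v - c.pt w⟫ := by
  rw [pullback, pullback, ← map_sub, c.inner_π, c.pt_sub_pt]

theorem isPinchedOn_pullback {ε : ℝ} (h : IsPinchedOn ε ν q {0}ᶜ) :
    IsPinchedOn ε (c.pullback ν) (c.pullback q) univ := fun v _ w _ => by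
  rw [inner_pullback_sub, inner_pullback_sub]
  exact h _ (c.pt_ne_zero v) _ (c.pt_ne_zero w)

theorem inner_pt_ι (y d : F) : ⟪c.pt y, c.ι d⟫ = ⟪y, d⟫ := by rw [← c.inner_π, c.π_pt]

theorem norm_pt_sq (y : F) : ‖c.pt y‖ ^ 2 = 1 + ‖y‖ ^ 2 := by
  rw [pt, norm_add_sq_real, c.inner_e_ι, c.norm_e, LinearIsometry.norm_map]
  ring

theorem le_inner_compress_normalizeDeriv (y d : F) :
    (‖c.pt y‖ ^ 3)⁻¹ * ‖d‖ ^ 2 ≤ ⟪c.compress (normalizeDeriv (c.pt y)) d, d⟫ := by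
  have hpos := c.norm_pt_pos y
  have hcauchy : ‖d‖ ^ 2 ≤ ‖c.pt y‖ ^ 2 * ‖d‖ ^ 2 - ⟪y, d⟫ ^ 2 := by
    have := sq_le_sq.2 ((abs_real_inner_le_norm y d).trans (le_abs_self _))
    rw [c.norm_pt_sq]
    linarith
  calc (‖c.pt y‖ ^ 3)⁻¹ * ‖d‖ ^ 2
      ≤ (‖c.pt y‖ ^ 3)⁻¹ * (‖c.pt y‖ ^ 2 * ‖d‖ ^ 2 - ⟪y, d⟫ ^ 2) := by gcongr
    _ = ⟪c.compress (normalizeDeriv (c.pt y)) d, d⟫ := by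
      rw [c.inner_compress, normalizeDeriv_apply, real_inner_smul_left, inner_sub_left,
        real_inner_smul_left, c.inner_pt_ι, LinearIsometry.inner_map_map,
        real_inner_self_eq_norm_sq]
      field_simp

end Calculus

section SupportPoint

variable {n : ℕ} {F : Type*} [NormedAddCommGroup F] [InnerProductSpace ℝ F] (c : Chart n F)
  {K : ConvexBody (E n)} {A : E n →L[ℝ] E n} {y : F}

theorem lipschitzWith_supportPoint_comp_pt (hK : IsOfConstantWidth K 1) :
    LipschitzWith 1 (supportPoint K ∘ c.pt) := by
  refine LipschitzWith.of_dist_le_mul fun v w => ?_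
  rw [dist_eq_norm, dist_eq_norm, NNReal.coe_one, one_mul]
  refine (hK.norm_supportPoint_sub_le (c.pt_ne_zero v) (c.pt_ne_zero w)).trans ?_
  refine (norm_normalize_sub_le (c.one_le_norm_pt v) (c.one_le_norm_pt w)).trans_eq ?_
  rw [c.pt_sub_pt, LinearIsometry.norm_map]

theorem hasFDerivAt_supportFun_pt (hK : IsOfConstantWidth K 1) (y : F) :
    HasFDerivAt (fun y => supportFun K (c.pt y)) (innerSL ℝ (c.pullback (supportPoint K) y)) y :=
  c.hasFDerivAt_comp_pt (hK.hasFDerivAt_supportFun (c.pt_ne_zero y))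

theorem exists_hasFDerivAt_supportPoint (hK : IsOfConstantWidth K 1)
    (hy : DifferentiableAt ℝ (supportPoint K ∘ c.pt) y) :
    ∃ A : E n →L[ℝ] E n, HasFDerivAt (supportPoint K) A (c.pt y) := by
  have hinner : DifferentiableAt ℝ (fun x => ⟪c.e, x⟫) (c.pt y) :=
    (innerSL ℝ c.e).differentiableAt
  have hcoord : DifferentiableAt ℝ (fun x => ⟪c.e, x⟫⁻¹ • c.π x) (c.pt y) :=
    (hinner.inv (by rw [c.inner_e_pt]; exact one_ne_zero)).smul c.π.differentiableAt
  have hcoord_pt : ⟪c.e, c.pt y⟫⁻¹ • c.π (c.pt y) = y := by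
    rw [c.inner_e_pt, c.π_pt, inv_one, one_smul]
  have hcomp : DifferentiableAt ℝ
      (fun x => supportPoint K (c.pt (⟪c.e, x⟫⁻¹ • c.π x))) (c.pt y) :=
    DifferentiableAt.comp (g := supportPoint K ∘ c.pt) (c.pt y) (by rwa [hcoord_pt]) hcoord
  have hpos : ∀ᶠ x in 𝓝 (c.pt y), 0 < ⟪c.e, x⟫ :=
    hinner.continuousAt.eventually_const_lt (one_pos.trans_eq (c.inner_e_pt y).symm)
  refine ⟨_, (hcomp.congr_of_eventuallyEq ?_).hasFDerivAt⟩
  filter_upwards [hpos] with x hx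
  rw [← hK.supportPoint_smul hx (c.pt_ne_zero _), c.smul_pt hx.ne']

theorem lineDeriv_supportPoint_comp_pt (hA : HasFDerivAt (supportPoint K) A (c.pt y)) (z : F) :
    lineDeriv ℝ (supportPoint K ∘ c.pt) y z = A (c.ι z) :=
  ((hA.comp y (c.hasFDerivAt_pt y)).hasLineDerivAt z).lineDeriv

end SupportPoint

section Defect

variable {n : ℕ} {F : Type*} [NormedAddCommGroup F] [InnerProductSpace ℝ F] (c : Chart n F)
  {K : ConvexBody (E n)} {A : E n →L[ℝ] E n} {y : F}

/-- The deviation from equality in `‖v‖ * ‖A x‖ ^ 2 ≤ ⟪A x, x⟫` at `v = c.pt y` and `x = c.ι z`, as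
a function of the value `D = A x`, so that it also makes sense for difference quotients. -/
def defectForm (z y : F) (D : E n) : ℝ := ⟪D, c.ι z⟫ - ‖c.pt y‖ * ‖D‖ ^ 2

/-- The defect of `K` at `c.pt y` in direction `c.ι z`. -/
def defect (K : ConvexBody (E n)) (z y : F) : ℝ :=
  c.defectForm z y (lineDeriv ℝ (supportPoint K ∘ c.pt) y z)

theorem defect_eq (hA : HasFDerivAt (supportPoint K) A (c.pt y)) (z : F) :
    c.defect K z y = ⟪A (c.ι z), c.ι z⟫ - ‖c.pt y‖ * ‖A (c.ι z)‖ ^ 2 := by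
  rw [defect, c.lineDeriv_supportPoint_comp_pt hA, defectForm]

variable [FiniteDimensional ℝ F] [MeasurableSpace F] [BorelSpace F] (μ : Measure F)
  [μ.IsAddHaarMeasure]

theorem eventually_exists_isLocalPerturbation (hK : IsOfConstantWidth K 1) {ε σ c₀ : ℝ}
    (hε : 0 < ε) (hε₁ : ε ≤ 1) (hKε : IsRounded K ε) (hσ : 0 < σ) (hc₀ : 0 < c₀) {z : F}
    (hz : ‖z‖ ≤ 1) (hy : DifferentiableAt ℝ (supportPoint K ∘ c.pt) y)
    (hdefect : c₀ ≤ c.defect K z y)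
    (hlebesgue : Tendsto
      (fun ρ => ⨍ y in Metric.closedBall y ρ, secondDeriv (c.pullback (supportPoint K)) z y ^ 2 ∂μ)
      (𝓝[>] 0) (𝓝 (secondDeriv (c.pullback (supportPoint K)) z y ^ 2))) :
    ∀ᶠ ρ in 𝓝[>] 0, ∃ φ γ,
      IsLocalPerturbation (c.pullback (supportPoint K)) (c.pullback NormedSpace.normalize)
        (ε / 4) σ y ρ φ γ ∧
      ∃ r ≤ ρ, (∫ w in Metric.closedBall y ρ, secondDeriv (c.pullback (supportPoint K)) z w ^ 2 ∂μ)
          + c₀ ^ 4 / 16 * μ.real (Metric.closedBall y ρ) ≤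
        ∫ w in Metric.ball y r,
          secondDeriv (fun w => c.pullback (supportPoint K) w + γ w) z w ^ 2 ∂μ := by
  obtain ⟨A, hA⟩ := c.exists_hasFDerivAt_supportPoint hK hy
  have hp := c.pt_ne_zero y
  have hsymm := hK.inner_deriv_comm hp hA
  have hιz : ‖c.ι z‖ ≤ 1 := by rwa [LinearIsometry.norm_map]
  set T := A (c.ι z) - ‖c.pt y‖ • A (A (c.ι z)) with hT
  have hTz : ⟪T, c.ι z⟫ = c.defect K z y := by
    rw [c.defect_eq hA, hT, inner_sub_left, real_inner_smul_left, hsymm (A (c.ι z)),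
      real_inner_self_eq_norm_sq]
  refine eventually_exists_isLocalPerturbation_integral_le μ (t := c.π T)
    (c.hasFDerivAt_supportFun_pt hK) (c.continuous_pullback fun v => hK.continuousAt_supportPoint)
    (c.hasFDerivAt_pullback hA) (fun a b => ?_) hε hε₁ (c.isPinchedOn_pullback (hKε.isPinchedOn hK))
    (c.hasStrictFDerivAt_pullback (hasStrictFDerivAt_normalize hp))
    (inv_pos.2 (pow_pos (c.norm_pt_pos y) 3)) (c.le_inner_compress_normalizeDeriv y)
    (fun d => ?_) hσ hc₀ (by rwa [c.inner_π, hTz]) hlebesgue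
  · rw [c.inner_compress, hsymm, real_inner_comm, ← c.inner_compress, real_inner_comm]
  · rw [c.inner_π, c.inner_compress, c.inner_compress]
    exact ⟨hK.inner_deriv_sub_sq_le (c.one_le_norm_pt y) hA hιz _,
      hK.inner_deriv_sub_sq_le_compl (c.one_le_norm_pt y) hA hιz _⟩

end Defect

end Chart

theorem exists_finset_half_measureReal_le {α : Type*} [MeasurableSpace α] (μ : Measure α)
    {s t : Set α} {B : α → Set α} (ht : t.Countable) (hB : ∀ x ∈ t, MeasurableSet (B x))
    (hdisj : t.PairwiseDisjoint B) (hcov : μ (s \ ⋃ x ∈ t, B x) = 0) (hfin : ∀ x ∈ t, μ (B x) ≠ ∞)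
    (hs : μ s ≠ ∞) (hs₀ : μ s ≠ 0) :
    ∃ u : Finset α, (u : Set α) ⊆ t ∧ μ.real s / 2 ≤ ∑ x ∈ u, μ.real (B x) := by
  have hle : μ s ≤ ∑' x : t, μ (B x) := by
    rw [← measure_biUnion ht hdisj hB]
    exact measure_mono_ae (ae_le_set.2 hcov)
  have hlt : μ s / 2 < ∑' x : t, μ (B x) := (ENNReal.half_lt_self hs₀ hs).trans_le hle
  rw [ENNReal.tsum_eq_iSup_sum, lt_iSup_iff] at hlt
  obtain ⟨u, hu⟩ := hlt
  have hfin_u : ∀ x ∈ u, μ (B x) ≠ ∞ := fun x _ => hfin x x.2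
  refine ⟨u.map (Function.Embedding.subtype _), fun x hx => ?_, ?_⟩
  · obtain ⟨x, -, rfl⟩ := Finset.mem_map.1 (Finset.mem_coe.1 hx)
    exact x.2
  · have hreal := ENNReal.toReal_mono (ENNReal.sum_ne_top.2 hfin_u) hu.le
    rw [ENNReal.toReal_div, ENNReal.toReal_ofNat, ENNReal.toReal_sum hfin_u] at hreal
    rwa [Finset.sum_map]

section FinitePerturbation

variable {F : Type*} [NormedAddCommGroup F] [InnerProductSpace ℝ F]

theorem convexOn_add_const_mul_of_gradient {f N : F → ℝ} {g ν : F → F} (a b : ℝ)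
    (hf : ∀ y, HasFDerivAt f (innerSL ℝ (g y)) y) (hN : ∀ y, HasFDerivAt N (innerSL ℝ (ν y)) y)
    (hg : Continuous g) (hν : Continuous ν)
    (hloc : ∀ y, ∀ᶠ w in 𝓝 y, 0 ≤ a * ⟪g w - g y, w - y⟫ + b * ⟪ν w - ν y, w - y⟫) :
    ConvexOn ℝ univ fun y => a * f y + b * N y := by
  refine convexOn_univ_of_gradient (g := fun y => a • g y + b • ν y) (fun y => ?_) (by fun_prop)
    fun y => (hloc y).mono fun w hw => ?_
  · rw [map_add, map_smul, map_smul]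
    exact ((hf y).const_mul a).add ((hN y).const_mul b)
  · rwa [add_sub_add_comm, ← smul_sub, ← smul_sub, inner_add_left, real_inner_smul_left,
      real_inner_smul_left]

namespace IsLocalPerturbation

variable {g ν : F → F} {ε σ : ℝ}

theorem eq_zero_of_notMem_ball {ρ : ℝ} {y₀ y : F} {φ : F → ℝ} {γ : F → F}
    (h : IsLocalPerturbation g ν ε σ y₀ ρ φ γ) (hy : y ∉ Metric.ball y₀ ρ) :
    φ y = 0 ∧ γ y = 0 := by
  obtain ⟨r, hr, hzero⟩ := h.eq_zero
  rw [mem_ball_iff_norm, not_lt] at hy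
  exact hzero y (hr.le.trans hy)

theorem eventually_gradient_eq_zero {ρ : ℝ} {y₀ y : F} {φ : F → ℝ} {γ : F → F}
    (h : IsLocalPerturbation g ν ε σ y₀ ρ φ γ) (hy : y ∉ Metric.ball y₀ ρ) :
    ∀ᶠ w in 𝓝 y, γ w = 0 := by
  obtain ⟨r, hr, hzero⟩ := h.eq_zero
  rw [mem_ball_iff_norm, not_lt] at hy
  have hcont : Continuous fun w => ‖w - y₀‖ := by fun_prop
  filter_upwards [hcont.continuousAt.eventually_const_lt (hr.trans_le hy)] with w hw
  exact (hzero w hw.le).2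

variable {t : Finset F} {ρ : F → ℝ} {φ : F → F → ℝ} {γ : F → F → F}

theorem sum_eq (h : ∀ j ∈ t, IsLocalPerturbation g ν ε σ j (ρ j) (φ j) (γ j))
    (hdisj : (t : Set F).PairwiseDisjoint fun j => Metric.closedBall j (ρ j)) {j y : F} (hj : j ∈ t)
    (hy : y ∈ Metric.closedBall j (ρ j)) :
    ∑ i ∈ t, φ i y = φ j y ∧ ∑ i ∈ t, γ i y = γ j y := by
  have hzero (i : F) (hi : i ∈ t) (hij : i ≠ j) : φ i y = 0 ∧ γ i y = 0 :=
    (h i hi).eq_zero_of_notMem_ball fun hyi =>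
      Set.disjoint_left.1 (hdisj hi hj hij) (Metric.ball_subset_closedBall hyi) hy
  exact ⟨Finset.sum_eq_single_of_mem j hj fun i hi hij => (hzero i hi hij).1,
    Finset.sum_eq_single_of_mem j hj fun i hi hij => (hzero i hi hij).2⟩

theorem sum_eq_zero (h : ∀ j ∈ t, IsLocalPerturbation g ν ε σ j (ρ j) (φ j) (γ j)) {y : F}
    (hy : ∀ j ∈ t, y ∉ Metric.ball j (ρ j)) : ∑ i ∈ t, φ i y = 0 ∧ ∑ i ∈ t, γ i y = 0 :=
  ⟨Finset.sum_eq_zero fun i hi => ((h i hi).eq_zero_of_notMem_ball (hy i hi)).1,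
    Finset.sum_eq_zero fun i hi => ((h i hi).eq_zero_of_notMem_ball (hy i hi)).2⟩

theorem eventually_sum_gradient_eq_zero
    (h : ∀ j ∈ t, IsLocalPerturbation g ν ε σ j (ρ j) (φ j) (γ j)) {y : F}
    (hy : ∀ j ∈ t, y ∉ Metric.ball j (ρ j)) : ∀ᶠ w in 𝓝 y, ∑ i ∈ t, γ i w = 0 := by
  have hzero : ∀ᶠ w in 𝓝 y, ∀ i ∈ t, γ i w = 0 :=
    (Filter.eventually_all_finset t).2 fun i hi => (h i hi).eventually_gradient_eq_zero (hy i hi)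
  exact hzero.mono fun w => Finset.sum_eq_zero

theorem hasFDerivAt_sum (h : ∀ j ∈ t, IsLocalPerturbation g ν ε σ j (ρ j) (φ j) (γ j)) (y : F) :
    HasFDerivAt (fun y => ∑ j ∈ t, φ j y) (innerSL ℝ (∑ j ∈ t, γ j y)) y := by
  rw [map_sum]
  exact HasFDerivAt.fun_sum fun j hj => (h j hj).hasFDerivAt y

theorem abs_sum_le (h : ∀ j ∈ t, IsLocalPerturbation g ν ε σ j (ρ j) (φ j) (γ j))
    (hdisj : (t : Set F).PairwiseDisjoint fun j => Metric.closedBall j (ρ j)) (hσ : 0 ≤ σ) (y : F) :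
    |∑ j ∈ t, φ j y| ≤ σ := by
  by_cases hy : ∃ j ∈ t, y ∈ Metric.ball j (ρ j)
  · obtain ⟨j, hj, hyj⟩ := hy
    rw [(sum_eq h hdisj hj (Metric.ball_subset_closedBall hyj)).1]
    exact (h j hj).abs_le y
  · push Not at hy
    rwa [(sum_eq_zero h hy).1, abs_zero]

theorem sum_eq_zero_of_le_norm (h : ∀ j ∈ t, IsLocalPerturbation g ν ε σ j (ρ j) (φ j) (γ j))
    {y : F} (hy : ∑ j ∈ t, (‖j‖ + |ρ j|) ≤ ‖y‖) : ∑ j ∈ t, φ j y = 0 := by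
  refine (sum_eq_zero h fun j hj hyj => ?_).1
  have hsingle : ‖j‖ + |ρ j| ≤ ∑ j ∈ t, (‖j‖ + |ρ j|) :=
    Finset.single_le_sum (f := fun j => ‖j‖ + |ρ j|) (fun _ _ => by positivity) hj
  linarith [mem_ball_iff_norm.1 hyj, norm_sub_norm_le y j, le_abs_self (ρ j)]

theorem eventually_pinched_sum (hg : IsPinchedOn ε ν g univ)
    (h : ∀ j ∈ t, IsLocalPerturbation g ν ε σ j (ρ j) (φ j) (γ j))
    (hdisj : (t : Set F).PairwiseDisjoint fun j => Metric.closedBall j (ρ j)) (y : F) :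
    ∀ᶠ w in 𝓝 y,
      ε * ⟪ν w - ν y, w - y⟫ ≤ ⟪g w + ∑ j ∈ t, γ j w - (g y + ∑ j ∈ t, γ j y), w - y⟫ ∧
      ⟪g w + ∑ j ∈ t, γ j w - (g y + ∑ j ∈ t, γ j y), w - y⟫ ≤
        (1 - ε) * ⟪ν w - ν y, w - y⟫ := by
  by_cases hy : ∃ j ∈ t, y ∈ Metric.ball j (ρ j)
  · obtain ⟨j, hj, hyj⟩ := hy
    filter_upwards [Metric.isOpen_ball.mem_nhds hyj] with w hw
    rw [(sum_eq h hdisj hj (Metric.ball_subset_closedBall hyj)).2,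
      (sum_eq h hdisj hj (Metric.ball_subset_closedBall hw)).2]
    exact (h j hj).isPinchedOn w hw y hyj
  · push Not at hy
    filter_upwards [eventually_sum_gradient_eq_zero h hy] with w hw
    rw [hw, (sum_eq_zero h hy).2, add_zero, add_zero]
    exact hg w (mem_univ w) y (mem_univ y)

end IsLocalPerturbation

end FinitePerturbation

namespace Chart

section Perturbation

variable {n : ℕ} {F : Type*} [NormedAddCommGroup F] [InnerProductSpace ℝ F] (c : Chart n F)

theorem hasFDerivAt_norm_pt (y : F) :
    HasFDerivAt (fun y => ‖c.pt y‖) (innerSL ℝ (c.pullback NormedSpace.normalize y)) y :=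
  c.hasFDerivAt_comp_pt (hasStrictFDerivAt_norm (c.pt_ne_zero y)).hasFDerivAt

theorem exists_isRounded_pullback_eq (K : ConstantWidthBody n) {ε σ R : ℝ} {φ : F → ℝ} {γ : F → F}
    (hε : 0 ≤ ε) (hε₁ : ε ≤ 1 / 2) (hφ : ∀ y, HasFDerivAt φ (innerSL ℝ (γ y)) y)
    (hγ : Continuous γ) (hσ : ∀ y, |φ y| ≤ σ) (hR : ∀ y, R ≤ ‖y‖ → φ y = 0)
    (hpinched : ∀ y, ∀ᶠ w in 𝓝 y,
      ε * ⟪c.pullback NormedSpace.normalize w - c.pullback NormedSpace.normalize y, w - y⟫ ≤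
        ⟪c.pullback (supportPoint K.1) w + γ w - (c.pullback (supportPoint K.1) y + γ y), w - y⟫ ∧
      ⟪c.pullback (supportPoint K.1) w + γ w - (c.pullback (supportPoint K.1) y + γ y), w - y⟫ ≤
        (1 - ε) *
          ⟪c.pullback NormedSpace.normalize w - c.pullback NormedSpace.normalize y, w - y⟫) :
    ∃ L : ConstantWidthBody n, IsRounded L.1 ε ∧ dist L K ≤ σ ∧
      ∀ y, c.pullback (supportPoint L.1) y = c.pullback (supportPoint K.1) y + γ y := by
  have hgrad (y : F) : HasFDerivAt (fun y => supportFun K.1 (c.pt y) + φ y)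
      (innerSL ℝ (c.pullback (supportPoint K.1) y + γ y)) y := by
    rw [map_add]
    exact (c.hasFDerivAt_supportFun_pt K.2 y).add (hφ y)
  have hcont : Continuous fun y => c.pullback (supportPoint K.1) y + γ y :=
    (c.continuous_pullback fun v => K.2.continuousAt_supportPoint).add hγ
  have hν : Continuous (c.pullback NormedSpace.normalize) :=
    c.continuous_pullback fun v => continuousAt_normalize
  have hlow := convexOn_add_const_mul_of_gradient 1 (-ε) hgrad c.hasFDerivAt_norm_pt hcont hν
    fun y => (hpinched y).mono fun w hw => by linarith [hw.1]
  have hup := convexOn_add_const_mul_of_gradient (-1) (1 - ε) hgrad c.hasFDerivAt_norm_pt hcont hν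
    fun y => (hpinched y).mono fun w hw => by linarith [hw.2]
  obtain ⟨L, hL, hdist, heq⟩ := c.exists_isRounded_supportFun_pt_eq K hε hε₁
    (continuous_iff_continuousAt.2 fun y => (hφ y).continuousAt) hσ hR
    (by convert hlow using 2; ring) (by convert hup using 2; ring)
  refine ⟨L, hL, hdist, fun y => ?_⟩
  have hLgrad := c.hasFDerivAt_supportFun_pt L.2 y
  rw [funext heq] at hLgrad
  exact ext_inner_right ℝ fun d => DFunLike.congr_fun (hLgrad.unique (hgrad y)) d

theorem exists_isRounded_pullback_eq_sum (K : ConstantWidthBody n) {ε σ : ℝ} {t : Finset F}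
    {ρ : F → ℝ} {φ : F → F → ℝ} {γ : F → F → F} (hε : 0 ≤ ε) (hε₁ : ε ≤ 1 / 2)
    (hKε : IsRounded K.1 ε) (hσ : 0 ≤ σ)
    (h : ∀ j ∈ t, IsLocalPerturbation (c.pullback (supportPoint K.1))
      (c.pullback NormedSpace.normalize) ε σ j (ρ j) (φ j) (γ j))
    (hdisj : (t : Set F).PairwiseDisjoint fun j => Metric.closedBall j (ρ j)) :
    ∃ L : ConstantWidthBody n, IsRounded L.1 ε ∧ dist L K ≤ σ ∧
      ∀ y, c.pullback (supportPoint L.1) y =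
        c.pullback (supportPoint K.1) y + ∑ j ∈ t, γ j y :=
  c.exists_isRounded_pullback_eq K hε hε₁ (IsLocalPerturbation.hasFDerivAt_sum h)
    (continuous_finsetSum _ fun j hj => (h j hj).continuous_gradient)
    (IsLocalPerturbation.abs_sum_le h hdisj hσ)
    (fun _ => IsLocalPerturbation.sum_eq_zero_of_le_norm h)
    (IsLocalPerturbation.eventually_pinched_sum (c.isPinchedOn_pullback (hKε.isPinchedOn K.2)) h
      hdisj)

end Perturbation

section Energy

variable {n : ℕ} {F : Type*} [NormedAddCommGroup F] [InnerProductSpace ℝ F] (c : Chart n F)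
  {K : ConvexBody (E n)} {z : F}

theorem norm_lineDeriv_supportPoint_le (hK : IsOfConstantWidth K 1) (hz : ‖z‖ ≤ 1) (y : F) :
    ‖lineDeriv ℝ (supportPoint K ∘ c.pt) y z‖ ≤ 1 := by
  have hle := norm_lineDeriv_le_of_lipschitz ℝ (c.lipschitzWith_supportPoint_comp_pt hK)
    (x₀ := y) (v := z)
  rw [NNReal.coe_one, one_mul] at hle
  exact hle.trans hz

theorem abs_secondDeriv_le (hK : IsOfConstantWidth K 1) (hz : ‖z‖ ≤ 1) (y : F) :
    |secondDeriv (c.pullback (supportPoint K)) z y| ≤ 1 := by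
  have hlip : LipschitzWith 1 fun y => ⟪c.pullback (supportPoint K) y, z⟫ := by
    refine LipschitzWith.of_dist_le_mul fun v w => ?_
    rw [Real.dist_eq, ← inner_sub_left, pullback, pullback, ← map_sub, c.inner_π, NNReal.coe_one,
      one_mul]
    calc |⟪supportPoint K (c.pt v) - supportPoint K (c.pt w), c.ι z⟫|
        ≤ ‖supportPoint K (c.pt v) - supportPoint K (c.pt w)‖ * ‖c.ι z‖ := abs_real_inner_le_norm ..
      _ ≤ dist v w * 1 := by
        gcongr
        · simpa only [dist_eq_norm, NNReal.coe_one, one_mul, Function.comp_apply] using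
            (c.lipschitzWith_supportPoint_comp_pt hK).dist_le_mul v w
        · rwa [LinearIsometry.norm_map]
      _ = dist v w := mul_one _
  have hle := norm_lineDeriv_le_of_lipschitz ℝ hlip (x₀ := y) (v := z)
  rw [NNReal.coe_one, one_mul] at hle
  exact hle.trans hz

theorem norm_pt_le (y : F) : ‖c.pt y‖ ≤ 1 + ‖y‖ := by
  refine (norm_add_le _ _).trans_eq ?_
  rw [c.norm_e, LinearIsometry.norm_map]

theorem abs_defectForm_le {D : E n} (hD : ‖D‖ ≤ 1) (hz : ‖z‖ ≤ 1) {R : ℝ} {y : F} (hy : ‖y‖ ≤ R) :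
    |c.defectForm z y D| ≤ 2 + R := by
  have hinner : |⟪D, c.ι z⟫| ≤ 1 := by
    refine (abs_real_inner_le_norm _ _).trans ?_
    rw [LinearIsometry.norm_map]
    exact mul_le_one₀ hD (norm_nonneg _) hz
  have hsq : ‖c.pt y‖ * ‖D‖ ^ 2 ≤ 1 + R :=
    (mul_le_of_le_one_right (norm_nonneg _) (pow_le_one₀ (norm_nonneg _) hD)).trans
      ((c.norm_pt_le y).trans (by gcongr))
  calc |c.defectForm z y D| ≤ |⟪D, c.ι z⟫| + |‖c.pt y‖ * ‖D‖ ^ 2| := abs_sub _ _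
    _ ≤ 1 + (1 + R) := by
      rw [abs_of_nonneg (by positivity : 0 ≤ ‖c.pt y‖ * ‖D‖ ^ 2)]
      gcongr
    _ = 2 + R := by ring

theorem abs_defect_le (hK : IsOfConstantWidth K 1) (hz : ‖z‖ ≤ 1) {R : ℝ} {y : F}
    (hy : ‖y‖ ≤ R) : |c.defect K z y| ≤ 2 + R :=
  c.abs_defectForm_le (c.norm_lineDeriv_supportPoint_le hK hz y) hz hy

variable [MeasurableSpace F] [BorelSpace F]

theorem measurable_secondDeriv (hK : IsOfConstantWidth K 1) :
    Measurable (secondDeriv (c.pullback (supportPoint K)) z) :=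
  measurable_lineDeriv <|
    (c.continuous_pullback fun _ => hK.continuousAt_supportPoint).inner continuous_const

theorem measurable_defectForm {D : F → E n} (hD : Measurable D) :
    Measurable fun y => c.defectForm z y (D y) :=
  hD.inner_const.sub (c.continuous_pt.norm.measurable.mul (hD.norm.pow_const 2))

theorem measurable_defect (hK : IsOfConstantWidth K 1) : Measurable (c.defect K z) :=
  c.measurable_defectForm <|
    measurable_lineDeriv (c.lipschitzWith_supportPoint_comp_pt hK).continuous

variable [FiniteDimensional ℝ F] (μ : Measure F) [μ.IsAddHaarMeasure]

theorem locallyIntegrable_secondDeriv_sq (hK : IsOfConstantWidth K 1) (hz : ‖z‖ ≤ 1) :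
    LocallyIntegrable (fun y => secondDeriv (c.pullback (supportPoint K)) z y ^ 2) μ := by
  refine (locallyIntegrable_const (1 : ℝ)).mono
    ((c.measurable_secondDeriv hK).pow_const 2).aestronglyMeasurable
    (Eventually.of_forall fun y => ?_)
  rw [norm_pow, Real.norm_eq_abs, norm_one]
  exact pow_le_one₀ (abs_nonneg _) (c.abs_secondDeriv_le hK hz y)

theorem integrableOn_secondDeriv_sq (hK : IsOfConstantWidth K 1) (hz : ‖z‖ ≤ 1) {s : Set F}
    (hs : Bornology.IsBounded s) :
    IntegrableOn (fun y => secondDeriv (c.pullback (supportPoint K)) z y ^ 2) s μ :=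
  ((c.locallyIntegrable_secondDeriv_sq μ hK hz).integrableOn_isCompact
    hs.isCompact_closure).mono_set subset_closure

theorem ae_tendsto_average_secondDeriv_sq (hK : IsOfConstantWidth K 1) (hz : ‖z‖ ≤ 1) :
    ∀ᵐ y₀ ∂μ, Tendsto
      (fun ρ => ⨍ y in Metric.closedBall y₀ ρ, secondDeriv (c.pullback (supportPoint K)) z y ^ 2 ∂μ)
      (𝓝[>] 0) (𝓝 (secondDeriv (c.pullback (supportPoint K)) z y₀ ^ 2)) := by
  filter_upwards [IsUnifLocDoublingMeasure.ae_tendsto_average μ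
    (c.locallyIntegrable_secondDeriv_sq μ hK hz) 1] with y₀ hy₀
  refine hy₀ (fun _ => y₀) id tendsto_id ?_
  filter_upwards [self_mem_nhdsWithin] with ρ (hρ : 0 < ρ)
  exact Metric.mem_closedBall_self (by rw [one_mul]; exact hρ.le)

end Energy

end Chart

theorem exists_finset_disjoint_closedBall {α : Type*} [MetricSpace α] [SecondCountableTopology α]
    [HasBesicovitchCovering α] [MeasurableSpace α] [OpensMeasurableSpace α] (μ : Measure α)
    [SFinite μ] {s U : Set α} (hU : IsOpen U) (hμU : μ U ≠ ∞) (hsU : s ⊆ U) {P : α → ℝ → Prop}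
    (hP : ∀ᵐ x ∂μ, x ∈ s → ∀ᶠ ρ in 𝓝[>] 0, P x ρ) :
    ∃ (t : Finset α) (ρ : α → ℝ), (∀ x ∈ t, P x (ρ x) ∧ Metric.closedBall x (ρ x) ⊆ U) ∧
      (t : Set α).PairwiseDisjoint (fun x => Metric.closedBall x (ρ x)) ∧
      μ.real s / 2 ≤ ∑ x ∈ t, μ.real (Metric.closedBall x (ρ x)) := by
  rcases eq_or_ne (μ s) 0 with hs₀ | hs₀
  · exact ⟨∅, 0, by simp [measureReal_def, hs₀]⟩
  set s' := s ∩ {x | x ∈ s → ∀ᶠ ρ in 𝓝[>] 0, P x ρ}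
  have hμs' : μ s' = μ s := measure_inter_conull (mem_ae_iff.1 hP)
  obtain ⟨t, ρ, ht, -, htρ, hcov, hdisj⟩ := Besicovitch.exists_disjoint_closedBall_covering_ae μ
    (fun x => {ρ | P x ρ ∧ Metric.closedBall x ρ ⊆ U}) s' (fun x hx δ hδ => by
      have hsub : ∀ᶠ ρ in 𝓝[>] 0, Metric.closedBall x ρ ⊆ U :=
        (eventually_closedBall_subset (hU.mem_nhds (hsU hx.1))).filter_mono
          nhdsWithin_le_nhds
      exact ((hx.2 hx.1).and hsub |>.and (Ioo_mem_nhdsGT hδ)).exists) (fun _ => 1)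
    fun _ _ => one_pos
  obtain ⟨u, hut, hu⟩ := exists_finset_half_measureReal_le μ ht
    (fun _ _ => Metric.isClosed_closedBall.measurableSet) hdisj hcov
    (fun x hx => measure_ne_top_of_subset (htρ x hx).1.2 hμU)
    (measure_ne_top_of_subset (inter_subset_left.trans hsU) hμU) (hμs'.trans_ne hs₀)
  refine ⟨u, ρ, fun x hx => (htρ x (hut hx)).1, hdisj.subset hut, ?_⟩
  rwa [measureReal_def, hμs'] at hu

theorem setIntegral_add_sum_le {α ι : Type*} [MeasurableSpace α] {μ : Measure α} {s : Finset ι}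
    {U : Set α} {B : ι → Set α} {f g : α → ℝ} {a : ι → ℝ} (hU : MeasurableSet U)
    (hB : ∀ i ∈ s, MeasurableSet (B i)) (hdisj : (s : Set ι).PairwiseDisjoint B)
    (hBU : ∀ i ∈ s, B i ⊆ U) (hf : IntegrableOn f U μ) (hg : IntegrableOn g U μ)
    (heq : ∀ x ∈ U, (∀ i ∈ s, x ∉ B i) → f x = g x)
    (hle : ∀ i ∈ s, ∫ x in B i, f x ∂μ + a i ≤ ∫ x in B i, g x ∂μ) :
    ∫ x in U, f x ∂μ + ∑ i ∈ s, a i ≤ ∫ x in U, g x ∂μ := by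
  have hV : MeasurableSet (⋃ i ∈ s, B i) := s.measurableSet_biUnion hB
  have hsplit {h : α → ℝ} (hh : IntegrableOn h U μ) : ∫ x in U, h x ∂μ =
      ∑ i ∈ s, ∫ x in B i, h x ∂μ + ∫ x in U \ ⋃ i ∈ s, B i, h x ∂μ := by
    rw [← integral_biUnion_finset s hB hdisj fun i hi => hh.mono_set (hBU i hi),
      ← setIntegral_union disjoint_sdiff_right (hU.diff hV) (hh.mono_set (iUnion₂_subset hBU))
        (hh.mono_set sdiff_subset), union_sdiff_cancel (iUnion₂_subset hBU)]
  have houtside : ∫ x in U \ ⋃ i ∈ s, B i, f x ∂μ = ∫ x in U \ ⋃ i ∈ s, B i, g x ∂μ :=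
    setIntegral_congr_fun (hU.diff hV) fun x hx =>
      heq x hx.1 fun i hi hxi => hx.2 (mem_biUnion hi hxi)
  have hsum := Finset.sum_le_sum hle
  rw [Finset.sum_add_distrib] at hsum
  rw [hsplit hf, hsplit hg, houtside]
  linarith

namespace Chart

variable {n : ℕ} {F : Type*} [NormedAddCommGroup F] [InnerProductSpace ℝ F] (c : Chart n F) {z : F}
  [FiniteDimensional ℝ F] [MeasurableSpace F] [BorelSpace F] (μ : Measure F) [μ.IsAddHaarMeasure]

theorem setIntegral_secondDeriv_sq_add_sum_le {K L : ConstantWidthBody n} {ε σ R : ℝ} {t : Finset F}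
    {ρ r a : F → ℝ} {φ : F → F → ℝ} {γ : F → F → F} (hz : ‖z‖ ≤ 1)
    (h : ∀ j ∈ t, IsLocalPerturbation (c.pullback (supportPoint K.1))
      (c.pullback NormedSpace.normalize) ε σ j (ρ j) (φ j) (γ j))
    (hdisj : (t : Set F).PairwiseDisjoint fun j => Metric.closedBall j (ρ j))
    (hball : ∀ j ∈ t, Metric.closedBall j (ρ j) ⊆ Metric.ball 0 R)
    (hL : ∀ y, c.pullback (supportPoint L.1) y =
      c.pullback (supportPoint K.1) y + ∑ j ∈ t, γ j y)
    (hr : ∀ j ∈ t, r j ≤ ρ j)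
    (hgain : ∀ j ∈ t, ∫ y in Metric.closedBall j (ρ j),
        secondDeriv (c.pullback (supportPoint K.1)) z y ^ 2 ∂μ + a j ≤
      ∫ y in Metric.ball j (r j),
        secondDeriv (fun y => c.pullback (supportPoint K.1) y + γ j y) z y ^ 2 ∂μ) :
    ∫ y in Metric.ball 0 R, secondDeriv (c.pullback (supportPoint K.1)) z y ^ 2 ∂μ +
        ∑ j ∈ t, a j ≤
      ∫ y in Metric.ball 0 R, secondDeriv (c.pullback (supportPoint L.1)) z y ^ 2 ∂μ := by
  have hint (M : ConstantWidthBody n) := c.integrableOn_secondDeriv_sq μ M.2 hz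
    (Metric.isBounded_ball (x := 0) (r := R))
  refine setIntegral_add_sum_le measurableSet_ball (fun _ _ => measurableSet_closedBall) hdisj hball
    (hint K) (hint L) (fun y _ hy => ?_) fun j hj => (hgain j hj).trans ?_
  · congr 1
    refine secondDeriv_congr ?_
    filter_upwards [IsLocalPerturbation.eventually_sum_gradient_eq_zero h fun j hj hyj =>
      hy j hj (Metric.ball_subset_closedBall hyj)] with w hw
    rw [hL, hw, add_zero]
  · have hsub : Metric.ball j (r j) ⊆ Metric.closedBall j (ρ j) :=
      Metric.ball_subset_closedBall.trans (Metric.closedBall_subset_closedBall (hr j hj))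
    have heq : ∀ y ∈ Metric.ball j (r j),
        secondDeriv (fun y => c.pullback (supportPoint K.1) y + γ j y) z y ^ 2 =
          secondDeriv (c.pullback (supportPoint L.1)) z y ^ 2 := fun y hy => by
      congr 1
      refine secondDeriv_congr ?_
      filter_upwards [Metric.isOpen_ball.mem_nhds hy] with w hw
      rw [hL, (IsLocalPerturbation.sum_eq h hdisj hj (hsub hw)).2]
    rw [setIntegral_congr_fun measurableSet_ball heq]
    exact setIntegral_mono_set ((hint L).mono_set (hball j hj))
      (Eventually.of_forall fun _ => sq_nonneg _) hsub.eventuallyLE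

theorem exists_setIntegral_secondDeriv_sq_add_le (K : ConstantWidthBody n) {ε σ c₀ : ℝ} (R : ℝ)
    (hε : 0 < ε) (hε₁ : ε < 1 / 2) (hKε : IsRounded K.1 ε) (hσ : 0 < σ) (hc₀ : 0 < c₀)
    (hz : ‖z‖ ≤ 1) :
    ∃ L : ConstantWidthBody n, IsRounded L.1 (ε / 4) ∧ dist L K ≤ σ ∧
      ∫ y in Metric.ball 0 R, secondDeriv (c.pullback (supportPoint K.1)) z y ^ 2 ∂μ +
          c₀ ^ 4 / 32 * μ.real {y ∈ Metric.ball 0 R | c₀ ≤ c.defect K.1 z y} ≤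
        ∫ y in Metric.ball 0 R, secondDeriv (c.pullback (supportPoint L.1)) z y ^ 2 ∂μ := by
  obtain ⟨t, ρ, ht, hdisj, hmeas⟩ := exists_finset_disjoint_closedBall μ
    (s := {y ∈ Metric.ball 0 R | c₀ ≤ c.defect K.1 z y}) Metric.isOpen_ball
    measure_ball_lt_top.ne (sep_subset _ _) <| by
      filter_upwards [(c.lipschitzWith_supportPoint_comp_pt K.2).ae_differentiableAt,
        c.ae_tendsto_average_secondDeriv_sq μ K.2 hz] with y hdiff hlebesgue hy
      exact c.eventually_exists_isLocalPerturbation μ K.2 hε (by linarith) hKε hσ hc₀ hz hdiff hy.2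
        hlebesgue
  choose! hperturb hball using ht
  choose! φ γ hφ r hr hgain using hperturb
  have hKε' : IsRounded K.1 (ε / 4) := hKε.mono (by linarith)
  obtain ⟨L, hLε, hdist, hL⟩ := c.exists_isRounded_pullback_eq_sum K (by positivity) (by linarith)
    hKε' hσ.le hφ hdisj
  have htotal := c.setIntegral_secondDeriv_sq_add_sum_le μ hz hφ hdisj hball hL hr hgain
  rw [← Finset.mul_sum] at htotal
  have hhalf : c₀ ^ 4 / 16 * (μ.real {y ∈ Metric.ball 0 R | c₀ ≤ c.defect K.1 z y} / 2) ≤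
      c₀ ^ 4 / 16 * ∑ j ∈ t, μ.real (Metric.closedBall j (ρ j)) := by gcongr
  exact ⟨L, hLε, hdist, by linarith⟩

theorem setIntegral_secondDeriv_sq_le (K : ConstantWidthBody n) (hz : ‖z‖ ≤ 1) (R : ℝ) :
    ∫ y in Metric.ball 0 R, secondDeriv (c.pullback (supportPoint K.1)) z y ^ 2 ∂μ ≤
      μ.real (Metric.ball (0 : F) R) := by
  rw [← mul_one (μ.real _), ← smul_eq_mul, ← setIntegral_const]
  refine setIntegral_mono (c.integrableOn_secondDeriv_sq μ K.2 hz Metric.isBounded_ball)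
    (integrableOn_const measure_ball_lt_top.ne) fun y => ?_
  exact (sq_abs _).symm.trans_le (pow_le_one₀ (abs_nonneg _) (c.abs_secondDeriv_le K.2 hz y))

theorem exists_measureReal_le_defect_lt (K₀ : ConstantWidthBody n) (hz : ‖z‖ ≤ 1) {c₀ δ η : ℝ}
    (R : ℝ) (hc₀ : 0 < c₀) (hδ : 0 < δ) (hη : 0 < η) :
    ∃ K : ConstantWidthBody n, dist K K₀ < δ ∧
      μ.real {y ∈ Metric.ball 0 R | c₀ ≤ c.defect K.1 z y} < η := by
  -- A rounded body whose energy is within `c₀ ^ 4 / 32 * η` of the supremum cannot be improved.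
  set energy : ConstantWidthBody n → ℝ := fun K =>
    ∫ y in Metric.ball 0 R, secondDeriv (c.pullback (supportPoint K.1)) z y ^ 2 ∂μ
  set rounded : Set (ConstantWidthBody n) :=
    {K | dist K K₀ < δ ∧ ∃ ε, 0 < ε ∧ ε < 1 / 2 ∧ IsRounded K.1 ε}
  have hne : (energy '' rounded).Nonempty := by
    obtain ⟨K, ε, hε, hε₁, hKε, hdist⟩ := exists_isRounded_dist_lt K₀ hδ
    exact ⟨_, K, ⟨hdist, ε, hε, hε₁, hKε⟩, rfl⟩
  have hbdd : BddAbove (energy '' rounded) :=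
    ⟨_, forall_mem_image.2 fun K _ => c.setIntegral_secondDeriv_sq_le μ K hz R⟩
  obtain ⟨_, ⟨K, ⟨hK, ε, hε, hε₁, hKε⟩, rfl⟩, hlt⟩ := exists_lt_of_lt_csSup hne
    (sub_lt_self (sSup (energy '' rounded)) (by positivity : 0 < c₀ ^ 4 / 32 * η))
  refine ⟨K, hK, ?_⟩
  obtain ⟨L, hLε, hdist, hgain⟩ := c.exists_setIntegral_secondDeriv_sq_add_le μ K R hε hε₁ hKε
    (half_pos (sub_pos.2 hK)) hc₀ hz
  have hL : L ∈ rounded :=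
    ⟨by linarith [dist_triangle L K K₀], ε / 4, by positivity, by linarith, hLε⟩
  have hsup : energy L ≤ sSup (energy '' rounded) := le_csSup hbdd ⟨L, hL, rfl⟩
  exact lt_of_mul_lt_mul_left (a := c₀ ^ 4 / 32) (by linarith) (by positivity)

theorem integrableOn_defect (K : ConstantWidthBody n) (hz : ‖z‖ ≤ 1) (R : ℝ) :
    IntegrableOn (c.defect K.1 z) (Metric.ball 0 R) μ := by
  refine Measure.integrableOn_of_bounded (M := 2 + R) measure_ball_lt_top.ne
    (c.measurable_defect K.2).aestronglyMeasurable ?_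
  filter_upwards [ae_restrict_mem measurableSet_ball] with y hy
  exact c.abs_defect_le K.2 hz (mem_ball_zero_iff.1 hy).le

theorem setIntegral_defect_le (K : ConstantWidthBody n) (hz : ‖z‖ ≤ 1) {R c₀ : ℝ} (hc₀ : 0 ≤ c₀) :
    ∫ y in Metric.ball 0 R, c.defect K.1 z y ∂μ ≤ c₀ * μ.real (Metric.ball (0 : F) R) +
      (2 + R) * μ.real {y ∈ Metric.ball 0 R | c₀ ≤ c.defect K.1 z y} := by
  set S : Set F := {y | c₀ ≤ c.defect K.1 z y}
  have hS : MeasurableSet S := measurableSet_le measurable_const (c.measurable_defect K.2)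
  have hconst (a : ℝ) : IntegrableOn (fun _ : F => a) (Metric.ball 0 R) μ :=
    integrableOn_const measure_ball_lt_top.ne
  have hind : IntegrableOn (S.indicator fun _ => 2 + R) (Metric.ball 0 R) μ :=
    (hconst (2 + R)).indicator hS
  calc ∫ y in Metric.ball 0 R, c.defect K.1 z y ∂μ
      ≤ ∫ y in Metric.ball (0 : F) R, (c₀ + S.indicator (fun _ => 2 + R) y) ∂μ := by
        refine setIntegral_mono_on (c.integrableOn_defect μ K hz R) ((hconst c₀).add hind)
          measurableSet_ball fun y hy => ?_
        by_cases hyS : y ∈ S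
        · rw [indicator_of_mem hyS]
          exact (le_abs_self _).trans ((c.abs_defect_le K.2 hz (mem_ball_zero_iff.1 hy).le).trans
            (le_add_of_nonneg_left hc₀))
        · rw [indicator_of_notMem hyS, add_zero]
          exact (not_le.1 hyS).le
    _ = c₀ * μ.real (Metric.ball (0 : F) R) + (2 + R) * μ.real (Metric.ball 0 R ∩ S) := by
        rw [integral_add (hconst c₀) hind, setIntegral_indicator hS, setIntegral_const,
          setIntegral_const, smul_eq_mul, smul_eq_mul, mul_comm, mul_comm (2 + R)]

theorem exists_setIntegral_defect_lt (K₀ : ConstantWidthBody n) (hz : ‖z‖ ≤ 1) {R δ η : ℝ}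
    (hR : 0 ≤ R) (hδ : 0 < δ) (hη : 0 < η) :
    ∃ K : ConstantWidthBody n, dist K K₀ < δ ∧
      ∫ y in Metric.ball 0 R, c.defect K.1 z y ∂μ < η := by
  set V := μ.real (Metric.ball (0 : F) R)
  have hV : 0 ≤ V := measureReal_nonneg
  set c₀ := η / (2 * (V + 1)) with hc₀
  have hc₀_pos : 0 < c₀ := by positivity
  obtain ⟨K, hK, hlt⟩ := c.exists_measureReal_le_defect_lt μ K₀ hz R hc₀_pos hδ
    (by positivity : 0 < η / 2 / (2 + R))
  refine ⟨K, hK, (c.setIntegral_defect_le μ K hz hc₀_pos.le).trans_lt ?_⟩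
  rw [lt_div_iff₀' (by positivity)] at hlt
  calc c₀ * V + (2 + R) * μ.real {y ∈ Metric.ball 0 R | c₀ ≤ c.defect K.1 z y}
      < c₀ * (V + 1) + η / 2 := by gcongr; linarith
    _ = η := by rw [hc₀]; field_simp; norm_num

end Chart

theorem eventually_residual_le_of_tendsto {X : Type*} [TopologicalSpace X] {Φ : ℕ → X → ℝ}
    {Ψ : X → ℝ} {a : ℝ} (hΦ : ∀ k, Continuous (Φ k))
    (hΨ : ∀ x, Tendsto (fun k => Φ k x) atTop (𝓝 (Ψ x))) (ha : ∀ b > a, Dense {x | Ψ x < b}) :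
    ∀ᶠ x in residual X, Ψ x ≤ a := by
  obtain ⟨b, -, hab, hb⟩ := exists_seq_strictAnti_tendsto a
  have hfreq : ∀ᶠ x in residual X, ∀ j m, ∃ k ≥ m, Φ k x < b j := by
    refine eventually_countable_forall.2 fun j => eventually_countable_forall.2 fun m => ?_
    have hopen : IsOpen (⋃ k ≥ m, {x | Φ k x < b j}) :=
      isOpen_biUnion fun k _ => isOpen_lt (hΦ k) continuous_const
    have hdense : Dense (⋃ k ≥ m, {x | Φ k x < b j}) := (ha _ (hab j)).mono fun x hx => by
      obtain ⟨k, hlt, hk⟩ :=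
        (((hΨ x).eventually_lt_const hx).and (eventually_ge_atTop m)).exists
      exact mem_iUnion₂.2 ⟨k, hk, hlt⟩
    filter_upwards [residual_of_dense_open hopen hdense] with x hx
    simpa only [mem_iUnion, exists_prop, mem_ofPred_eq] using hx
  filter_upwards [hfreq] with x hx
  exact ge_of_tendsto' hb fun j => le_of_tendsto_of_frequently (hΨ x)
    ((frequently_atTop.2 (hx j)).mono fun _ => le_of_lt)

namespace Chart

section Residual

variable {n : ℕ} {F : Type*} [NormedAddCommGroup F] [InnerProductSpace ℝ F] (c : Chart n F)
  {z : F}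

/-- The difference quotient of the support point map in direction `z`. -/
def diffQuot (K : ConvexBody (E n)) (z : F) (δ : ℝ) (y : F) : E n :=
  δ⁻¹ • (supportPoint K (c.pt (y + δ • z)) - supportPoint K (c.pt y))

/-- The defect with the derivative replaced by a difference quotient, which makes it continuous in
the body. -/
def quotDefect (K : ConvexBody (E n)) (z : F) (δ : ℝ) (y : F) : ℝ :=
  c.defectForm z y (c.diffQuot K z δ y)

variable {K : ConvexBody (E n)} {y : F}

theorem norm_diffQuot_le (hK : IsOfConstantWidth K 1) (hz : ‖z‖ ≤ 1) {δ : ℝ} (hδ : 0 < δ) (y : F) :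
    ‖c.diffQuot K z δ y‖ ≤ 1 := by
  have hdist := (c.lipschitzWith_supportPoint_comp_pt hK).dist_le_mul (y + δ • z) y
  rw [dist_eq_norm, dist_eq_norm, add_sub_cancel_left, NNReal.coe_one, one_mul, norm_smul,
    Real.norm_of_nonneg hδ.le] at hdist
  rw [diffQuot, norm_smul, norm_inv, Real.norm_of_nonneg hδ.le, inv_mul_le_iff₀ hδ]
  exact hdist.trans (by gcongr)

theorem continuous_quotDefect (hK : IsOfConstantWidth K 1) (δ : ℝ) :
    Continuous (c.quotDefect K z δ) := by
  have hsupport : Continuous fun y => supportPoint K (c.pt y) :=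
    (c.lipschitzWith_supportPoint_comp_pt hK).continuous
  have hshift : Continuous fun y => supportPoint K (c.pt (y + δ • z)) :=
    hsupport.comp (continuous_id.add continuous_const)
  have hpt := c.continuous_pt
  unfold quotDefect defectForm diffQuot
  fun_prop

theorem continuous_quotDefect_body (δ : ℝ) (y : F) :
    Continuous fun K : ConstantWidthBody n => c.quotDefect K.1 z δ y := by
  have hsupport (y : F) : Continuous fun K : ConstantWidthBody n => supportPoint K.1 (c.pt y) :=
    continuous_supportPoint_body (c.pt_ne_zero y)
  unfold quotDefect defectForm diffQuot
  fun_prop (disch := exact hsupport _)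

theorem tendsto_quotDefect (hd : DifferentiableAt ℝ (supportPoint K ∘ c.pt) y) :
    Tendsto (fun δ => c.quotDefect K z δ y) (𝓝[≠] 0) (𝓝 (c.defect K z y)) := by
  have hslope : Tendsto (fun δ => c.diffQuot K z δ y) (𝓝[≠] 0)
      (𝓝 (lineDeriv ℝ (supportPoint K ∘ c.pt) y z)) :=
    hd.lineDifferentiableAt.hasLineDerivAt.tendsto_slope_zero
  exact (hslope.inner tendsto_const_nhds).sub (tendsto_const_nhds.mul (hslope.norm.pow 2))

theorem defect_nonneg (hK : IsOfConstantWidth K 1)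
    (hd : DifferentiableAt ℝ (supportPoint K ∘ c.pt) y) : 0 ≤ c.defect K z y := by
  obtain ⟨A, hA⟩ := c.exists_hasFDerivAt_supportPoint hK hd
  rw [c.defect_eq hA]
  exact sub_nonneg.2 (hK.norm_mul_norm_deriv_sq_le (c.pt_ne_zero y) hA (c.ι z))

theorem defect_smul (K : ConvexBody (E n)) (a : ℝ) (z y : F) :
    c.defect K (a • z) y = a ^ 2 * c.defect K z y := by
  rw [defect, defect, lineDeriv_smul, defectForm, defectForm, map_smul, real_inner_smul_left,
    real_inner_smul_right, norm_smul, mul_pow, Real.norm_eq_abs, sq_abs]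
  ring

variable [MeasurableSpace F] [BorelSpace F] (μ : Measure F)

theorem ae_norm_quotDefect_le (K : ConstantWidthBody n) (hz : ‖z‖ ≤ 1) (R : ℝ) {δ : ℝ}
    (hδ : 0 < δ) : ∀ᵐ y ∂μ.restrict (Metric.ball 0 R), ‖c.quotDefect K.1 z δ y‖ ≤ 2 + R := by
  filter_upwards [ae_restrict_mem measurableSet_ball] with y hy
  exact c.abs_defectForm_le (c.norm_diffQuot_le K.2 hz hδ y) hz (mem_ball_zero_iff.1 hy).le

variable [FiniteDimensional ℝ F] [μ.IsAddHaarMeasure]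

theorem continuous_setIntegral_quotDefect (hz : ‖z‖ ≤ 1) (R : ℝ) {δ : ℝ} (hδ : 0 < δ) :
    Continuous fun K : ConstantWidthBody n => ∫ y in Metric.ball 0 R, c.quotDefect K.1 z δ y ∂μ :=
  continuous_of_dominated (bound := fun _ => 2 + R)
    (fun K => (c.continuous_quotDefect K.2 δ).aestronglyMeasurable)
    (fun K => c.ae_norm_quotDefect_le μ K hz R hδ)
    (integrableOn_const measure_ball_lt_top.ne)
    (Eventually.of_forall fun y => c.continuous_quotDefect_body δ y)

theorem tendsto_setIntegral_quotDefect (K : ConstantWidthBody n) (hz : ‖z‖ ≤ 1) (R : ℝ) {δ : ℕ → ℝ}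
    (hδ : ∀ k, 0 < δ k) (hlim : Tendsto δ atTop (𝓝 0)) :
    Tendsto (fun k => ∫ y in Metric.ball 0 R, c.quotDefect K.1 z (δ k) y ∂μ) atTop
      (𝓝 (∫ y in Metric.ball 0 R, c.defect K.1 z y ∂μ)) := by
  have hlim_ne : Tendsto δ atTop (𝓝[≠] 0) :=
    tendsto_nhdsWithin_iff.2 ⟨hlim, Eventually.of_forall fun k => (hδ k).ne'⟩
  refine tendsto_integral_of_dominated_convergence (fun _ => 2 + R)
    (fun k => (c.continuous_quotDefect K.2 _).aestronglyMeasurable)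
    (integrableOn_const measure_ball_lt_top.ne)
    (fun k => c.ae_norm_quotDefect_le μ K hz R (hδ k)) ?_
  filter_upwards [ae_restrict_of_ae (c.lipschitzWith_supportPoint_comp_pt K.2).ae_differentiableAt]
    with y hy
  exact (c.tendsto_quotDefect hy).comp hlim_ne

theorem eventually_setIntegral_defect_le_zero (hz : ‖z‖ ≤ 1) {R : ℝ} (hR : 0 ≤ R) :
    ∀ᶠ K : ConstantWidthBody n in residual (ConstantWidthBody n),
      ∫ y in Metric.ball 0 R, c.defect K.1 z y ∂μ ≤ 0 := by
  obtain ⟨δ, -, hδ, hlim⟩ := exists_seq_strictAnti_tendsto (0 : ℝ)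
  refine eventually_residual_le_of_tendsto
    (fun k => c.continuous_setIntegral_quotDefect μ hz R (hδ k))
    (fun K => c.tendsto_setIntegral_quotDefect μ K hz R hδ hlim) fun η hη => ?_
  refine Metric.dense_iff.2 fun K₀ r hr => ?_
  obtain ⟨K, hK, hlt⟩ := c.exists_setIntegral_defect_lt μ K₀ hz hR hr hη
  exact ⟨K, hK, hlt⟩

theorem eventually_ae_defect_eq_zero_of_norm_le (hz : ‖z‖ ≤ 1) :
    ∀ᶠ K : ConstantWidthBody n in residual (ConstantWidthBody n),
      ∀ᵐ y ∂μ, c.defect K.1 z y = 0 := by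
  have hint : ∀ᶠ K : ConstantWidthBody n in residual (ConstantWidthBody n), ∀ R : ℕ,
      ∫ y in Metric.ball 0 (R : ℝ), c.defect K.1 z y ∂μ ≤ 0 :=
    eventually_countable_forall.2 fun R =>
      c.eventually_setIntegral_defect_le_zero μ hz R.cast_nonneg
  filter_upwards [hint] with K hK
  have hnonneg : ∀ᵐ y ∂μ, 0 ≤ c.defect K.1 z y := by
    filter_upwards [(c.lipschitzWith_supportPoint_comp_pt K.2).ae_differentiableAt] with y hy
    exact c.defect_nonneg K.2 hy
  have hball (R : ℕ) : ∀ᵐ y ∂μ, y ∈ Metric.ball 0 (R : ℝ) → c.defect K.1 z y = 0 := by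
    refine (ae_restrict_iff' measurableSet_ball).1 ?_
    exact (setIntegral_eq_zero_iff_of_nonneg_ae (ae_restrict_of_ae hnonneg)
      (c.integrableOn_defect μ K hz R)).1 (le_antisymm (hK R)
      (integral_nonneg_of_ae (ae_restrict_of_ae hnonneg)))
  filter_upwards [ae_all_iff.2 hball] with y hy
  obtain ⟨R, hR⟩ := exists_nat_gt ‖y‖
  exact hy R (mem_ball_zero_iff.2 hR)

theorem eventually_ae_defect_eq_zero (z : F) :
    ∀ᶠ K : ConstantWidthBody n in residual (ConstantWidthBody n),
      ∀ᵐ y ∂μ, c.defect K.1 z y = 0 := by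
  have hpos : 0 < (1 + ‖z‖)⁻¹ := by positivity
  have hz : ‖(1 + ‖z‖)⁻¹ • z‖ ≤ 1 := by
    rw [norm_smul, Real.norm_of_nonneg hpos.le, inv_mul_le_iff₀ (by positivity)]
    linarith
  filter_upwards [c.eventually_ae_defect_eq_zero_of_norm_le μ hz] with K hK
  filter_upwards [hK] with y hy
  rw [defect_smul] at hy
  exact (mul_eq_zero.1 hy).resolve_left (by positivity)

end Residual

section Pointwise

variable {n : ℕ} {F : Type*} [NormedAddCommGroup F] [InnerProductSpace ℝ F] (c : Chart n F)
  {K : ConvexBody (E n)} {A : E n →L[ℝ] E n} {y : F}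

theorem inner_deriv_eq_of_denseRange {ι' : Type*} {d : ι' → F} (hd : DenseRange d)
    (hA : HasFDerivAt (supportPoint K) A (c.pt y)) (h : ∀ i, c.defect K (d i) y = 0) (z : F) :
    ⟪A (c.ι z), c.ι z⟫ = ‖c.pt y‖ * ‖A (c.ι z)‖ ^ 2 := by
  refine hd.induction_on z (isClosed_eq (by fun_prop) (by fun_prop)) fun i => ?_
  rw [← sub_eq_zero, ← c.defect_eq hA, h i]

theorem exists_eq_smul_pt_add (y : F) (x : E n) : ∃ a w, x = (a : ℝ) • c.pt y + c.ι w := by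
  refine ⟨⟪c.e, x⟫, c.π x - ⟪c.e, x⟫ • y, ?_⟩
  conv_lhs => rw [← c.decomp x]
  rw [pt, map_sub, map_smul, smul_add]
  abel

theorem inner_deriv_eq_of_forall_ι (hK : IsOfConstantWidth K 1)
    (hA : HasFDerivAt (supportPoint K) A (c.pt y))
    (h : ∀ z, ⟪A (c.ι z), c.ι z⟫ = ‖c.pt y‖ * ‖A (c.ι z)‖ ^ 2) (x : E n) :
    ⟪A x, x⟫ = ‖c.pt y‖ * ‖A x‖ ^ 2 := by
  obtain ⟨a, w, rfl⟩ := c.exists_eq_smul_pt_add y x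
  have hAx : A (a • c.pt y + c.ι w) = A (c.ι w) := by
    rw [map_add, map_smul, hK.deriv_apply_self (c.pt_ne_zero y) hA, smul_zero, zero_add]
  rw [hAx, inner_add_right, real_inner_smul_right, hK.inner_deriv_self (c.pt_ne_zero y) hA,
    mul_zero, zero_add, h]

end Pointwise

end Chart

theorem IsOfConstantWidth.hasFDerivAt_supportPoint_normalize {n : ℕ} {K : ConvexBody (E n)}
    {A : E n →L[ℝ] E n} {v : E n} (hK : IsOfConstantWidth K 1) (hv : v ≠ 0)
    (hA : HasFDerivAt (supportPoint K) A v) :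
    HasFDerivAt (supportPoint K) (‖v‖ • A) (NormedSpace.normalize v) := by
  have hpos : 0 < ‖v‖ := norm_pos_iff.2 hv
  have hscale : HasFDerivAt (fun w : E n => ‖v‖ • w) (‖v‖ • ContinuousLinearMap.id ℝ (E n))
      (NormedSpace.normalize v) := (hasFDerivAt_id _).const_smul ‖v‖
  have hA' : HasFDerivAt (supportPoint K) A (‖v‖ • NormedSpace.normalize v) := by
    rwa [norm_smul_normalize]
  refine ((hA'.comp _ hscale).congr_fderiv (by ext w; simp)).congr_of_eventuallyEq ?_
  filter_upwards [isOpen_ne.mem_nhds ((normalize_eq_zero_iff v).not.2 hv)] with w hw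
  exact (hK.supportPoint_smul hpos hw).symm

namespace Chart

section Sphere

variable {n : ℕ} {F : Type*} [NormedAddCommGroup F] [InnerProductSpace ℝ F] (c : Chart n F)

theorem lipschitzWith_normalize_pt : LipschitzWith 1 fun y => NormedSpace.normalize (c.pt y) := by
  refine LipschitzWith.of_dist_le_mul fun v w => ?_
  rw [dist_eq_norm, dist_eq_norm, NNReal.coe_one, one_mul]
  refine (norm_normalize_sub_le (c.one_le_norm_pt v) (c.one_le_norm_pt w)).trans_eq ?_
  rw [c.pt_sub_pt, LinearIsometry.norm_map]

theorem exists_normalize_pt_eq {u : E n} (hu : ‖u‖ = 1) (h : 0 < ⟪c.e, u⟫) :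
    ∃ y, NormedSpace.normalize (c.pt y) = u := by
  refine ⟨⟪c.e, u⟫⁻¹ • c.π u, ?_⟩
  rw [← normalize_smul_of_pos h, c.smul_pt h.ne', normalize_eq_self_of_norm_eq_one hu]

variable [FiniteDimensional ℝ F] [MeasurableSpace F] [BorelSpace F]

theorem eventually_ae_hasProjectionDeriv_normalize_pt (μ : Measure F) [μ.IsAddHaarMeasure] :
    ∀ᶠ K : ConstantWidthBody n in residual (ConstantWidthBody n), ∀ᵐ y ∂μ,
      HasProjectionDeriv K.1 (NormedSpace.normalize (c.pt y)) := by
  have hall : ∀ᶠ K : ConstantWidthBody n in residual (ConstantWidthBody n), ∀ i,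
      ∀ᵐ y ∂μ, c.defect K.1 (TopologicalSpace.denseSeq F i) y = 0 :=
    eventually_countable_forall.2 fun i => c.eventually_ae_defect_eq_zero μ _
  filter_upwards [hall] with K hK
  filter_upwards [ae_all_iff.2 hK, (c.lipschitzWith_supportPoint_comp_pt K.2).ae_differentiableAt]
    with y hy hdiff
  obtain ⟨A, hA⟩ := c.exists_hasFDerivAt_supportPoint K.2 hdiff
  refine ⟨_, K.2.hasFDerivAt_supportPoint_normalize (c.pt_ne_zero y) hA, fun x => ?_⟩
  have hx := c.inner_deriv_eq_of_forall_ι K.2 hA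
    (c.inner_deriv_eq_of_denseRange (TopologicalSpace.denseRange_denseSeq F) hA hy) x
  rw [smul_apply, real_inner_smul_left, norm_smul, norm_norm, hx]
  ring

theorem eventually_ae_hasProjectionDeriv :
    ∀ᶠ K : ConstantWidthBody n in residual (ConstantWidthBody n),
      ∀ᵐ u ∂(μH[Module.finrank ℝ F] : Measure (E n)),
        ‖u‖ = 1 → 0 < ⟪c.e, u⟫ → HasProjectionDeriv K.1 u := by
  have := isAddHaarMeasure_hausdorffMeasure (E := F)
  filter_upwards [c.eventually_ae_hasProjectionDeriv_normalize_pt μH[Module.finrank ℝ F]] with K hK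
  rw [ae_iff] at hK ⊢
  have himage := c.lipschitzWith_normalize_pt.hausdorffMeasure_image_le
    (d := Module.finrank ℝ F) (Nat.cast_nonneg _)
    {y | ¬HasProjectionDeriv K.1 (NormedSpace.normalize (c.pt y))}
  rw [hK, mul_zero] at himage
  refine measure_mono_null (fun u hu => ?_) (le_antisymm himage zero_le)
  rw [mem_ofPred_eq] at hu
  push Not at hu
  obtain ⟨hu_norm, hu_pos, hu_not⟩ := hu
  obtain ⟨y, rfl⟩ := c.exists_normalize_pt_eq hu_norm hu_pos
  exact ⟨y, hu_not, rfl⟩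

end Sphere

/-- The gnomonic chart centred at a unit vector. -/
def ofUnit {n : ℕ} (e : E n) (he : ‖e‖ = 1) : Chart n (Submodule.span ℝ {e})ᗮ where
  e := e
  norm_e := he
  ι := (Submodule.span ℝ {e})ᗮ.subtypeₗᵢ
  π := (Submodule.span ℝ {e})ᗮ.orthogonalProjectionOnto
  inner_e_ι y := Submodule.mem_orthogonal_singleton_iff_inner_right.1 y.2
  inner_π x y := by
    rw [real_inner_comm, Submodule.inner_orthogonalProjectionOnto_eq_of_mem_left, real_inner_comm]
    rfl
  decomp x := by
    have hsum := Submodule.starProjection_add_starProjection_orthogonal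
      (K := Submodule.span ℝ {e}) x
    rwa [Submodule.starProjection_unit_singleton ℝ he] at hsum

end Chart

theorem eventually_ae_hasProjectionDeriv_of_inner_pos {n : ℕ} {e : E n} (he : ‖e‖ = 1) :
    ∀ᶠ K : ConstantWidthBody n in residual (ConstantWidthBody n),
      ∀ᵐ u ∂(μH[(n : ℝ) - 1] : Measure (E n)),
        ‖u‖ = 1 → 0 < ⟪e, u⟫ → HasProjectionDeriv K.1 u := by
  have he₀ : e ≠ 0 := norm_ne_zero_iff.1 (he.trans_ne one_ne_zero)
  have hfinrank := Submodule.finrank_add_finrank_orthogonal (Submodule.span ℝ {e})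
  rw [finrank_span_singleton he₀, finrank_euclideanSpace_fin] at hfinrank
  have hdim : (n : ℝ) - 1 = Module.finrank ℝ (Submodule.span ℝ {e})ᗮ := by
    rw [sub_eq_iff_eq_add']
    exact_mod_cast hfinrank.symm
  rw [hdim]
  exact (Chart.ofUnit e he).eventually_ae_hasProjectionDeriv

theorem exists_inner_single_pos {n : ℕ} {u : E n} (hu : u ≠ 0) :
    ∃ i : Fin n, 0 < ⟪EuclideanSpace.single i (1 : ℝ), u⟫ ∨
      0 < ⟪-EuclideanSpace.single i (1 : ℝ), u⟫ := by
  obtain ⟨i, hi⟩ : ∃ i, u i ≠ 0 := by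
    contrapose! hu
    exact PiLp.ext hu
  refine ⟨i, ?_⟩
  rcases hi.lt_or_gt with hneg | hpos
  · exact Or.inr (by simpa [inner_neg_left, EuclideanSpace.inner_single_left] using hneg)
  · exact Or.inl (by simpa [EuclideanSpace.inner_single_left] using hpos)

theorem eventually_ae_hasProjectionDeriv (n : ℕ) :
    ∀ᶠ K : ConstantWidthBody n in residual (ConstantWidthBody n),
      ∀ᵐ u ∂(μH[(n : ℝ) - 1] : Measure (E n)), ‖u‖ = 1 → HasProjectionDeriv K.1 u := by
  have hnorm (i : Fin n) : ‖EuclideanSpace.single i (1 : ℝ)‖ = 1 := by simp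
  have hpos := eventually_countable_forall.2 fun i : Fin n =>
    eventually_ae_hasProjectionDeriv_of_inner_pos (hnorm i)
  have hneg := eventually_countable_forall.2 fun i : Fin n =>
    eventually_ae_hasProjectionDeriv_of_inner_pos ((norm_neg _).trans (hnorm i))
  filter_upwards [hpos, hneg] with K hK hK'
  filter_upwards [ae_all_iff.2 hK, ae_all_iff.2 hK'] with u hu hu' hu₁
  obtain ⟨i, hi | hi⟩ := exists_inner_single_pos (norm_ne_zero_iff.1 (hu₁.trans_ne one_ne_zero))
  exacts [hu i hu₁ hi, hu' i hu₁ hi]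

end

end ConstWidth

theorem mainTheorem2 (n : ℕ) (hn : 2 ≤ n) :
    ∀ᶠ K : ConstWidth.ConstantWidthBody n in residual (ConstWidth.ConstantWidthBody n),
      ∀ᵐ u ∂((μH[(n : ℝ) - 1] : Measure (ConstWidth.E n)).restrict (Metric.sphere 0 1)),
        (∀ t : ConstWidth.E n, ‖t‖ = 1 → ⟪u, t⟫ = 0 →
            ConstWidth.HasRadiusOfCurvature K.1 u t 1) ∨
        (∃ t : ConstWidth.E n, ‖t‖ = 1 ∧ ⟪u, t⟫ = 0 ∧
            ConstWidth.HasRadiusOfCurvature K.1 u t 0) := by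
  filter_upwards [ConstWidth.eventually_ae_hasProjectionDeriv n] with K hK
  rw [ae_restrict_iff' Metric.isClosed_sphere.measurableSet]
  filter_upwards [hK] with u hKu hu
  have hu₁ : ‖u‖ = 1 := mem_sphere_zero_iff_norm.1 hu
  exact K.2.curvature_alternative hu₁ (hKu hu₁)
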